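/- Let $n\ge 0$ and let $\triangle\subset\mathbb R^n$ be the simplex with vertices $(n,-1,\ldots,-1),\ (-1,n,\ldots,-1),\ \ldots,\ (-1,\ldots,-1,n),\ (-1,\ldots,-1)$, that is, a lattice translate of $n+1$ times the standard unimodular simplex. Then $\triangle$ is reflexive: it is a lattice polytope (with respect to $\mathbb Z^n$) with the origin in its interior, and its polar dual $\{y : \langle x,y\rangle\ge -1 \text{ for all } x\in\triangle\}$ is a lattice polytope. Moreover $\triangle$ admits a regular projective triangulation, i.e. a finite triangulation $\mathcal T$ of $\triangle$ with lattice points as vertices such that 1. $\mathcal T$ is unimodular: every maximal simplex is an $n$-simplex of normalized volume $1$; 2. $\mathcal T$ is coherent: there is a convex function $f$ on $\triangle$ such that for every maximal simplex $s$ of $\mathcal T$ there is an affine function $g_s$ with $f=g_s$ on $s$ and $g_s<f$ on $\triangle\setminus s$; 3. the origin is a vertex of every maximal simplex of $\mathcal T$. Such a $\mathcal T$ can be obtained by iterated star subdivisions of the fan $\Sigma_\triangle$ of cones over the proper faces of $\triangle$ (the empty face giving $\{0\}$), ordered by faces: there are a $\mathcal T$ as above and an enumeration $v_1,\ldots,v_N$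 without repetition of all lattice points of $\partial\triangle$, such that the dimension of the smallest face of $\triangle$ containing $v_i$ is non-increasing in $i$, and such that the fan of the cones over the simplices of $\mathcal T$ equals $\Sigma^N$, where $\Sigma^0=\Sigma_\triangle$ and $\Sigma^i=(\Sigma^{i-1})^*(v_i)$. Here, for a fan $\Sigma$ and a lattice vector $v$ in its support, the star subdivision $\Sigma^*(v)$ consists of the cones $\sigma\in\Sigma$ with $v\notin\sigma$, and of the cones generated by $\tau$ and $v$ for $v\notin\tau\in\Sigma$ with $\{v\}\cup\tau\subset\sigma$ for some $\sigma\in\Sigma$. -/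

import Mathlib

namespace ToricTriangulation

variable {n : ℕ}

/-! ### Lattice polytopes in `ℝⁿ`, with lattice `ℤⁿ` -/

/-- The points of the lattice `ℤⁿ ⊆ ℝⁿ`. -/
def IsLatticePoint (x : Fin n → ℝ) : Prop :=
  ∃ m : Fin n → ℤ, ∀ i, x i = (m i : ℝ)

/-- A lattice polytope: the convex hull of finitely many lattice points. -/
def IsLatticePolytope (P : Set (Fin n → ℝ)) : Prop :=
  ∃ S : Set (Fin n → ℝ), S.Finite ∧ (∀ x ∈ S, IsLatticePoint x) ∧ P = convexHull ℝ S

/-- The polar dual `P^∨ = {y | ⟨x, y⟩ ≥ -1 for all x ∈ P}`. -/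
def polarDual (P : Set (Fin n → ℝ)) : Set (Fin n → ℝ) :=
  {y | ∀ x ∈ P, -1 ≤ ∑ i, x i * y i}

/-- A reflexive polytope: a lattice polytope with the origin in its interior whose polar dual is
a lattice polytope, too. -/
def IsReflexive (P : Set (Fin n → ℝ)) : Prop :=
  IsLatticePolytope P ∧ (0 : Fin n → ℝ) ∈ interior P ∧ IsLatticePolytope (polarDual P)

/-- The polytope in `ℝⁿ` with vertices `(n,-1,…,-1), (-1,n,…,-1), …, (-1,…,-1,n)` and
`(-1,…,-1)`. -/
def projectiveSpacePolytope (n : ℕ) : Set (Fin n → ℝ) :=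
  convexHull ℝ (insert (fun _ => (-1 : ℝ))
    (Set.range fun i : Fin n => fun j : Fin n => if j = i then (n : ℝ) else -1))

/-- The dimension of the smallest face of `P` that contains `x`. The faces of a polytope are its
exposed faces. -/
noncomputable def faceDim (P : Set (Fin n → ℝ)) (x : Fin n → ℝ) : ℕ :=
  Module.finrank ℝ
    (vectorSpan ℝ (⋂₀ {F : Set (Fin n → ℝ) | IsExposed ℝ P F ∧ x ∈ F}))

/-! ### Triangulations -/

/-- `T` is a (finite) triangulation of `P` all of whose vertices are lattice points. -/
def IsLatticeTriangulation (T : Geometry.SimplicialComplex ℝ (Fin n → ℝ))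
    (P : Set (Fin n → ℝ)) : Prop :=
  T.faces.Finite ∧ T.space = P ∧ ∀ v ∈ T.vertices, IsLatticePoint v

/-- The normalized volume (`n!` times the Euclidean volume) of the `n`-simplex with vertices
`v 0, …, v n`. -/
noncomputable def normalizedVolume (v : Fin (n + 1) → Fin n → ℝ) : ℝ :=
  |(Matrix.of fun i j : Fin n => v i.succ j - v 0 j).det|

/-- Every maximal simplex is an `n`-simplex of normalized volume `1`. -/
def IsUnimodular (T : Geometry.SimplicialComplex ℝ (Fin n → ℝ)) : Prop :=
  ∀ s ∈ T.facets, ∃ v : Fin (n + 1) → Fin n → ℝ,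
    Set.range v = (s : Set (Fin n → ℝ)) ∧ normalizedVolume v = 1

/-- Coherence of a triangulation `T` of `P`: there is a convex function on `P` that is affine on
each maximal simplex, such that the affine function of each maximal simplex lies strictly below it
at all points of `P` outside that simplex (a strictly convex `T`-piecewise linear function). -/
def IsCoherent (T : Geometry.SimplicialComplex ℝ (Fin n → ℝ)) (P : Set (Fin n → ℝ)) : Prop :=
  ∃ f : (Fin n → ℝ) → ℝ, ConvexOn ℝ P f ∧
    ∀ s ∈ T.facets, ∃ g : (Fin n → ℝ) →ᵃ[ℝ] ℝ,
      (∀ x ∈ convexHull ℝ (s : Set (Fin n → ℝ)), f x = g x) ∧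
      ∀ x ∈ P, x ∉ convexHull ℝ (s : Set (Fin n → ℝ)) → g x < f x

/-- A regular projective triangulation of `P`: a triangulation with lattice points as vertices
that is unimodular and coherent, and has the origin as a vertex of every maximal simplex. -/
def IsRegularProjectiveTriangulation (T : Geometry.SimplicialComplex ℝ (Fin n → ℝ))
    (P : Set (Fin n → ℝ)) : Prop :=
  IsLatticeTriangulation T P ∧ IsUnimodular T ∧ IsCoherent T P ∧
    ∀ s ∈ T.facets, (0 : Fin n → ℝ) ∈ s

/-! ### Fans and star subdivisions -/

/-- The fan `Σ_P` of the cones over the proper faces of `P`; the empty face gives the cone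
`{0}`. -/
def faceFan (P : Set (Fin n → ℝ)) : Set (PointedCone ℝ (Fin n → ℝ)) :=
  {σ | ∃ F : Set (Fin n → ℝ), IsExposed ℝ P F ∧ F ≠ P ∧ σ = PointedCone.hull ℝ F}

/-- The collection `Σ_{P,T}` of the cones over the simplices of `T`; where the origin is a vertex
of every maximal simplex, it is the fan induced by `T`. -/
def triangulationFan (T : Geometry.SimplicialComplex ℝ (Fin n → ℝ)) :
    Set (PointedCone ℝ (Fin n → ℝ)) :=
  {σ | ∃ s ∈ T.faces, σ = PointedCone.hull ℝ (s : Set (Fin n → ℝ))}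

/-- The star subdivision `Σ^*(v)`: the cones of `Σ` that do not contain `v`, and the cones
generated by `τ` and `v` where `v ∉ τ ∈ Σ` and `{v} ∪ τ ⊆ σ` for some `σ ∈ Σ`. -/
def starSubdivision (Fan : Set (PointedCone ℝ (Fin n → ℝ))) (v : Fin n → ℝ) :
    Set (PointedCone ℝ (Fin n → ℝ)) :=
  {σ | σ ∈ Fan ∧ v ∉ σ} ∪
    {ρ | ∃ τ ∈ Fan, v ∉ τ ∧ (∃ σ ∈ Fan, v ∈ σ ∧ τ ≤ σ) ∧ ρ = τ ⊔ PointedCone.hull ℝ {v}}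

end ToricTriangulation

/-!
Modulo `(1, …, 1)`, the cone over a face of the polytope is the orthant `ℝ^S≥0` spanned by a proper
subset `S` of the coordinates of `ℝⁿ⁺¹`. Its lattice points are those of `ℕ^S` whose coordinate sum
is divisible by `d = n + 1`, and the lattice points on the face are those with coordinate sum `d`.

The lattice points in the interior of the face spanned by `T` are `𝟙_T + w`, where `w ∈ ℕ^T` lies in
the simplex of coordinate sum `m = d - |T|`. They are inserted starting with the corners
`𝟙_T + m eᵢ`, and then recursively through the faces of this inner simplex. Once the corners are
inserted, the coefficients of a lattice point of the cone over `T` split into those of a lattice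
point of the cone over the inner simplex, which become natural numbers by induction on `d`, and
those of a lattice point of the cone over a proper face of `T`, which is subdivided later. Since all
lattice points end up with natural coefficients, the rays of each maximal cone generate the lattice,
which is unimodularity.

A star subdivision preserves coherence: lowering the support function slightly at the new ray keeps
it strictly convex. As all rays end on the boundary of the polytope, the cones cut out a
triangulation of the polytope in which every maximal simplex contains the origin.
-/

namespace ToricTriangulation

/-! ### Coefficients under star subdivisions -/

section Coefficients

variable {Λ Λ' : Type*}

/-- The largest `c` with `c • κ ≤ a`, for coefficients `0 ≤ κ ≠ 0` and `0 ≤ a`. For `κ = 0` the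
infimum is over the empty set and the value is `0`. -/
noncomputable def starCoeff (κ a : Λ →₀ ℝ) : ℝ := ⨅ r : κ.support, a r / κ r

/-- If `κ` and `a` are the coefficients of vectors `v` and `x` with respect to a simplicial fan,
these are the coefficients of `x` with respect to the star subdivision at `v`. -/
noncomputable def starReduce (v : Λ) (κ a : Λ →₀ ℝ) : Λ →₀ ℝ :=
  a - starCoeff κ a • κ + Finsupp.single v (starCoeff κ a)

/-- The effect of the star subdivision at `v` on a coefficient system `κ`, which records the
coefficients `κ u` of every label `u` with respect to the current simplicial fan. -/
noncomputable def subdivide (κ : Λ → Λ →₀ ℝ) (v : Λ) (u : Λ) : Λ →₀ ℝ :=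
  starReduce v (κ v) (κ u)

variable {v : Λ} {κ a : Λ →₀ ℝ}

theorem starCoeff_nonneg (hκ : 0 ≤ κ) (ha : 0 ≤ a) : 0 ≤ starCoeff κ a :=
  Real.iInf_nonneg fun r => div_nonneg (ha r) (hκ r)

theorem starCoeff_smul_le (hκ : 0 ≤ κ) (ha : 0 ≤ a) : starCoeff κ a • κ ≤ a := by
  intro r
  by_cases hr : κ r = 0
  · simpa [hr] using ha r
  · have hpos : 0 < κ r := (hκ r).lt_of_ne' hr
    have hle : starCoeff κ a ≤ a r / κ r :=
      ciInf_le (Finite.bddBelow_range fun r : κ.support => a r / κ r)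
        ⟨r, Finsupp.mem_support_iff.2 hr⟩
    simpa using (le_div_iff₀ hpos).1 hle

theorem exists_eq_starCoeff_mul (h : κ ≠ 0) : ∃ r ∈ κ.support, a r = starCoeff κ a * κ r := by
  have : Nonempty κ.support := (Finsupp.support_nonempty_iff.2 h).to_subtype
  obtain ⟨⟨r, hr⟩, h⟩ := exists_eq_ciInf_of_finite (f := fun r : κ.support => a r / κ r)
  exact ⟨r, hr, (div_eq_iff (Finsupp.mem_support_iff.1 hr)).1 h⟩

theorem starCoeff_eq_of_smul_le {c : ℝ} (hκ : 0 ≤ κ) (ha : 0 ≤ a) (hc : c • κ ≤ a) {r : Λ}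
    (hr : r ∈ κ.support) (h : a r = c * κ r) : starCoeff κ a = c := by
  have hpos : 0 < κ r := (hκ r).lt_of_ne' (Finsupp.mem_support_iff.1 hr)
  refine le_antisymm ?_ ?_
  · have := starCoeff_smul_le hκ ha r
    rw [h] at this
    exact le_of_mul_le_mul_right this hpos
  · obtain ⟨s, hs, hs'⟩ := exists_eq_starCoeff_mul (a := a)
      (Finsupp.support_nonempty_iff.1 ⟨r, hr⟩)
    have := hc s
    rw [hs'] at this
    exact le_of_mul_le_mul_right this ((hκ s).lt_of_ne' (Finsupp.mem_support_iff.1 hs))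

theorem starReduce_eq_self_of_apply_eq_zero (hκ : 0 ≤ κ) (ha : 0 ≤ a) {r : Λ}
    (hr : r ∈ κ.support) (h : a r = 0) : starReduce v κ a = a := by
  have hc : starCoeff κ a = 0 :=
    starCoeff_eq_of_smul_le hκ ha (by simpa using ha) hr (by simpa using h)
  simp [starReduce, hc]

theorem starReduce_nonneg (hκ : 0 ≤ κ) (ha : 0 ≤ a) : 0 ≤ starReduce v κ a :=
  add_nonneg (sub_nonneg.2 (starCoeff_smul_le hκ ha))
    (Finsupp.single_nonneg.2 (starCoeff_nonneg hκ ha))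

theorem support_starReduce_subset {S : Set Λ} (hv : v ∈ S) (hκ : ↑κ.support ⊆ S)
    (ha : ↑a.support ⊆ S) : ↑(starReduce v κ a).support ⊆ S := by
  classical
  intro r hr
  by_contra hS
  have hκr : κ r = 0 := Finsupp.notMem_support_iff.1 fun h => hS (hκ h)
  have har : a r = 0 := Finsupp.notMem_support_iff.1 fun h => hS (ha h)
  have hvr : r ≠ v := fun h => hS (h ▸ hv)
  exact Finsupp.mem_support_iff.1 hr (by simp [starReduce, hκr, har, hvr])

theorem linearCombination_starReduce {E : Type*} [AddCommGroup E] [Module ℝ E] {vec : Λ → E}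
    (h : Finsupp.linearCombination ℝ vec κ = vec v) (a : Λ →₀ ℝ) :
    Finsupp.linearCombination ℝ vec (starReduce v κ a) = Finsupp.linearCombination ℝ vec a := by
  simp [starReduce, h]

@[simp] theorem starReduce_single (v : Λ) (a : Λ →₀ ℝ) :
    starReduce v (Finsupp.single v 1) a = a := by
  simp [starReduce]

theorem starCoeff_add_mapDomain {f : Λ → Λ'} (hf : f.Injective) {N : Λ' →₀ ℝ}
    (hN : ∀ r ∈ κ.support, N (f r) = 0) :
    starCoeff (κ.mapDomain f) (N + a.mapDomain f) = starCoeff κ a := by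
  classical
  have hsupp := Finsupp.mapDomain_support_of_injective hf κ
  refine (Function.Surjective.iInf_congr
    (fun r : κ.support => ⟨f r, hsupp ▸ Finset.mem_image_of_mem f r.2⟩) ?_ fun r => ?_).symm
  · rintro ⟨s, hs⟩
    rw [hsupp] at hs
    obtain ⟨r, hr, rfl⟩ := Finset.mem_image.1 hs
    exact ⟨⟨r, hr⟩, rfl⟩
  · simp [Finsupp.mapDomain_apply hf, hN r r.2]

theorem starReduce_add_mapDomain {f : Λ → Λ'} (hf : f.Injective) {N : Λ' →₀ ℝ}
    (hN : ∀ r ∈ κ.support, N (f r) = 0) :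
    starReduce (f v) (κ.mapDomain f) (N + a.mapDomain f) = N + (starReduce v κ a).mapDomain f := by
  simp only [starReduce, starCoeff_add_mapDomain hf hN, Finsupp.mapDomain_add,
    Finsupp.mapDomain_single, sub_eq_add_neg, ← neg_smul, Finsupp.mapDomain_smul, add_assoc]

theorem foldl_subdivide_add_mapDomain {f : Λ → Λ'} (hf : f.Injective) {S : Set Λ} {Q : List Λ}
    {κ : Λ → Λ →₀ ℝ} {κ' : Λ' → Λ' →₀ ℝ} {N : Λ' →₀ ℝ} {x : Λ} {x' : Λ'}
    (hQ : ∀ q ∈ Q, q ∈ S ∧ ↑(κ q).support ⊆ S ∧ κ' (f q) = (κ q).mapDomain f)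
    (hN : ∀ r ∈ S, N (f r) = 0) (hx : κ' x' = N + (κ x).mapDomain f) :
    (Q.map f).foldl subdivide κ' x' = N + (Q.foldl subdivide κ x).mapDomain f := by
  induction Q generalizing κ κ' with
  | nil => exact hx
  | cons v Q ih =>
    obtain ⟨⟨hvS, hκS, hv⟩, hQ⟩ := List.forall_mem_cons.1 hQ
    refine ih (fun q hq => ⟨(hQ q hq).1, support_starReduce_subset hvS hκS (hQ q hq).2.1, ?_⟩) ?_
    · simpa [subdivide, hv, (hQ q hq).2.2] using
        starReduce_add_mapDomain (v := v) (κ := κ v) (a := κ q) hf (N := 0) (by simp)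
    · simpa only [subdivide, hv, hx] using
        starReduce_add_mapDomain hf fun r hr => hN r (hκS hr)

/-- `κ u` gives nonnegative coefficients expressing `vec u` through the vectors `vec r`. -/
def Represents {E : Type*} [AddCommGroup E] [Module ℝ E] (vec : Λ → E) (κ : Λ → Λ →₀ ℝ) : Prop :=
  ∀ u, 0 ≤ κ u ∧ Finsupp.linearCombination ℝ vec (κ u) = vec u

theorem Represents.subdivide {E : Type*} [AddCommGroup E] [Module ℝ E] {vec : Λ → E}
    {κ : Λ → Λ →₀ ℝ} (h : Represents vec κ) (v : Λ) : Represents vec (subdivide κ v) := fun u =>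
  ⟨starReduce_nonneg (h v).1 (h u).1,
    (linearCombination_starReduce (h v).2 (κ u)).trans (h u).2⟩

theorem Represents.foldl_subdivide {E : Type*} [AddCommGroup E] [Module ℝ E] {vec : Λ → E}
    {κ : Λ → Λ →₀ ℝ} (h : Represents vec κ) (Q : List Λ) :
    Represents vec (Q.foldl ToricTriangulation.subdivide κ) := by
  induction Q generalizing κ with
  | nil => exact h
  | cons v _ ih => exact ih (h.subdivide v)

end Coefficients

/-! ### Lattice points of dilated simplices -/

section Labels

variable {I : Type*}

/-- The lattice point `u` as a real vector. -/
def realLabel (u : I → ℕ) : I → ℝ := fun i => u i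

theorem single_injective [DecidableEq I] {d : ℕ} (hd : d ≠ 0) :
    Function.Injective fun i : I => (Pi.single i d : I → ℕ) := by
  intro i j h
  by_contra hij
  have := congrFun h i
  simp [hij, hd] at this

/-- The members of `F`, by decreasing cardinality. -/
noncomputable def sortedByCard (F : Finset (Finset I)) : List (Finset I) :=
  F.toList.mergeSort fun A B => B.card ≤ A.card

@[simp] theorem mem_sortedByCard {F : Finset (Finset I)} {A : Finset I} :
    A ∈ sortedByCard F ↔ A ∈ F := by
  simp [sortedByCard]

theorem pairwise_sortedByCard (F : Finset (Finset I)) :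
    (sortedByCard F).Pairwise fun A B => B.card ≤ A.card ∧ A ≠ B := by
  refine List.Pairwise.and ?_ ((List.mergeSort_perm _ _).nodup_iff.2 F.nodup_toList)
  refine (List.pairwise_mergeSort ?_ ?_ F.toList).imp fun h => of_decide_eq_true h
  · intro A B C h h'
    exact decide_eq_true ((of_decide_eq_true h').trans (of_decide_eq_true h))
  · intro A B
    simpa using le_total B.card A.card

/-- The indicator function of a set of coordinates. -/
def indicatorLabel [DecidableEq I] (T : Finset I) : I → ℕ := fun i => if i ∈ T then 1 else 0

variable [Fintype I]

/-- The set of nonzero coordinates. -/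
def labelSupport (u : I → ℕ) : Finset I := Finset.univ.filter fun i => u i ≠ 0

@[simp] theorem mem_labelSupport {u : I → ℕ} {i : I} : i ∈ labelSupport u ↔ u i ≠ 0 := by
  simp [labelSupport]

theorem notMem_labelSupport {u : I → ℕ} {i : I} : i ∉ labelSupport u ↔ u i = 0 := by
  simp

theorem labelSupport_mono {u w : I → ℕ} (h : u ≤ w) : labelSupport u ⊆ labelSupport w := by
  intro i hi
  rw [mem_labelSupport] at hi ⊢
  exact fun h0 => hi (Nat.le_zero.1 (h0 ▸ h i))

section Coefficients

variable {a : (I → ℕ) →₀ ℝ} {u v r : I → ℕ} {κ : (I → ℕ) → (I → ℕ) →₀ ℝ}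

theorem labelSupport_subset_of_mem_support (ha : 0 ≤ a)
    (h : Finsupp.linearCombination ℝ realLabel a = realLabel u) (hr : r ∈ a.support) :
    labelSupport r ⊆ labelSupport u := by
  intro i hi
  rw [mem_labelSupport] at hi ⊢
  intro hu
  have hsum : ∑ s ∈ a.support, a s * (s i : ℝ) = 0 := by
    simpa [Finsupp.linearCombination_apply, Finsupp.sum, realLabel, hu] using congrFun h i
  have hzero := (Finset.sum_eq_zero_iff_of_nonneg fun s _ =>
    mul_nonneg (ha s) (Nat.cast_nonneg (s i))).1 hsum r hr
  exact (mul_ne_zero (Finsupp.mem_support_iff.1 hr) (Nat.cast_ne_zero.2 hi)) hzero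

theorem exists_mem_support_of_mem_labelSupport
    (h : Finsupp.linearCombination ℝ realLabel a = realLabel u) {i : I}
    (hi : i ∈ labelSupport u) : ∃ r ∈ a.support, i ∈ labelSupport r := by
  by_contra! hc
  have hsum : (u i : ℝ) = ∑ s ∈ a.support, a s * (s i : ℝ) := by
    simpa [Finsupp.linearCombination_apply, Finsupp.sum, realLabel] using (congrFun h i).symm
  refine mem_labelSupport.1 hi (Nat.cast_eq_zero.1 (hsum.trans (Finset.sum_eq_zero fun s hs => ?_)))
  simp [notMem_labelSupport.1 (hc s hs)]

theorem subdivide_eq_of_not_subset (hκ : Represents realLabel κ)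
    (h : ¬ labelSupport v ⊆ labelSupport u) : subdivide κ v u = κ u := by
  obtain ⟨i, hiv, hiu⟩ := Finset.not_subset.1 h
  obtain ⟨r, hr, hir⟩ := exists_mem_support_of_mem_labelSupport (hκ v).2 hiv
  refine starReduce_eq_self_of_apply_eq_zero (hκ v).1 (hκ u).1 hr ?_
  by_contra hur
  exact hiu (labelSupport_subset_of_mem_support (hκ u).1 (hκ u).2
    (Finsupp.mem_support_iff.2 hur) hir)

theorem foldl_subdivide_eq_of_not_subset (hκ : Represents realLabel κ) {Q : List (I → ℕ)}
    (h : ∀ v ∈ Q, ¬ labelSupport v ⊆ labelSupport u) : Q.foldl subdivide κ u = κ u := by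
  induction Q generalizing κ with
  | nil => rfl
  | cons v Q ih =>
    rw [List.forall_mem_cons] at h
    exact (ih (hκ.subdivide v) h.2).trans (subdivide_eq_of_not_subset hκ h.1)

end Coefficients

variable [DecidableEq I]

theorem labelSupport_single {d : ℕ} (hd : d ≠ 0) (i : I) :
    labelSupport (Pi.single i d) = {i} := by
  ext j
  by_cases h : j = i <;> simp [h, hd]

theorem sum_indicatorLabel (T : Finset I) : ∑ i, indicatorLabel T i = T.card := by
  simp [indicatorLabel]

theorem subset_labelSupport_indicatorLabel_add (T : Finset I) (u : I → ℕ) :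
    T ⊆ labelSupport (indicatorLabel T + u) := by
  intro i hi
  simp [indicatorLabel, hi]

theorem labelSupport_indicatorLabel_add {T : Finset I} {u : I → ℕ} (hu : labelSupport u ⊆ T) :
    labelSupport (indicatorLabel T + u) = T := by
  refine (subset_labelSupport_indicatorLabel_add T u).antisymm' fun i hi => ?_
  by_contra hiT
  have : u i = 0 := notMem_labelSupport.1 fun h => hiT (hu h)
  simp [indicatorLabel, hiT, this] at hi

theorem exists_eq_indicatorLabel_add {u : I → ℕ} {T : Finset I} (h : labelSupport u = T) :
    ∃ w, u = indicatorLabel T + w ∧ labelSupport w ⊆ T ∧ T.card + ∑ i, w i = ∑ i, u i := by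
  have key : u = indicatorLabel T + (u - indicatorLabel T) := by
    refine (add_tsub_cancel_of_le fun i => ?_).symm
    by_cases hi : i ∈ T
    · simpa [indicatorLabel, hi, Nat.one_le_iff_ne_zero] using mem_labelSupport.1 (h ▸ hi)
    · simp [indicatorLabel, hi]
  refine ⟨u - indicatorLabel T, key, h ▸ labelSupport_mono tsub_le_self, ?_⟩
  conv_rhs => rw [key]
  simp only [Pi.add_apply, Finset.sum_add_distrib, sum_indicatorLabel]

/-- The coefficients of `u` with respect to the vertices `d • eᵢ` of the dilated simplex. -/
noncomputable def vertexCoeffs (d : ℕ) (u : I → ℕ) : (I → ℕ) →₀ ℝ :=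
  ∑ i, Finsupp.single (Pi.single i d) ((u i : ℝ) / d)

theorem vertexCoeffs_apply_single {d : ℕ} (hd : d ≠ 0) (u : I → ℕ) (i : I) :
    vertexCoeffs d u (Pi.single i d) = (u i : ℝ) / d := by
  rw [vertexCoeffs, Finsupp.finsetSum_apply, Finset.sum_eq_single i]
  · simp
  · exact fun j _ hj => Finsupp.single_eq_of_ne fun h => hj (single_injective hd h).symm
  · simp

theorem exists_of_mem_support_vertexCoeffs {d : ℕ} {u r : I → ℕ}
    (h : r ∈ (vertexCoeffs d u).support) : ∃ i ∈ labelSupport u, r = Pi.single i d := by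
  by_contra! hc
  refine Finsupp.mem_support_iff.1 h ?_
  rw [vertexCoeffs, Finsupp.finsetSum_apply]
  refine Finset.sum_eq_zero fun i _ => ?_
  by_cases hi : i ∈ labelSupport u
  · exact Finsupp.single_eq_of_ne (hc i hi)
  · simp [notMem_labelSupport.1 hi]

theorem represents_vertexCoeffs {d : ℕ} (hd : d ≠ 0) {E : Type*} [AddCommGroup E] [Module ℝ E]
    (vec : (I → ℝ) →ₗ[ℝ] E) :
    Represents (fun u => vec (realLabel u)) (vertexCoeffs (I := I) d) := by
  refine fun u => ⟨Finset.sum_nonneg fun i _ => Finsupp.single_nonneg.2 (by positivity), ?_⟩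
  have hu : realLabel u = ∑ i, ((u i : ℝ) / d) • realLabel (Pi.single i d) := by
    ext j
    have : (d : ℝ) ≠ 0 := Nat.cast_ne_zero.2 hd
    simp [realLabel, Finset.sum_apply, Pi.single_apply, this]
  simp only [vertexCoeffs, map_sum, Finsupp.linearCombination_single]
  rw [hu, map_sum]
  simp only [map_smul]

theorem vertexCoeffs_single {d : ℕ} (hd : d ≠ 0) (i : I) :
    vertexCoeffs d (Pi.single i d) = Finsupp.single (Pi.single i d) 1 := by
  rw [vertexCoeffs, Finset.sum_eq_single i]
  · simp [hd]
  · intro j _ hj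
    simp [hj]
  · simp

theorem vertexCoeffs_add (d : ℕ) (u w : I → ℕ) :
    vertexCoeffs d (u + w) = vertexCoeffs d u + vertexCoeffs d w := by
  simp [vertexCoeffs, add_div, Finset.sum_add_distrib]

theorem vertexCoeffs_nsmul (d k : ℕ) (u : I → ℕ) :
    vertexCoeffs d (k • u) = (k : ℝ) • vertexCoeffs d u := by
  simp [vertexCoeffs, mul_div_assoc, Finset.smul_sum]

end Labels

section InteriorPoints

variable {I : Type*} [LinearOrder I]

/-- The nonempty subsets of `T`: first the singletons in increasing order, then the other subsets
by decreasing cardinality. -/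
noncomputable def cornersFirst (T : Finset I) : List (Finset I) :=
  T.sort.map ({·}) ++ sortedByCard (T.powerset.filter fun S => 2 ≤ S.card)

/-- The lattice points with coordinate sum `d` and support `T`. Subtracting the indicator function
of `T` leaves the lattice points with coordinate sum `d - T.card` and support in `T`; they are
listed in the order of `cornersFirst`. -/
noncomputable def interiorPoints (d : ℕ) (T : Finset I) : List (I → ℕ) :=
  if T.Nonempty ∧ T.card ≤ d then
    if d = T.card then [indicatorLabel T]
    else ((cornersFirst T).flatMap (interiorPoints (d - T.card))).map (indicatorLabel T + ·)
  else []
termination_by d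
decreasing_by
  rename_i hT _
  have := hT.1.card_pos
  omega

/-- The lattice points with coordinate sum `d` and support in `F`. -/
noncomputable def latticePoints (d : ℕ) (F : Finset (Finset I)) : List (I → ℕ) :=
  (sortedByCard F).flatMap (interiorPoints d)

theorem interiorPoints_eq_nil {d : ℕ} {T : Finset I} (h : ¬ (T.Nonempty ∧ T.card ≤ d)) :
    interiorPoints d T = [] := by
  rw [interiorPoints, if_neg h]

theorem interiorPoints_card {T : Finset I} (h : T.Nonempty) :
    interiorPoints T.card T = [indicatorLabel T] := by
  rw [interiorPoints, if_pos ⟨h, le_rfl⟩, if_pos rfl]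

theorem interiorPoints_card_add {T : Finset I} (h : T.Nonempty) {m : ℕ} (hm : m ≠ 0) :
    interiorPoints (T.card + m) T =
      ((cornersFirst T).flatMap (interiorPoints m)).map (indicatorLabel T + ·) := by
  rw [interiorPoints, if_pos ⟨h, Nat.le_add_right _ _⟩, if_neg (by omega), Nat.add_sub_cancel_left]

theorem mem_cornersFirst {S T : Finset I} : S ∈ cornersFirst T ↔ S.Nonempty ∧ S ⊆ T := by
  simp only [cornersFirst, List.mem_append, List.mem_map, Finset.mem_sort, mem_sortedByCard,
    Finset.mem_filter, Finset.mem_powerset]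
  constructor
  · rintro (⟨i, hi, rfl⟩ | ⟨hS, h2⟩)
    · simpa using hi
    · exact ⟨Finset.card_pos.1 (by omega), hS⟩
  · rintro ⟨hne, hS⟩
    obtain h1 | h2 : S.card = 1 ∨ 2 ≤ S.card := by
      have := hne.card_pos
      omega
    · obtain ⟨i, rfl⟩ := Finset.card_eq_one.1 h1
      exact Or.inl ⟨i, by simpa using hS, rfl⟩
    · exact Or.inr ⟨hS, h2⟩

theorem nodup_cornersFirst (T : Finset I) : (cornersFirst T).Nodup := by
  refine List.Nodup.append ((T.sort_nodup _).map Finset.singleton_injective)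
    ((pairwise_sortedByCard _).imp And.right) fun S hS hS' => ?_
  obtain ⟨i, -, rfl⟩ := List.mem_map.1 hS
  simp at hS'

section Membership

variable [Fintype I]

theorem mem_interiorPoints {d : ℕ} {T : Finset I} {v : I → ℕ} :
    v ∈ interiorPoints d T ↔ T.Nonempty ∧ labelSupport v = T ∧ ∑ i, v i = d := by
  induction d using Nat.strong_induction_on generalizing T v with
  | _ d ih =>
  constructor
  · intro hv
    by_cases hT : T.Nonempty ∧ T.card ≤ d
    · obtain ⟨hne, m, rfl⟩ := hT.imp_right Nat.exists_eq_add_of_le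
      rcases eq_or_ne m 0 with rfl | hm
      · rw [Nat.add_zero, interiorPoints_card hne, List.mem_singleton] at hv
        subst hv
        simpa [hne, sum_indicatorLabel, labelSupport] using
          labelSupport_indicatorLabel_add (u := 0) (T := T)
      · rw [interiorPoints_card_add hne hm, List.mem_map] at hv
        obtain ⟨w, hw, rfl⟩ := hv
        obtain ⟨S, hS, hwS⟩ := List.mem_flatMap.1 hw
        obtain ⟨-, hsupp, hsum⟩ := (ih m (by have := hne.card_pos; omega)).1 hwS
        refine ⟨hne, labelSupport_indicatorLabel_add (hsupp ▸ (mem_cornersFirst.1 hS).2), ?_⟩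
        simp only [Pi.add_apply, Finset.sum_add_distrib, sum_indicatorLabel, hsum]
    · simp [interiorPoints_eq_nil hT] at hv
  · rintro ⟨hne, hsupp, rfl⟩
    obtain ⟨w, rfl, hw, hsum⟩ := exists_eq_indicatorLabel_add hsupp
    rw [← hsum] at ih ⊢
    rcases eq_or_ne (∑ i, w i) 0 with h0 | h0
    · have : w = 0 := by
        ext i
        exact Finset.sum_eq_zero_iff.1 h0 i (Finset.mem_univ i)
      simp [this, interiorPoints_card hne]
    · rw [interiorPoints_card_add hne h0]
      have hwne : (labelSupport w).Nonempty := by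
        obtain ⟨i, -, hi⟩ := Finset.exists_ne_zero_of_sum_ne_zero h0
        exact ⟨i, mem_labelSupport.2 hi⟩
      refine List.mem_map_of_mem (List.mem_flatMap.2 ⟨_, mem_cornersFirst.2 ⟨hwne, hw⟩, ?_⟩)
      exact (ih _ (by have := hne.card_pos; omega)).2 ⟨hwne, rfl, rfl⟩

theorem mem_latticePoints {d : ℕ} {F : Finset (Finset I)} {v : I → ℕ} :
    v ∈ latticePoints d F ↔ labelSupport v ∈ F ∧ (labelSupport v).Nonempty ∧ ∑ i, v i = d := by
  simp only [latticePoints, List.mem_flatMap, mem_sortedByCard, mem_interiorPoints]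
  constructor
  · rintro ⟨T, hT, hne, rfl, hsum⟩
    exact ⟨hT, hne, hsum⟩
  · rintro ⟨hF, hne, hsum⟩
    exact ⟨_, hF, hne, rfl, hsum⟩

theorem pairwise_latticePoints (d : ℕ) (F : Finset (Finset I)) :
    (latticePoints d F).Pairwise fun v w => (labelSupport w).card ≤ (labelSupport v).card := by
  refine List.pairwise_flatMap.2
    ⟨fun T _ => List.pairwise_of_forall_mem_list fun v hv w hw => ?_,
      (pairwise_sortedByCard F).imp fun {S T} hST v hv w hw => ?_⟩
  · rw [(mem_interiorPoints.1 hv).2.1, (mem_interiorPoints.1 hw).2.1]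
  · rw [(mem_interiorPoints.1 hv).2.1, (mem_interiorPoints.1 hw).2.1]
    exact hST.1

end Membership

section Nodup

variable [Finite I]

theorem nodup_flatMap_interiorPoints {d : ℕ} {Ts : List (Finset I)} (hTs : Ts.Nodup)
    (h : ∀ T ∈ Ts, (interiorPoints d T).Nodup) : (Ts.flatMap (interiorPoints d)).Nodup := by
  have := Fintype.ofFinite I
  refine List.nodup_flatMap.2 ⟨h, hTs.imp fun hST v hS hT => hST ?_⟩
  rw [← (mem_interiorPoints.1 hS).2.1, (mem_interiorPoints.1 hT).2.1]

theorem nodup_interiorPoints (d : ℕ) (T : Finset I) : (interiorPoints d T).Nodup := by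
  induction d using Nat.strong_induction_on generalizing T with
  | _ d ih =>
  by_cases hT : T.Nonempty ∧ T.card ≤ d
  · obtain ⟨hne, m, rfl⟩ := hT.imp_right Nat.exists_eq_add_of_le
    rcases eq_or_ne m 0 with rfl | hm
    · simp [interiorPoints_card hne]
    · rw [interiorPoints_card_add hne hm]
      exact (nodup_flatMap_interiorPoints (nodup_cornersFirst T) fun S _ =>
        ih m (by have := hne.card_pos; omega) S).map (add_right_injective _)
  · simp [interiorPoints_eq_nil hT]

theorem interiorPoints_singleton {d : ℕ} (hd : d ≠ 0) (i : I) :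
    interiorPoints d {i} = [Pi.single i d] := by
  have := Fintype.ofFinite I
  have hnodup := nodup_interiorPoints d {i}
  refine List.perm_singleton.1
    ((List.perm_ext_iff_of_nodup hnodup (List.nodup_singleton _)).2 fun v => ?_)
  rw [mem_interiorPoints, List.mem_singleton]
  constructor
  · rintro ⟨-, hsupp, rfl⟩
    have hv : ∀ j ≠ i, v j = 0 := fun j hj => notMem_labelSupport.1 (by simpa [hsupp] using hj)
    ext j
    rcases eq_or_ne j i with rfl | hj
    · simp [Finset.sum_eq_single j fun k _ hk => hv k hk]
    · simp [hj, hv j hj]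
  · rintro rfl
    simp [labelSupport_single hd]

theorem nodup_latticePoints (d : ℕ) (F : Finset (Finset I)) : (latticePoints d F).Nodup :=
  nodup_flatMap_interiorPoints ((pairwise_sortedByCard F).imp And.right) fun T _ =>
    nodup_interiorPoints d T

end Nodup

end InteriorPoints

/-! ### Subdividing at the corners of the inner simplex -/

section Corners

variable {I : Type*} [LinearOrder I]

/-- The corners of the simplex that remains after subtracting the indicator function of `T`. -/
def cornerLabel (m : ℕ) (T : Finset I) (j : I) : I → ℕ := indicatorLabel T + Pi.single j m

theorem cornerLabel_apply {m : ℕ} {T : Finset I} {i : I} (hi : i ∈ T) (j : I) :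
    cornerLabel m T j i = 1 + if i = j then m else 0 := by
  simp [cornerLabel, indicatorLabel, hi, Pi.single_apply]

theorem cornerLabel_injective {m : ℕ} (hm : m ≠ 0) (T : Finset I) :
    Function.Injective (cornerLabel m T) :=
  (add_right_injective _).comp (single_injective hm)

theorem cornerLabel_ne_single {m d : ℕ} {T : Finset I} (hT : T.Nontrivial) (i k : I) :
    cornerLabel m T i ≠ Pi.single k d := by
  intro h
  obtain ⟨j, hj, hjk⟩ := hT.exists_ne k
  have := congrFun h j
  rw [cornerLabel_apply hj, Pi.single_eq_of_ne hjk] at this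
  omega

variable {d m : ℕ} {T J : Finset I} {a κ : (I → ℕ) →₀ ℝ} {u : I → ℕ}

/-- The shape of the coefficients `a` once the star subdivisions at the corners in `J` are made:
they involve the corners in `J` and the vertices of `d` times the simplex on `T`. -/
structure IsCornerState (d m : ℕ) (T J : Finset I) (a : (I → ℕ) →₀ ℝ) : Prop where
  eq_corner_or_vertex : ∀ r ∈ a.support, ∃ i ∈ T, r = cornerLabel m T i ∨ r = Pi.single i d
  corner_eq_zero : ∀ i ∈ T, i ∉ J → a (cornerLabel m T i) = 0
  ordered : ∀ i ∈ T, ∀ k ∈ T, i < k → a (cornerLabel m T k) = 0 ∨ a (Pi.single i d) = 0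
  exhausted : (∃ i ∈ T, a (cornerLabel m T i) = 0 ∧ a (Pi.single i d) = 0) ∨
    ∀ i ∈ J, a (Pi.single i d) = 0

theorem IsCornerState.eq_sum (h : IsCornerState d m T J a) (hT : T.Nontrivial) (hm : m ≠ 0)
    (hd : d ≠ 0) :
    a = ∑ k ∈ T, Finsupp.single (cornerLabel m T k) (a (cornerLabel m T k)) +
      ∑ k ∈ T, Finsupp.single (Pi.single k d) (a (Pi.single k d)) := by
  classical
  have hsupp : a.support ⊆ T.image (cornerLabel m T) ∪ T.image (Pi.single · d) := by
    intro r hr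
    obtain ⟨i, hi, rfl | rfl⟩ := h.eq_corner_or_vertex r hr
    · exact Finset.mem_union_left _ (Finset.mem_image_of_mem _ hi)
    · exact Finset.mem_union_right _ (Finset.mem_image_of_mem (Pi.single · d) hi)
  have hdisj : Disjoint (T.image (cornerLabel m T)) (T.image (Pi.single · d)) := by
    simp only [Finset.disjoint_left, Finset.mem_image]
    rintro _ ⟨i, -, rfl⟩ ⟨k, -, hk⟩
    exact cornerLabel_ne_single hT i k hk.symm
  conv_lhs => rw [← a.sum_single, Finsupp.sum_of_support_subset a hsupp _ (by simp),
    Finset.sum_union hdisj, Finset.sum_image ((cornerLabel_injective hm T).injOn),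
    Finset.sum_image ((single_injective hd).injOn)]

theorem IsCornerState.label_apply (h : IsCornerState d m T J a) (hT : T.Nontrivial) (hm : m ≠ 0)
    (hd : d ≠ 0) (hu : Finsupp.linearCombination ℝ realLabel a = realLabel u) {i : I}
    (hi : i ∈ T) :
    (u i : ℝ) = ∑ k ∈ T, a (cornerLabel m T k) + m * a (cornerLabel m T i) +
      d * a (Pi.single i d) := by
  rw [h.eq_sum hT hm hd] at hu
  have := congrFun hu i
  simp only [map_add, map_sum, Finsupp.linearCombination_single, Pi.add_apply, Finset.sum_apply,
    Pi.smul_apply, smul_eq_mul, realLabel, cornerLabel_apply hi, Pi.single_apply, Nat.cast_add,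
    Nat.cast_one, Nat.cast_ite, Nat.cast_zero, mul_add, mul_one, mul_ite, mul_zero,
    Finset.sum_add_distrib, Finset.sum_ite_eq, hi, if_true] at this
  linarith

/-- The coefficients of the corner at `j`: were the coefficients of the earlier corners to add up to
`1` or more, they would outweigh the coordinates of that corner. -/
theorem IsCornerState.sum_corner_lt_one (h : IsCornerState d m T J κ) (hT : T.Nontrivial)
    (hm : m ≠ 0) (hd : d ≠ 0) (hκ : 0 ≤ κ) {j : I} (hjJ : j ∉ J) (hJ : J ⊆ T)
    (hj : Finsupp.linearCombination ℝ realLabel κ = realLabel (cornerLabel m T j)) :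
    ∑ k ∈ T, κ (cornerLabel m T k) < 1 := by
  by_contra! hge
  have hsum : ∑ k ∈ T, κ (cornerLabel m T k) = ∑ k ∈ J, κ (cornerLabel m T k) :=
    (Finset.sum_subset hJ h.corner_eq_zero).symm
  have hle : ∀ k ∈ J, (m : ℝ) * κ (cornerLabel m T k) ≤ 0 := by
    intro k hk
    have hkj : k ≠ j := fun e => hjJ (e ▸ hk)
    have happly := h.label_apply hT hm hd hj (hJ hk)
    rw [cornerLabel_apply (hJ hk), if_neg hkj] at happly
    have := mul_nonneg (Nat.cast_nonneg (α := ℝ) d) (hκ (Pi.single k d))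
    push_cast at happly
    linarith
  have hm' : (0 : ℝ) < m := by positivity
  have : ∑ k ∈ J, κ (cornerLabel m T k) ≤ 0 :=
    Finset.sum_nonpos fun k hk => nonpos_of_mul_nonpos_right (hle k hk) hm'
  linarith

theorem IsCornerState.corner_or_vertex_ne_zero (h : IsCornerState d m T J κ) (hT : T.Nontrivial)
    (hm : m ≠ 0) (hd : d ≠ 0) (hκ : 0 ≤ κ) {j : I} (hjJ : j ∉ J) (hJ : J ⊆ T)
    (hj : Finsupp.linearCombination ℝ realLabel κ = realLabel (cornerLabel m T j)) {i : I}
    (hi : i ∈ T) : κ (cornerLabel m T i) ≠ 0 ∨ κ (Pi.single i d) ≠ 0 := by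
  by_contra! hzero
  have hlt := h.sum_corner_lt_one hT hm hd hκ hjJ hJ hj
  have happly := h.label_apply hT hm hd hj hi
  have hone : (1 : ℝ) ≤ cornerLabel m T j i := by
    rw [cornerLabel_apply hi]
    exact_mod_cast Nat.le_add_right 1 _
  rw [hzero.1, hzero.2] at happly
  linarith

theorem IsCornerState.vertex_eq_zero (h : IsCornerState d m T J κ) (hT : T.Nontrivial)
    (hm : m ≠ 0) (hd : d ≠ 0) (hκ : 0 ≤ κ) {j : I} (hjJ : j ∉ J) (hJ : J ⊆ T)
    (hj : Finsupp.linearCombination ℝ realLabel κ = realLabel (cornerLabel m T j)) :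
    ∀ i ∈ J, κ (Pi.single i d) = 0 := by
  refine h.exhausted.resolve_left ?_
  rintro ⟨i, hi, hc, hv⟩
  exact (h.corner_or_vertex_ne_zero hT hm hd hκ hjJ hJ hj hi).elim (· hc) (· hv)

theorem IsCornerState.starReduce_of_vertex_eq_zero (ha : IsCornerState d m T J a)
    (hav : ∀ i ∈ J, a (Pi.single i d) = 0) (hκ : IsCornerState d m T J κ) (hκ0 : κ ≠ 0)
    (hκv : ∀ i ∈ J, κ (Pi.single i d) = 0) (hT : T.Nontrivial) (hm : m ≠ 0) {j : I} (hjT : j ∈ T)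
    (hJ : ∀ i, i ∈ J ↔ i ∈ T ∧ i < j) :
    IsCornerState d m T (insert j J) (starReduce (cornerLabel m T j) κ a) := by
  set b := ToricTriangulation.starReduce (cornerLabel m T j) κ a with hb
  have hbr {r : I → ℕ} (hr : r ≠ cornerLabel m T j) : b r = a r - starCoeff κ a * κ r := by
    simp [hb, ToricTriangulation.starReduce, hr]
  have hbv {i : I} (hi : i ∈ J) : b (Pi.single i d) = 0 := by
    rw [hbr (cornerLabel_ne_single hT j i).symm, hav i hi, hκv i hi, mul_zero, sub_zero]
  have hbc {i : I} (hi : i ∈ T) (hiJ : i ∉ insert j J) : b (cornerLabel m T i) = 0 := by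
    rw [Finset.mem_insert, not_or] at hiJ
    rw [hbr ((cornerLabel_injective hm T).ne hiJ.1), ha.corner_eq_zero i hi hiJ.2,
      hκ.corner_eq_zero i hi hiJ.2, mul_zero, sub_zero]
  refine ⟨support_starReduce_subset
    (S := {r | ∃ i ∈ T, r = cornerLabel m T i ∨ r = Pi.single i d})
    ⟨j, hjT, Or.inl rfl⟩ hκ.eq_corner_or_vertex ha.eq_corner_or_vertex, fun i => hbc, ?_, ?_⟩
  · intro i hi k hk hik
    by_cases hkJ : k ∈ insert j J
    · have hkj : k ≤ j := (Finset.mem_insert.1 hkJ).elim le_of_eq fun h => ((hJ k).1 h).2.le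
      exact Or.inr (hbv ((hJ i).2 ⟨hi, hik.trans_le hkj⟩))
    · exact Or.inl (hbc hk hkJ)
  · obtain ⟨r, hr, hrc⟩ := exists_eq_starCoeff_mul (a := a) hκ0
    have hbr0 (h : r ≠ cornerLabel m T j) : b r = 0 := by rw [hbr h, hrc, sub_self]
    rw [Finsupp.mem_support_iff] at hr
    obtain ⟨i, hi, rfl | rfl⟩ := hκ.eq_corner_or_vertex r (Finsupp.mem_support_iff.2 hr)
    · have hiJ : i ∈ J := by_contra fun h => hr (hκ.corner_eq_zero i hi h)
      have hij : i ≠ j := ((hJ i).1 hiJ).2.ne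
      exact Or.inl ⟨i, hi, hbr0 ((cornerLabel_injective hm T).ne hij), hbv hiJ⟩
    · have hvi := hbr0 (cornerLabel_ne_single hT j i).symm
      rcases eq_or_ne i j with rfl | hij
      · exact Or.inr (Finset.forall_mem_insert _ _ _ |>.2 ⟨hvi, fun _ => hbv⟩)
      · exact Or.inl ⟨i, hi, hbc hi (by simpa [hij] using fun h => hr (hκv i h)), hvi⟩

theorem IsCornerState.starReduce (ha : IsCornerState d m T J a) (hκ : IsCornerState d m T J κ)
    (hT : T.Nontrivial) (hm : m ≠ 0) (hd : d ≠ 0) (ha0 : 0 ≤ a) (hκ0 : 0 ≤ κ) {j : I} (hjT : j ∈ T)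
    (hJ : ∀ i, i ∈ J ↔ i ∈ T ∧ i < j)
    (hj : Finsupp.linearCombination ℝ realLabel κ = realLabel (cornerLabel m T j)) :
    IsCornerState d m T (insert j J) (starReduce (cornerLabel m T j) κ a) := by
  have hJT : J ⊆ T := fun i hi => ((hJ i).1 hi).1
  have hjJ : j ∉ J := fun h => lt_irrefl j ((hJ j).1 h).2
  have hne {i : I} := hκ.corner_or_vertex_ne_zero hT hm hd hκ0 hjJ hJT hj (i := i)
  rcases ha.exhausted with ⟨i, hi, hc, hv⟩ | hav
  · have hself : ToricTriangulation.starReduce (cornerLabel m T j) κ a = a := by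
      rcases hne hi with h | h
      · exact starReduce_eq_self_of_apply_eq_zero hκ0 ha0 (Finsupp.mem_support_iff.2 h) hc
      · exact starReduce_eq_self_of_apply_eq_zero hκ0 ha0 (Finsupp.mem_support_iff.2 h) hv
    rw [hself]
    exact ⟨ha.eq_corner_or_vertex,
      fun i hi h => ha.corner_eq_zero i hi fun h' => h (Finset.mem_insert_of_mem h'),
      ha.ordered, Or.inl ⟨i, hi, hc, hv⟩⟩
  · have hκne : κ ≠ 0 := by
      rintro rfl
      exact (hne hjT).elim (· rfl) (· rfl)
    exact ha.starReduce_of_vertex_eq_zero hav hκ hκne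
      (hκ.vertex_eq_zero hT hm hd hκ0 hjJ hJT hj) hT hm hjT hJ

variable [Fintype I]

theorem isCornerState_vertexCoeffs (hT : T.Nontrivial) (hu : labelSupport u ⊆ T) :
    IsCornerState d m T ∅ (vertexCoeffs d u) := by
  have hcorner (i : I) : vertexCoeffs d u (cornerLabel m T i) = 0 := by
    by_contra h0
    obtain ⟨k, -, hk⟩ := exists_of_mem_support_vertexCoeffs (Finsupp.mem_support_iff.2 h0)
    exact cornerLabel_ne_single hT i k hk
  refine ⟨fun r hr => ?_, fun i _ _ => hcorner i, fun i _ k _ _ => Or.inl (hcorner k), by simp⟩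
  obtain ⟨i, hi, rfl⟩ := exists_of_mem_support_vertexCoeffs hr
  exact ⟨i, hu hi, Or.inr rfl⟩

omit [Fintype I] in
theorem mem_iff_of_append_singleton_prefix_sort {pre : List I} {j : I}
    (h : pre ++ [j] <+: T.sort) (i : I) : i ∈ pre ↔ i ∈ T ∧ i < j := by
  obtain ⟨post, hpost⟩ := h
  have hsorted := T.sortedLT_sort.pairwise
  rw [← Finset.mem_sort (· ≤ ·) (s := T)]
  simp only [← hpost, List.append_assoc, List.pairwise_append, List.mem_append,
    List.mem_singleton] at hsorted ⊢
  obtain ⟨-, ⟨-, -, hpost⟩, hpre⟩ := hsorted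
  constructor
  · exact fun hi => ⟨Or.inl hi, hpre i hi j (Or.inl rfl)⟩
  · rintro ⟨hi | rfl | hi, hij⟩
    · exact hi
    · exact absurd hij (lt_irrefl _)
    · exact absurd hij (hpost j rfl i hi).not_gt

theorem isCornerState_foldl_subdivide (hT : T.Nontrivial) (hm : m ≠ 0) (hd : d ≠ 0)
    (hu : labelSupport u ⊆ T) :
    IsCornerState d m T T ((T.sort.map (cornerLabel m T)).foldl subdivide (vertexCoeffs d) u) := by
  suffices key : ∀ pre, pre <+: T.sort → ∀ u, labelSupport u ⊆ T → IsCornerState d m T pre.toFinset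
      ((pre.map (cornerLabel m T)).foldl subdivide (vertexCoeffs d) u) by
    have := key T.sort List.prefix_rfl u hu
    rwa [T.sort_toFinset (· ≤ ·)] at this
  intro pre
  induction pre using List.reverseRecOn with
  | nil => exact fun _ u => isCornerState_vertexCoeffs hT
  | append_singleton pre j ih =>
    intro hpre u hu
    have hjT : j ∈ T := (Finset.mem_sort (· ≤ ·)).1 (hpre.subset (by simp))
    have hjsupp : labelSupport (cornerLabel m T j) ⊆ T :=
      (labelSupport_indicatorLabel_add
        ((labelSupport_single hm j).trans_subset (Finset.singleton_subset_iff.2 hjT))).subset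
    have hrep := (represents_vertexCoeffs hd LinearMap.id).foldl_subdivide
      (pre.map (cornerLabel m T))
    have ih := ih ((List.prefix_append pre [j]).trans hpre)
    have hstep := (ih u hu).starReduce (ih _ hjsupp) hT hm hd (hrep u).1 (hrep _).1 hjT
      (fun i => List.mem_toFinset.trans (mem_iff_of_append_singleton_prefix_sort hpre i)) (hrep _).2
    have hinsert : (pre ++ [j]).toFinset = insert j pre.toFinset := by
      ext i
      simp
    rw [hinsert, List.map_append, List.foldl_append]
    exact hstep

end Corners

section Integrality

variable {I : Type*} [LinearOrder I] {m d : ℕ} {T : Finset I} {a : (I → ℕ) →₀ ℝ}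
  {u : I → ℕ}

/-- By `IsCornerState.ordered`, at most one coordinate has both a corner and a vertex coefficient;
all the others are integral, hence so is this one. -/
theorem IsCornerState.exists_natCast_eq_mul_corner (h : IsCornerState (T.card + m) m T T a)
    (hT : T.Nontrivial) (hm : m ≠ 0) (ha : 0 ≤ a)
    (hu : Finsupp.linearCombination ℝ realLabel a = realLabel u) {k : ℕ}
    (hk : ∑ i ∈ T, a (cornerLabel m T i) = k) {i : I} (hi : i ∈ T) :
    ∃ w : ℕ, m * a (cornerLabel m T i) = w := by
  have happly {i : I} := h.label_apply hT hm (by omega) hu (i := i)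
  have hint {i : I} (hi : i ∈ T)
      (h0 : a (cornerLabel m T i) = 0 ∨ a (Pi.single i (T.card + m)) = 0) :
      m * a (cornerLabel m T i) ∈ (Int.castRingHom ℝ).range := by
    rcases h0 with h0 | h0
    · simp [h0]
    · exact ⟨u i - k, by simp [happly hi, h0, hk]⟩
  have hmem : m * a (cornerLabel m T i) ∈ (Int.castRingHom ℝ).range := by
    by_cases h0 : a (cornerLabel m T i) = 0 ∨ a (Pi.single i (T.card + m)) = 0
    · exact hint hi h0
    · rw [not_or] at h0
      have hothers : ∑ l ∈ T.erase i, m * a (cornerLabel m T l) ∈ (Int.castRingHom ℝ).range := by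
        refine sum_mem fun l hl => ?_
        obtain ⟨hli, hl⟩ := Finset.mem_erase.1 hl
        refine hint hl ?_
        rcases hli.lt_or_gt with hlt | hlt
        · exact Or.inr ((h.ordered l hl i hi hlt).resolve_left h0.1)
        · exact Or.inl ((h.ordered i hi l hl hlt).resolve_right h0.2)
      have htotal : (m : ℝ) * k ∈ (Int.castRingHom ℝ).range := ⟨m * k, by simp⟩
      rw [← hk, Finset.mul_sum, ← Finset.add_sum_erase T _ hi] at htotal
      simpa using sub_mem htotal hothers
  obtain ⟨z, hz⟩ := hmem
  rw [eq_intCast] at hz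
  have hz0 : 0 ≤ z := Int.cast_nonneg_iff.1 (hz ▸ mul_nonneg (Nat.cast_nonneg m) (ha _))
  exact ⟨z.toNat, by rw [← hz, ← Int.cast_natCast, Int.toNat_of_nonneg hz0]⟩

theorem IsCornerState.exists_vertex_eq_zero (h : IsCornerState d m T T a) (hT : T.Nonempty) :
    ∃ i ∈ T, a (Pi.single i d) = 0 := by
  rcases h.exhausted with ⟨i, hi, -, hv⟩ | hv
  · exact ⟨i, hi, hv⟩
  · exact hT.imp fun i hi => ⟨hi, hv i hi⟩

variable [Fintype I]

theorem vertexCoeffs_eq_sum_of_subset (d : ℕ) (hu : labelSupport u ⊆ T) :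
    vertexCoeffs d u = ∑ i ∈ T, Finsupp.single (Pi.single i d) ((u i : ℝ) / d) :=
  (Finset.sum_subset (Finset.subset_univ T) fun i _ hi => by
    simp [notMem_labelSupport.1 fun h => hi (hu h)]).symm

theorem mapDomain_vertexCoeffs_of_subset (m : ℕ) (hu : labelSupport u ⊆ T) :
    (vertexCoeffs m u).mapDomain (indicatorLabel T + ·) =
      ∑ i ∈ T, Finsupp.single (cornerLabel m T i) ((u i : ℝ) / m) := by
  simp only [vertexCoeffs_eq_sum_of_subset m hu, Finsupp.mapDomain_finsetSum,
    Finsupp.mapDomain_single, cornerLabel]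

theorem IsCornerState.exists_natCast_eq_sum_corner (h : IsCornerState (T.card + m) m T T a)
    (hT : T.Nontrivial) (hm : m ≠ 0)
    (hu : Finsupp.linearCombination ℝ realLabel a = realLabel u) (hsupp : labelSupport u ⊆ T)
    (hdvd : T.card + m ∣ ∑ i, u i) : ∃ k : ℕ, ∑ i ∈ T, a (cornerLabel m T i) = k := by
  have hd : T.card + m ≠ 0 := by omega
  have happly {i : I} := h.label_apply hT hm hd hu (i := i)
  rcases h.exhausted with ⟨i, hi, hc, hv⟩ | hv
  · exact ⟨u i, by simpa [hc, hv] using (happly hi).symm⟩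
  · obtain ⟨k, hk⟩ := hdvd
    refine ⟨k, mul_left_cancel₀ (Nat.cast_ne_zero.2 hd : ((T.card + m : ℕ) : ℝ) ≠ 0) ?_⟩
    have hsum : ∑ i ∈ T, u i = ∑ i, u i :=
      Finset.sum_subset (Finset.subset_univ T) fun i _ hi =>
        notMem_labelSupport.1 fun h => hi (hsupp h)
    have hcoord : ∀ i ∈ T, (u i : ℝ) = ∑ l ∈ T, a (cornerLabel m T l) + m * a (cornerLabel m T i) :=
      fun i hi => by simpa [hv i hi] using happly hi
    rw [← Nat.cast_mul, ← hk, ← hsum, Nat.cast_sum, Finset.sum_congr rfl hcoord,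
      Finset.sum_add_distrib, Finset.sum_const, ← Finset.mul_sum, nsmul_eq_mul, ← add_mul,
      Nat.cast_add]

theorem IsCornerState.eq_mapDomain_add (h : IsCornerState d m T T a) (hT : T.Nontrivial)
    (hm : m ≠ 0) (hd : d ≠ 0) {w b : I → ℕ} (hw : labelSupport w ⊆ T) (hb : labelSupport b ⊆ T)
    (hwa : ∀ i ∈ T, (w i : ℝ) = m * a (cornerLabel m T i))
    (hba : ∀ i ∈ T, (b i : ℝ) = d * a (Pi.single i d)) :
    a = (vertexCoeffs m w).mapDomain (indicatorLabel T + ·) + vertexCoeffs d b := by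
  rw [mapDomain_vertexCoeffs_of_subset m hw, vertexCoeffs_eq_sum_of_subset d hb]
  conv_lhs => rw [h.eq_sum hT hm hd]
  congr 1 <;> refine Finset.sum_congr rfl fun i hi => ?_
  · rw [hwa i hi, mul_div_cancel_left₀ _ (Nat.cast_ne_zero.2 hm)]
  · rw [hba i hi, mul_div_cancel_left₀ _ (Nat.cast_ne_zero.2 hd)]

theorem IsCornerState.exists_eq_mapDomain_add (h : IsCornerState (T.card + m) m T T a)
    (hT : T.Nontrivial) (hm : m ≠ 0) (ha : 0 ≤ a)
    (hu : Finsupp.linearCombination ℝ realLabel a = realLabel u) (hsupp : labelSupport u ⊆ T)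
    (hdvd : T.card + m ∣ ∑ i, u i) :
    ∃ (k : ℕ) (w b : I → ℕ), u = k • indicatorLabel T + w + b ∧ ∑ i, w i = m * k ∧
      labelSupport w ⊆ T ∧ ¬ T ⊆ labelSupport b ∧
      a = (vertexCoeffs m w).mapDomain (indicatorLabel T + ·) + vertexCoeffs (T.card + m) b := by
  have hd : T.card + m ≠ 0 := by omega
  obtain ⟨k, hk⟩ := h.exists_natCast_eq_sum_corner hT hm hu hsupp hdvd
  choose! w₀ hw₀ using fun i (hi : i ∈ T) => h.exists_natCast_eq_mul_corner hT hm ha hu hk hi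
  set w : I → ℕ := fun i => if i ∈ T then w₀ i else 0
  have hwT {i : I} (hi : i ∈ T) : (w i : ℝ) = m * a (cornerLabel m T i) := by
    simp [w, hi, hw₀ i hi]
  have hwsupp : labelSupport w ⊆ T := fun i hi =>
    by_contra fun hiT => mem_labelSupport.1 hi (if_neg hiT)
  have hcoord {i : I} (hi : i ∈ T) :
      (u i : ℝ) = k + w i + (T.card + m : ℕ) * a (Pi.single i (T.card + m)) := by
    rw [h.label_apply hT hm hd hu hi, hk, hwT hi]
  have hle : k • indicatorLabel T + w ≤ u := by
    intro i
    by_cases hi : i ∈ T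
    · have := mul_nonneg (Nat.cast_nonneg (α := ℝ) (T.card + m)) (ha (Pi.single i (T.card + m)))
      have hreal : (k + w i : ℝ) ≤ u i := by linarith [hcoord hi]
      simpa [indicatorLabel, hi] using (by exact_mod_cast hreal : k + w i ≤ u i)
    · simp [indicatorLabel, hi, w]
  obtain ⟨b, rfl⟩ := exists_add_of_le hle
  have hb {i : I} (hi : i ∈ T) :
      (b i : ℝ) = (T.card + m : ℕ) * a (Pi.single i (T.card + m)) := by
    have := hcoord hi
    simp only [Pi.add_apply, Pi.smul_apply, indicatorLabel, if_pos hi, smul_eq_mul, mul_one,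
      Nat.cast_add] at this ⊢
    linarith
  refine ⟨k, w, b, rfl, ?_, hwsupp, fun hTb => ?_, ?_⟩
  · rw [← Finset.sum_subset (Finset.subset_univ T) fun i _ hi => if_neg hi]
    have : ∑ i ∈ T, (w i : ℝ) = m * k := by
      rw [Finset.sum_congr rfl fun i hi => hwT hi, ← Finset.mul_sum, hk]
    exact_mod_cast this
  · obtain ⟨i, hi, hv⟩ := h.exists_vertex_eq_zero hT.nonempty
    exact mem_labelSupport.1 (hTb hi) (by simpa [hv] using hb hi)
  · exact h.eq_mapDomain_add hT hm hd hwsupp ((labelSupport_mono (by simp)).trans hsupp)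
      (fun i => hwT) fun i => hb

end Integrality

section FaceSplit

variable {I : Type*} [LinearOrder I] {m d : ℕ} {T : Finset I}

theorem interiorPoints_card_add_eq_append [Finite I] (hT : T.Nonempty) (hm : m ≠ 0) :
    interiorPoints (T.card + m) T = T.sort.map (cornerLabel m T) ++
      ((sortedByCard (T.powerset.filter fun S => 2 ≤ S.card)).flatMap (interiorPoints m)).map
        (indicatorLabel T + ·) := by
  rw [interiorPoints_card_add hT hm, cornersFirst, List.flatMap_append, List.map_append]
  congr 1
  simp only [List.flatMap_map, interiorPoints_singleton hm, ← List.map_eq_flatMap, List.map_map]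
  rfl

variable [Fintype I] {u : I → ℕ}

theorem foldl_subdivide_corners_indicatorLabel_add (hT : T.Nontrivial) (hm : m ≠ 0)
    (hu : labelSupport u ⊆ T) (hsum : ∑ i, u i = m) :
    (T.sort.map (cornerLabel m T)).foldl subdivide (vertexCoeffs (T.card + m))
      (indicatorLabel T + u) = (vertexCoeffs m u).mapDomain (indicatorLabel T + ·) := by
  have hd : T.card + m ≠ 0 := by omega
  have hsupp := labelSupport_indicatorLabel_add hu
  have hrep := (represents_vertexCoeffs hd LinearMap.id).foldl_subdivide
    (T.sort.map (cornerLabel m T)) (indicatorLabel T + u)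
  have htotal : ∑ i, (indicatorLabel T + u) i = T.card + m := by
    simp [Finset.sum_add_distrib, sum_indicatorLabel, hsum]
  obtain ⟨k, w, b, hkwb, hw, -, hb, ha⟩ := (isCornerState_foldl_subdivide hT hm hd
    hsupp.subset).exists_eq_mapDomain_add hT hm hrep.1 hrep.2 hsupp.subset htotal.symm.dvd
  have hsums : T.card + m = k * (T.card + m) + ∑ i, b i := by
    conv_lhs => rw [← htotal, hkwb]
    simp only [Pi.add_apply, Pi.smul_apply, smul_eq_mul, Finset.sum_add_distrib, ← Finset.mul_sum,
      sum_indicatorLabel, hw]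
    ring
  obtain rfl | rfl | hk : k = 0 ∨ k = 1 ∨ 2 ≤ k := by omega
  · have hw0 : w = 0 := by
      ext i
      exact Finset.sum_eq_zero_iff.1 hw i (Finset.mem_univ i)
    rw [hw0, zero_smul, zero_add, zero_add] at hkwb
    exact absurd (hkwb ▸ hsupp.superset) hb
  · have hb0 : b = 0 := by
      ext i
      exact Finset.sum_eq_zero_iff.1 (by omega : ∑ i, b i = 0) i (Finset.mem_univ i)
    have hwu : u = w := by simpa [hb0] using hkwb
    simpa [hb0, hwu, vertexCoeffs] using ha
  · have := Nat.mul_le_mul_right (T.card + m) hk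
    omega

/-- All coefficients are natural numbers. -/
def IsNatural {Λ : Type*} (a : Λ →₀ ℝ) : Prop := ∀ r, ∃ k : ℕ, a r = k

theorem IsNatural.add {Λ : Type*} {a b : Λ →₀ ℝ} (ha : IsNatural a) (hb : IsNatural b) :
    IsNatural (a + b) := fun r => by
  obtain ⟨k, hk⟩ := ha r
  obtain ⟨l, hl⟩ := hb r
  exact ⟨k + l, by simp [hk, hl]⟩

theorem IsNatural.mapDomain {Λ Λ' : Type*} {f : Λ → Λ'} (hf : f.Injective) {a : Λ →₀ ℝ}
    (ha : IsNatural a) : IsNatural (a.mapDomain f) := fun r => by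
  by_cases hr : r ∈ Set.range f
  · obtain ⟨s, rfl⟩ := hr
    simpa only [Finsupp.mapDomain_apply hf] using ha s
  · exact ⟨0, by simp [Finsupp.mapDomain_of_notMem_range _ _ hr]⟩

theorem isNatural_single {Λ : Type*} (r : Λ) (k : ℕ) :
    IsNatural (Finsupp.single r (k : ℝ)) := fun s => by
  classical
  exact ⟨if r = s then k else 0, by simp [Finsupp.single_apply]⟩

/-- The shape of the coefficients of `u` after the star subdivisions at the interior points of the
face `T`: integral coefficients at points that involve all of `T`, plus the initial coefficients of
a point `b` that does not. -/
def IsFaceSplit (d : ℕ) (T : Finset I) (u : I → ℕ) (a : (I → ℕ) →₀ ℝ) : Prop :=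
  ∃ (N : (I → ℕ) →₀ ℝ) (b : I → ℕ), a = N + vertexCoeffs d b ∧ IsNatural N ∧
    (∀ r ∈ N.support, T ⊆ labelSupport r) ∧ b ≤ u ∧ d ∣ ∑ i, b i ∧ ¬ T ⊆ labelSupport b

theorem isFaceSplit_interiorPoints_card (hT : T.Nonempty) (hu : T.card ∣ ∑ i, u i) :
    IsFaceSplit T.card T u ((interiorPoints T.card T).foldl subdivide (vertexCoeffs T.card) u) := by
  have hd : T.card ≠ 0 := hT.card_ne_zero
  have hrep := represents_vertexCoeffs (I := I) hd LinearMap.id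
  obtain ⟨i, hi, hmin⟩ := T.exists_min_image u hT
  obtain ⟨b, hb⟩ : ∃ b, u = u i • indicatorLabel T + b := by
    refine le_iff_exists_add.1 fun j => ?_
    by_cases hj : j ∈ T
    · simpa [indicatorLabel, hj] using hmin j hj
    · simp [indicatorLabel, hj]
  have hbi : b i = 0 := by simpa [indicatorLabel, hi] using congrFun hb i
  have ha : vertexCoeffs T.card u =
      (u i : ℝ) • vertexCoeffs T.card (indicatorLabel T) + vertexCoeffs T.card b := by
    conv_lhs => rw [hb, vertexCoeffs_add, vertexCoeffs_nsmul]
  have hκi : vertexCoeffs T.card (indicatorLabel T) (Pi.single i T.card) ≠ 0 := by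
    simpa [vertexCoeffs_apply_single hd, indicatorLabel, hi] using hd
  have hcoeff :
      starCoeff (vertexCoeffs T.card (indicatorLabel T)) (vertexCoeffs T.card u) = u i := by
    refine starCoeff_eq_of_smul_le (hrep _).1 (hrep _).1 ?_ (Finsupp.mem_support_iff.2 hκi) ?_
    · exact ha ▸ le_add_of_nonneg_right (hrep b).1
    · rw [ha, Finsupp.add_apply, vertexCoeffs_apply_single hd b, hbi]
      simp
  refine ⟨Finsupp.single (indicatorLabel T) (u i : ℝ), b, ?_, isNatural_single _ _, ?_, ?_, ?_,
    fun h => mem_labelSupport.1 (h hi) hbi⟩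
  · rw [interiorPoints_card hT, List.foldl_cons, List.foldl_nil, subdivide, starReduce, hcoeff]
    nth_rw 1 [ha]
    abel
  · intro r hr
    rw [Finset.mem_singleton.1 (Finsupp.support_single_subset hr)]
    exact subset_labelSupport_indicatorLabel_add T 0
  · exact hb.ge.trans' le_add_self
  · rw [hb] at hu
    simp only [Pi.add_apply, Pi.smul_apply, smul_eq_mul, Finset.sum_add_distrib, ← Finset.mul_sum,
      sum_indicatorLabel] at hu
    exact (Nat.dvd_add_right (dvd_mul_left _ _)).1 hu

theorem isFaceSplit_interiorPoints_card_add (hT : T.Nontrivial) (hm : m ≠ 0)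
    (hu : T.card + m ∣ ∑ i, u i) (hsupp : labelSupport u ⊆ T)
    (hnat : ∀ w, m ∣ ∑ i, w i → labelSupport w ⊆ T →
      IsNatural (((sortedByCard (T.powerset.filter fun S => 2 ≤ S.card)).flatMap
        (interiorPoints m)).foldl subdivide (vertexCoeffs m) w)) :
    IsFaceSplit (T.card + m) T u
      ((interiorPoints (T.card + m) T).foldl subdivide (vertexCoeffs (T.card + m)) u) := by
  have hd : T.card + m ≠ 0 := by omega
  have hrep := (represents_vertexCoeffs hd LinearMap.id).foldl_subdivide
    (T.sort.map (cornerLabel m T)) u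
  obtain ⟨k, w, b, hkwb, hw, hwT, hb, ha⟩ := (isCornerState_foldl_subdivide hT hm hd
    hsupp).exists_eq_mapDomain_add hT hm hrep.1 hrep.2 hsupp hu
  rw [interiorPoints_card_add_eq_append hT.nonempty hm, List.foldl_append]
  set Q := (sortedByCard (T.powerset.filter fun S => 2 ≤ S.card)).flatMap (interiorPoints m)
  have hmemQ : ∀ q ∈ Q, labelSupport q ⊆ T ∧ ∑ i, q i = m := by
    simp only [Q, List.mem_flatMap, mem_sortedByCard, Finset.mem_filter, Finset.mem_powerset,
      mem_interiorPoints]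
    rintro q ⟨S, ⟨hS, -⟩, -, rfl, hq⟩
    exact ⟨hS, hq⟩
  have havoid : ∀ r, vertexCoeffs (T.card + m) b (indicatorLabel T + r) = 0 := by
    intro r
    by_contra hr
    obtain ⟨i, -, hi⟩ := exists_of_mem_support_vertexCoeffs (Finsupp.mem_support_iff.2 hr)
    have := subset_labelSupport_indicatorLabel_add T r
    rw [hi, labelSupport_single hd] at this
    exact hT.not_subset_singleton this
  have hfold := foldl_subdivide_add_mapDomain (S := {r | labelSupport r ⊆ T}) (Q := Q)
    (add_right_injective (indicatorLabel T)) (fun q hq => ⟨(hmemQ q hq).1, fun r hr =>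
      (labelSupport_subset_of_mem_support (represents_vertexCoeffs hm LinearMap.id q).1
        (represents_vertexCoeffs hm LinearMap.id q).2 hr).trans (hmemQ q hq).1,
      foldl_subdivide_corners_indicatorLabel_add hT hm (hmemQ q hq).1 (hmemQ q hq).2⟩)
    (fun r _ => havoid r) (ha.trans (add_comm _ _))
  refine ⟨_, b, hfold.trans (add_comm _ _), (hnat w ⟨k, hw⟩ hwT).mapDomain
    (add_right_injective (indicatorLabel T)), fun r hr => ?_, hkwb ▸ le_add_self, ?_, hb⟩
  · obtain ⟨s, -, rfl⟩ := Finset.mem_image.1 (Finsupp.mapDomain_support hr)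
    exact subset_labelSupport_indicatorLabel_add T s
  · have hsums : ∑ i, u i = (T.card + m) * k + ∑ i, b i := by
      simp only [hkwb, Pi.add_apply, Pi.smul_apply, smul_eq_mul, Finset.sum_add_distrib,
        ← Finset.mul_sum, sum_indicatorLabel, hw]
      ring
    exact (Nat.dvd_add_right (dvd_mul_right _ k)).1 (hsums ▸ hu)

end FaceSplit

section Integrality

variable {I : Type*} [LinearOrder I] [Fintype I] {d : ℕ} {T : Finset I} {u : I → ℕ}

omit [LinearOrder I] in
theorem dvd_of_dvd_sum_of_card_labelSupport_le_one (hu : d ∣ ∑ i, u i)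
    (h : (labelSupport u).card ≤ 1) (i : I) : d ∣ u i := by
  by_cases hi : i ∈ labelSupport u
  · rwa [Finset.sum_eq_single i (fun j _ hj => ?_) (by simp)] at hu
    exact notMem_labelSupport.1 fun hj' => hj (Finset.card_le_one.1 h j hj' i hi)
  · simp [notMem_labelSupport.1 hi]

theorem isNatural_vertexCoeffs (h : ∀ i, d ∣ u i) : IsNatural (vertexCoeffs d u) := by
  refine Finset.sum_induction _ IsNatural (fun _ _ => IsNatural.add) (fun r => ⟨0, by simp⟩)
    fun i _ => ?_
  rw [← Nat.cast_div_charZero (h i)]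
  exact isNatural_single _ _

theorem foldl_subdivide_interiorPoints_of_card (hd : d ≠ 0) (hT : ¬ (2 ≤ T.card ∧ T.card ≤ d)) :
    (interiorPoints d T).foldl subdivide (vertexCoeffs d) = vertexCoeffs d := by
  by_cases h : T.Nonempty ∧ T.card ≤ d
  · obtain ⟨i, rfl⟩ := Finset.card_eq_one.1 (by have := h.1.card_pos; omega : T.card = 1)
    ext1 u
    simp [interiorPoints_singleton hd, subdivide, vertexCoeffs_single hd]
  · simp [interiorPoints_eq_nil h]

theorem foldl_subdivide_interiorPoints_of_not_subset (hd : d ≠ 0) (hT : ¬ T ⊆ labelSupport u) :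
    (interiorPoints d T).foldl subdivide (vertexCoeffs d) u = vertexCoeffs d u :=
  foldl_subdivide_eq_of_not_subset (represents_vertexCoeffs hd LinearMap.id) fun _ hv =>
    (mem_interiorPoints.1 hv).2.1 ▸ hT

theorem isFaceSplit_interiorPoints (hT : T.Nontrivial) (hTd : T.card ≤ d)
    (hu : d ∣ ∑ i, u i) (hmax : T.card < d → T ⊆ labelSupport u → labelSupport u ⊆ T)
    (ih : ∀ m < d, m ≠ 0 → ∀ w : I → ℕ, m ∣ ∑ i, w i → labelSupport w ⊆ T →
      IsNatural (((sortedByCard (T.powerset.filter fun S => 2 ≤ S.card)).flatMap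
        (interiorPoints m)).foldl subdivide (vertexCoeffs m) w)) :
    IsFaceSplit d T u ((interiorPoints d T).foldl subdivide (vertexCoeffs d) u) := by
  have hpos := hT.nonempty.card_pos
  by_cases hsub : T ⊆ labelSupport u
  · obtain rfl | hlt := hTd.eq_or_lt
    · exact isFaceSplit_interiorPoints_card hT.nonempty hu
    · obtain ⟨m, rfl⟩ := Nat.exists_eq_add_of_le hTd
      exact isFaceSplit_interiorPoints_card_add hT (by omega) hu (hmax hlt hsub)
        (ih m (by omega) (by omega))
  · rw [foldl_subdivide_interiorPoints_of_not_subset (by omega) hsub]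
    exact ⟨0, u, (zero_add _).symm, fun _ => ⟨0, by simp⟩, by simp, le_rfl, hu, hsub⟩

/-- After the star subdivisions at the interior points of `T`, the part of the coefficients that
involves all of `T` is left alone by the later subdivisions, which treat the rest like a point that
does not involve all of `T`. -/
theorem IsFaceSplit.isNatural_foldl_subdivide (hd : d ≠ 0) {Ts : List (Finset I)}
    (hsplit : IsFaceSplit d T u ((interiorPoints d T).foldl subdivide (vertexCoeffs d) u))
    (hTs : ∀ S ∈ Ts, ¬ T ⊆ S)
    (ih : ∀ b ≤ u, ¬ T ⊆ labelSupport b → d ∣ ∑ i, b i →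
      IsNatural ((Ts.flatMap (interiorPoints d)).foldl subdivide (vertexCoeffs d) b)) :
    IsNatural ((Ts.flatMap (interiorPoints d)).foldl subdivide
      ((interiorPoints d T).foldl subdivide (vertexCoeffs d)) u) := by
  obtain ⟨N, b, ha, hN, hNT, hbu, hdvd, hb⟩ := hsplit
  have hrep := represents_vertexCoeffs (I := I) hd LinearMap.id
  have hsupp : ∀ q ∈ Ts.flatMap (interiorPoints d), ¬ T ⊆ labelSupport q := by
    intro q hq
    obtain ⟨S, hS, hqS⟩ := List.mem_flatMap.1 hq
    exact (mem_interiorPoints.1 hqS).2.1 ▸ hTs S hS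
  have hfold := foldl_subdivide_add_mapDomain (f := id) Function.injective_id
    (S := {r | ¬ T ⊆ labelSupport r}) (fun q hq => ⟨hsupp q hq, fun r hr h => hsupp q hq
      (h.trans (labelSupport_subset_of_mem_support (hrep q).1 (hrep q).2 hr)), ?_⟩)
    (fun r hr => Finsupp.notMem_support_iff.1 fun h => hr (hNT r h))
    (ha.trans (by rw [Finsupp.mapDomain_id]))
  · rw [List.map_id, Finsupp.mapDomain_id] at hfold
    exact hfold ▸ hN.add (ih b hbu hb hdvd)
  · rw [Finsupp.mapDomain_id]
    exact foldl_subdivide_interiorPoints_of_not_subset hd (hsupp q hq)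

theorem isNatural_foldl_subdivide (hd : d ≠ 0) {Ts : List (Finset I)}
    (hTs : Ts.Pairwise fun A B => B.card ≤ A.card ∧ A ≠ B) (hu : d ∣ ∑ i, u i)
    (hmem : ∀ S ⊆ labelSupport u, 2 ≤ S.card → S.card ≤ d → S ∈ Ts) :
    IsNatural ((Ts.flatMap (interiorPoints d)).foldl subdivide (vertexCoeffs d) u) := by
  induction d using Nat.strong_induction_on generalizing Ts u with | _ d ihd
  induction Ts generalizing u with
  | nil =>
    refine isNatural_vertexCoeffs fun i => ?_
    obtain rfl | hd2 : d = 1 ∨ 2 ≤ d := by omega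
    · exact one_dvd _
    · refine dvd_of_dvd_sum_of_card_labelSupport_le_one hu ?_ i
      by_contra! hcard
      obtain ⟨S, hS, hS2⟩ := Finset.exists_subset_card_eq hcard
      exact List.not_mem_nil (hmem S hS hS2.ge (hS2.trans_le hd2))
  | cons T Ts ih =>
    obtain ⟨hT, hTs⟩ := List.pairwise_cons.1 hTs
    rw [List.flatMap_cons, List.foldl_append]
    by_cases hcard : 2 ≤ T.card ∧ T.card ≤ d
    · have hmax (hlt : T.card < d) (hsub : T ⊆ labelSupport u) : labelSupport u ⊆ T := by
        by_contra hnot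
        obtain ⟨i, hi, hiT⟩ := Finset.not_subset.1 hnot
        have hins := Finset.card_insert_of_notMem hiT
        obtain h | h := List.mem_cons.1 (hmem (insert i T) (Finset.insert_subset hi hsub)
          (by omega) (by omega))
        · exact hiT (h ▸ Finset.mem_insert_self i T)
        · exact (hT _ h).1.not_gt (by omega)
      refine (isFaceSplit_interiorPoints (Finset.one_lt_card_iff_nontrivial.1 hcard.1) hcard.2 hu
        hmax fun m hm hm0 w hw hwT => ihd m hm hm0 (pairwise_sortedByCard _) hw
          fun S hS hS2 _ => ?_).isNatural_foldl_subdivide hd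
          (fun S hS hsub => (hT S hS).2 (Finset.eq_of_subset_of_card_le hsub (hT S hS).1))
          fun b hbu hb hdvd => ih hTs hdvd fun S hS hS2 hSd => ?_
      · simpa using ⟨hS.trans hwT, hS2⟩
      · refine (List.mem_cons.1 (hmem S (hS.trans (labelSupport_mono hbu)) hS2 hSd)).resolve_left ?_
        exact fun h => hb (h ▸ hS)
    · rw [foldl_subdivide_interiorPoints_of_card hd hcard]
      refine ih hTs hu fun S hS hS2 hSd => (List.mem_cons.1 (hmem S hS hS2 hSd)).resolve_left ?_
      rintro rfl
      exact hcard ⟨hS2, hSd⟩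

end Integrality

/-! ### Star subdivisions of simplicial fans -/

section LinearCombination

variable {Λ E : Type*} [AddCommGroup E] [Module ℝ E] {vec : Λ → E} {φ ψ : Λ → ℝ} {a : Λ →₀ ℝ}

theorem support_subset_of_nonneg_of_le {b : Λ →₀ ℝ} (hb : 0 ≤ b) (h : b ≤ a) :
    b.support ⊆ a.support := fun v hv => by
  rw [Finsupp.mem_support_iff] at hv ⊢
  exact (((hb v).lt_of_ne' hv).trans_le (h v)).ne'

theorem linearCombination_congr (h : ∀ v ∈ a.support, φ v = ψ v) :
    Finsupp.linearCombination ℝ φ a = Finsupp.linearCombination ℝ ψ a := by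
  rw [Finsupp.linearCombination_apply, Finsupp.linearCombination_apply]
  exact Finset.sum_congr rfl fun v hv => congrArg (a v * ·) (h v hv)

theorem linearCombination_le (ha : 0 ≤ a) (h : ∀ v ∈ a.support, φ v ≤ ψ v) :
    Finsupp.linearCombination ℝ φ a ≤ Finsupp.linearCombination ℝ ψ a := by
  rw [Finsupp.linearCombination_apply, Finsupp.linearCombination_apply]
  exact Finset.sum_le_sum fun v hv => mul_le_mul_of_nonneg_left (h v hv) (ha v)

theorem linearCombination_lt (ha : 0 ≤ a) (h : ∀ v ∈ a.support, φ v ≤ ψ v)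
    (hlt : ∃ v ∈ a.support, φ v < ψ v) :
    Finsupp.linearCombination ℝ φ a < Finsupp.linearCombination ℝ ψ a := by
  rw [Finsupp.linearCombination_apply, Finsupp.linearCombination_apply]
  obtain ⟨v, hv, hlt⟩ := hlt
  refine Finset.sum_lt_sum (fun v hv => mul_le_mul_of_nonneg_left (h v hv) (ha v)) ⟨v, hv, ?_⟩
  exact mul_lt_mul_of_pos_left hlt ((ha v).lt_of_ne' (Finsupp.mem_support_iff.1 hv))

theorem map_linearCombination (g : E →ₗ[ℝ] ℝ) (a : Λ →₀ ℝ) :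
    g (Finsupp.linearCombination ℝ vec a) = Finsupp.linearCombination ℝ (fun v => g (vec v)) a :=
  Finsupp.apply_linearCombination ℝ g vec a

end LinearCombination

section Fan

open Filter Topology

variable {Λ E : Type*} [AddCommGroup E] [Module ℝ E]

/-- `g` is the linear function that the support function with values `ψ` at the rays agrees with
on the cone `t` of the fan `K`, and it is smaller than the support function elsewhere. -/
def IsStrictSupport (vec : Λ → E) (K : Set (Finset Λ)) (ψ : Λ → ℝ) (t : Finset Λ)
    (g : E →ₗ[ℝ] ℝ) : Prop :=
  (∀ v ∈ t, g (vec v) = ψ v) ∧ ∀ v, {v} ∈ K → v ∉ t → g (vec v) < ψ v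

namespace IsStrictSupport

variable {vec : Λ → E} {K : Set (Finset Λ)} {ψ : Λ → ℝ} {t : Finset Λ} {g : E →ₗ[ℝ] ℝ} {a : Λ →₀ ℝ}

theorem map_linearCombination_eq (hg : IsStrictSupport vec K ψ t g) (hat : a.support ⊆ t) :
    g (Finsupp.linearCombination ℝ vec a) = Finsupp.linearCombination ℝ ψ a := by
  rw [map_linearCombination]
  exact linearCombination_congr fun v hv => hg.1 v (hat hv)

theorem apply_le (hg : IsStrictSupport vec K ψ t g) {v : Λ} (hv : {v} ∈ K) : g (vec v) ≤ ψ v := by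
  by_cases hvt : v ∈ t
  · exact (hg.1 v hvt).le
  · exact (hg.2 v hv hvt).le

theorem map_linearCombination_le (hg : IsStrictSupport vec K ψ t g) (ha : 0 ≤ a)
    (haK : ∀ v ∈ a.support, {v} ∈ K) :
    g (Finsupp.linearCombination ℝ vec a) ≤ Finsupp.linearCombination ℝ ψ a := by
  rw [map_linearCombination]
  exact linearCombination_le ha fun v hv => hg.apply_le (haK v hv)

theorem map_linearCombination_lt (hg : IsStrictSupport vec K ψ t g) (ha : 0 ≤ a)
    (haK : ∀ v ∈ a.support, {v} ∈ K) (hat : ¬ a.support ⊆ t) :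
    g (Finsupp.linearCombination ℝ vec a) < Finsupp.linearCombination ℝ ψ a := by
  obtain ⟨v, hv, hvt⟩ := Finset.not_subset.1 hat
  rw [map_linearCombination]
  exact linearCombination_lt ha (fun w hw => hg.apply_le (haK w hw)) ⟨v, hv, hg.2 v (haK v hv) hvt⟩

end IsStrictSupport

/-- `K` is the set of the generating sets of the cones of a complete simplicial fan with rays
`vec v`, of pure dimension `n`, which has a strictly convex support function. -/
structure IsRegularFan (vec : Λ → E) (n : ℕ) (K : Set (Finset Λ)) : Prop where
  down : ∀ s ∈ K, ∀ t ⊆ s, t ∈ K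
  finite : K.Finite
  exists_rep : ∀ x : E, ∃ a : Λ →₀ ℝ, 0 ≤ a ∧ a.support ∈ K ∧ Finsupp.linearCombination ℝ vec a = x
  unique : ∀ a b : Λ →₀ ℝ, 0 ≤ a → 0 ≤ b → a.support ∈ K → b.support ∈ K →
    Finsupp.linearCombination ℝ vec a = Finsupp.linearCombination ℝ vec b → a = b
  pure : ∀ s ∈ K, ∃ t ∈ K, s ⊆ t ∧ t.card = n
  regular : ∃ ψ : Λ → ℝ, ∀ t ∈ K, t.card = n → ∃ g, IsStrictSupport vec K ψ t g

variable {vec : Λ → E} {n : ℕ} {K : Set (Finset Λ)} {v : Λ} {κ : Λ →₀ ℝ} {s t : Finset Λ}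

namespace IsRegularFan

theorem singleton_mem (hK : IsRegularFan vec n K) (hs : s ∈ K) (hv : v ∈ s) : {v} ∈ K :=
  hK.down s hs _ (Finset.singleton_subset_iff.2 hv)

theorem card_le (hK : IsRegularFan vec n K) (hs : s ∈ K) : s.card ≤ n := by
  obtain ⟨t, -, h, rfl⟩ := hK.pure s hs
  exact Finset.card_le_card h

theorem eq_single (hK : IsRegularFan vec n K) (hv : {v} ∈ K) (hκ : 0 ≤ κ) (hκs : κ.support ∈ K)
    (h : Finsupp.linearCombination ℝ vec κ = vec v) : κ = Finsupp.single v 1 := by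
  refine hK.unique _ _ hκ (Finsupp.single_nonneg.2 zero_le_one) hκs ?_ (by simp [h])
  rwa [Finsupp.support_single _ one_ne_zero]

theorem linearIndepOn (hK : IsRegularFan vec n K) (hs : s ∈ K) :
    LinearIndepOn ℝ vec (s : Set Λ) := by
  rw [linearIndepOn_iff]
  intro l hl h0
  rw [Finsupp.mem_supported, Finset.coe_subset] at hl
  set a : Λ →₀ ℝ := l.mapRange (fun x => max x 0) (by simp)
  set b : Λ →₀ ℝ := l.mapRange (fun x => max (-x) 0) (by simp)
  have hab : a - b = l := by
    ext v
    simp only [a, b, Finsupp.sub_apply, Finsupp.mapRange_apply]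
    rcases le_total (l v) 0 with h | h <;> simp [h]
  have heq : a = b := hK.unique a b (fun v => by simp [a]) (fun v => by simp [b])
    (hK.down s hs _ (Finsupp.support_mapRange.trans hl))
    (hK.down s hs _ (Finsupp.support_mapRange.trans hl)) (by rw [← sub_eq_zero, ← map_sub, hab, h0])
  rw [← hab, heq, sub_self]

theorem exists_functional (hK : IsRegularFan vec n K) (hs : s ∈ K) (c : Λ → ℝ) :
    ∃ g : E →ₗ[ℝ] ℝ, ∀ v ∈ s, g (vec v) = c v := by
  have hli : LinearIndependent ℝ (fun v : (s : Set Λ) => vec v) := hK.linearIndepOn hs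
  obtain ⟨g, hg⟩ := LinearMap.exists_extend
    ((Finsupp.linearCombination ℝ fun v : (s : Set Λ) => c v).comp hli.repr)
  refine ⟨g, fun v hv => ?_⟩
  have hgv := LinearMap.congr_fun hg ⟨vec v, Submodule.subset_span ⟨⟨v, hv⟩, rfl⟩⟩
  rw [LinearMap.comp_apply, LinearMap.comp_apply, Submodule.subtype_apply] at hgv
  rw [hgv]
  change Finsupp.linearCombination ℝ (fun v : (s : Set Λ) => c v) (hli.repr _) = c v
  rw [hli.repr_eq_single ⟨v, hv⟩ _ rfl]
  simp

end IsRegularFan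

variable [DecidableEq Λ]

/-- The combinatorial star subdivision of `K` at `v`, where `v` lies in the relative interior of
the cone `C`. -/
def starComplex (K : Set (Finset Λ)) (v : Λ) (C : Finset Λ) : Set (Finset Λ) :=
  {s | s ∈ K ∧ ¬ C ⊆ s} ∪ {t | ∃ s ∈ K, ¬ C ⊆ s ∧ s ∪ C ∈ K ∧ t = insert v s}

theorem singleton_mem_starComplex {w : Λ} {C : Finset Λ} (h : {w} ∈ starComplex K v C) :
    {w} ∈ K ∨ w = v := by
  rcases h with h | ⟨s, -, -, -, h⟩
  · exact Or.inl h.1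
  · have hv : v ∈ ({w} : Finset Λ) := h ▸ Finset.mem_insert_self v s
    exact Or.inr (Finset.mem_singleton.1 hv).symm

theorem starComplex_finite (hK : K.Finite) (v : Λ) (C : Finset Λ) : (starComplex K v C).Finite := by
  refine (hK.union (hK.image (insert v))).subset ?_
  rintro s (h | ⟨s, hs, -, -, rfl⟩)
  · exact Or.inl h.1
  · exact Or.inr ⟨s, hs, rfl⟩

namespace IsRegularFan

theorem starComplex_singleton (hK : IsRegularFan vec n K) : starComplex K v {v} = K := by
  ext s
  constructor
  · rintro (h | ⟨s, -, -, h, rfl⟩)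
    · exact h.1
    · rwa [Finset.union_comm, ← Finset.insert_eq] at h
  · intro hs
    by_cases h : v ∈ s
    · refine Or.inr ⟨s.erase v, hK.down _ hs _ (Finset.erase_subset _ _), by simp, ?_, ?_⟩
      · rwa [Finset.union_comm, ← Finset.insert_eq, Finset.insert_erase h]
      · rw [Finset.insert_erase h]
    · exact Or.inl ⟨hs, by simpa using h⟩

theorem starComplex_down (hK : IsRegularFan vec n K) {C : Finset Λ} (hs : s ∈ starComplex K v C)
    (hts : t ⊆ s) : t ∈ starComplex K v C := by
  rcases hs with ⟨hs, hCs⟩ | ⟨s, hs, hCs, hsC, rfl⟩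
  · exact Or.inl ⟨hK.down s hs t hts, fun h => hCs (h.trans hts)⟩
  · by_cases hvt : v ∈ t
    · have hsub : t.erase v ⊆ s := Finset.subset_insert_iff.1 hts
      exact Or.inr ⟨t.erase v, hK.down s hs _ hsub, fun h => hCs (h.trans hsub),
        hK.down _ hsC _ (Finset.union_subset_union hsub le_rfl), (Finset.insert_erase hvt).symm⟩
    · have hsub : t ⊆ s := (Finset.subset_insert_iff_of_notMem hvt).1 hts
      exact Or.inl ⟨hK.down s hs _ hsub, fun h => hCs (h.trans hsub)⟩

theorem support_starReduce_mem (hK : IsRegularFan vec n K) (hκ : 0 ≤ κ) (hκ0 : κ ≠ 0)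
    {a : Λ →₀ ℝ} (ha : 0 ≤ a) (has : a.support ∈ K) :
    (starReduce v κ a).support ∈ starComplex K v κ.support := by
  obtain ⟨r, hr, hr'⟩ := exists_eq_starCoeff_mul (a := a) hκ0
  have hle := starCoeff_smul_le hκ ha
  rcases (starCoeff_nonneg hκ ha).eq_or_lt with hc | hc
  · rw [← hc, zero_mul] at hr'
    rw [starReduce_eq_self_of_apply_eq_zero hκ ha hr hr']
    exact Or.inl ⟨has, fun hsub => Finsupp.mem_support_iff.1 (hsub hr) hr'⟩
  · set e := a - starCoeff κ a • κ with he
    have he0 : 0 ≤ e := sub_nonneg.2 hle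
    have hea : e.support ⊆ a.support :=
      support_subset_of_nonneg_of_le he0 (sub_le_self a (smul_nonneg hc.le hκ))
    have hκa : κ.support ⊆ a.support := by
      rw [← Finsupp.support_smul_eq hc.ne']
      exact support_subset_of_nonneg_of_le (smul_nonneg hc.le hκ) hle
    refine Or.inr ⟨e.support, hK.down _ has _ hea, fun h => ?_,
      hK.down _ has _ (Finset.union_subset hea hκa), ?_⟩
    · exact Finsupp.mem_support_iff.1 (h hr) (by simp [he, hr'])
    · ext w
      by_cases hwv : w = v
      · subst hwv
        have hpos : 0 < e w + starCoeff κ a := add_pos_of_nonneg_of_pos (he0 w) hc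
        simp [starReduce, ← he, hpos.ne']
      · simp [starReduce, ← he, hwv]

theorem exists_starReduce_eq (hK : IsRegularFan vec n K) (hκ : 0 ≤ κ) {b : Λ →₀ ℝ}
    (hb : 0 ≤ b) (hbs : b.support ∈ starComplex K v κ.support) :
    ∃ a, 0 ≤ a ∧ a.support ∈ K ∧ starReduce v κ a = b := by
  rcases hbs with ⟨hbK, hκb⟩ | ⟨s, -, hκs, hsκ, heq⟩
  · obtain ⟨r, hr, hr'⟩ := Finset.not_subset.1 hκb
    exact ⟨b, hb, hbK, starReduce_eq_self_of_apply_eq_zero hκ hb hr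
      (Finsupp.notMem_support_iff.1 hr')⟩
  · obtain ⟨r, hr, hrs⟩ := Finset.not_subset.1 hκs
    have he0 : 0 ≤ b.erase v := fun w => by
      by_cases hw : w = v
      · simp [hw]
      · simpa [Finsupp.erase_ne hw] using hb w
    have hes : (b.erase v).support ⊆ s := by
      rw [Finsupp.support_erase, heq]
      exact Finset.erase_insert_subset _ _
    have ha : 0 ≤ b.erase v + b v • κ := add_nonneg he0 (smul_nonneg (hb v) hκ)
    have hcoeff : starCoeff κ (b.erase v + b v • κ) = b v := by
      refine starCoeff_eq_of_smul_le hκ ha (le_add_of_nonneg_left he0) hr ?_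
      simp [Finsupp.notMem_support_iff.1 fun h => hrs (hes h)]
    refine ⟨_, ha, hK.down _ hsκ _ (Finsupp.support_add.trans
      (Finset.union_subset_union hes Finsupp.support_smul)), ?_⟩
    rw [starReduce, hcoeff, add_sub_cancel_right, add_comm]
    exact Finsupp.single_add_erase _ _

theorem exists_mem_starComplex_insert_subset (hK : IsRegularFan vec n K) (hvK : ∀ s ∈ K, v ∉ s)
    {C : Finset Λ} (hCs : ¬ C ⊆ s) (ht : t ∈ K) (hCt : C ⊆ t) (hst : s ⊆ t) :
    ∃ t' ∈ starComplex K v C, insert v s ⊆ t' ∧ t'.card = t.card := by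
  obtain ⟨r, hr, hrs⟩ := Finset.not_subset.1 hCs
  have herase := Finset.erase_subset r t
  refine ⟨insert v (t.erase r), Or.inr ⟨t.erase r, hK.down t ht _ herase, fun h => ?_,
    hK.down t ht _ (Finset.union_subset herase hCt), rfl⟩, Finset.insert_subset_insert _ ?_, ?_⟩
  · exact Finset.notMem_erase r t (h hr)
  · exact Finset.subset_erase.2 ⟨hst, hrs⟩
  · rw [Finset.card_insert_of_notMem fun h => hvK t ht (herase h),
      Finset.card_erase_add_one (hCt hr)]

theorem starComplex_pure (hK : IsRegularFan vec n K) (hvK : ∀ s ∈ K, v ∉ s) {C : Finset Λ}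
    (hs : s ∈ starComplex K v C) : ∃ t ∈ starComplex K v C, s ⊆ t ∧ t.card = n := by
  rcases hs with ⟨hs, hCs⟩ | ⟨s, -, hCs, hsC, rfl⟩
  · obtain ⟨t, ht, hst, htn⟩ := hK.pure s hs
    by_cases hCt : C ⊆ t
    · obtain ⟨t', ht', hsub, hc⟩ := hK.exists_mem_starComplex_insert_subset hvK hCs ht hCt hst
      exact ⟨t', ht', (Finset.subset_insert _ _).trans hsub, hc.trans htn⟩
    · exact ⟨t, Or.inl ⟨ht, hCt⟩, hst, htn⟩
  · obtain ⟨t, ht, hst, htn⟩ := hK.pure _ hsC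
    rw [← htn]
    exact hK.exists_mem_starComplex_insert_subset hvK hCs ht (Finset.subset_union_right.trans hst)
      (Finset.subset_union_left.trans hst)

theorem isStrictSupport_of_not_subset (hK : IsRegularFan vec n K) (hκ : 0 ≤ κ)
    (hκs : κ.support ∈ K) (hv : Finsupp.linearCombination ℝ vec κ = vec v)
    (hvK : ∀ s ∈ K, v ∉ s) {ψ : Λ → ℝ} (ht : t ∈ K) (hκt : ¬ κ.support ⊆ t) {g : E →ₗ[ℝ] ℝ}
    (hg : IsStrictSupport vec K ψ t g) :
    ∀ᶠ ε in 𝓝[>] 0, IsStrictSupport vec (starComplex K v κ.support)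
      (Function.update ψ v (Finsupp.linearCombination ℝ ψ κ - ε)) t g := by
  have hne {w : Λ} (hw : {w} ∈ K) : w ≠ v := by
    rintro rfl
    exact hvK _ hw (Finset.mem_singleton_self _)
  have hlt : g (vec v) < Finsupp.linearCombination ℝ ψ κ - 0 := by
    rw [← hv, sub_zero]
    exact hg.map_linearCombination_lt hκ (fun _ => hK.singleton_mem hκs) hκt
  have hcont : Tendsto (fun ε : ℝ => Finsupp.linearCombination ℝ ψ κ - ε) (𝓝[>] 0) (𝓝 _) :=
    (tendsto_const_nhds.sub tendsto_id).mono_left nhdsWithin_le_nhds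
  filter_upwards [hcont.eventually_const_lt hlt] with ε hε
  refine ⟨fun w hw => ?_, fun w hw hwt => ?_⟩
  · rw [Function.update_of_ne (hne (hK.singleton_mem ht hw)), hg.1 w hw]
  · obtain rfl | hwv := eq_or_ne w v
    · rwa [Function.update_self]
    · rw [Function.update_of_ne hwv]
      exact hg.2 w ((singleton_mem_starComplex hw).resolve_right hwv) hwt

theorem exists_insert_mem_of_card (hK : IsRegularFan vec n K) {C : Finset Λ} (hCs : ¬ C ⊆ s)
    (hsC : s ∪ C ∈ K) (hn : s.card + 1 = n) :
    ∃ r ∈ C, r ∉ s ∧ insert r s ∈ K ∧ C ⊆ insert r s ∧ (insert r s).card = n := by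
  obtain ⟨r, hr, hrs⟩ := Finset.not_subset.1 hCs
  have hcard : (insert r s).card = n := by rw [Finset.card_insert_of_notMem hrs, hn]
  have heq : insert r s = s ∪ C := Finset.eq_of_subset_of_card_le
    (Finset.insert_subset (Finset.mem_union_right _ hr) Finset.subset_union_left)
    (hcard ▸ hK.card_le hsC)
  exact ⟨r, hr, hrs, heq ▸ hsC, heq ▸ Finset.subset_union_right, hcard⟩

/-- On a new maximal cone, the support function is that of the old maximal cone that contains it,
lowered at `v` by a multiple of the coordinate functional `φ` of the ray `r` replaced by `v`. -/
theorem exists_isStrictSupport_insert (hK : IsRegularFan vec n K) (hκ : 0 ≤ κ)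
    (hv : Finsupp.linearCombination ℝ vec κ = vec v) (hvK : ∀ s ∈ K, v ∉ s) {ψ : Λ → ℝ} {r : Λ}
    (hr : r ∈ κ.support) (hrs : r ∉ s) (hT : insert r s ∈ K) (hκT : κ.support ⊆ insert r s)
    {g : E →ₗ[ℝ] ℝ} (hg : IsStrictSupport vec K ψ (insert r s) g) :
    ∀ᶠ ε in 𝓝[>] 0, ∃ g' : E →ₗ[ℝ] ℝ, IsStrictSupport vec (starComplex K v κ.support)
      (Function.update ψ v (Finsupp.linearCombination ℝ ψ κ - ε)) (insert v s) g' := by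
  obtain ⟨φ, hφ⟩ := hK.exists_functional hT (Pi.single r 1)
  have hφr : φ (vec r) = 1 := by simp [hφ r (Finset.mem_insert_self r s)]
  have hφs {w : Λ} (hw : w ∈ s) : φ (vec w) = 0 := by
    rw [hφ w (Finset.mem_insert_of_mem hw), Pi.single_eq_of_ne (ne_of_mem_of_not_mem hw hrs)]
  have hφv : φ (vec v) = κ r := by
    rw [← hv, map_linearCombination, linearCombination_congr fun w hw => hφ w (hκT hw),
      Finsupp.linearCombination_apply, Finsupp.sum_eq_single r] <;> simp +contextual
  have hgv : g (vec v) = Finsupp.linearCombination ℝ ψ κ := by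
    rw [← hv, hg.map_linearCombination_eq hκT]
  have hpos : 0 < κ r := (hκ r).lt_of_ne' (Finsupp.mem_support_iff.1 hr)
  have hother : ∀ w ∈ {w : Λ | {w} ∈ K}, ∀ᶠ ε : ℝ in 𝓝[>] 0, w ∉ insert r s →
      g (vec w) - ε / κ r * φ (vec w) < ψ w := fun w hw => by
    by_cases hwT : w ∈ insert r s
    · exact Eventually.of_forall fun ε h => absurd hwT h
    have hcont : Tendsto (fun ε : ℝ => g (vec w) - ε / κ r * φ (vec w)) (𝓝[>] 0) (𝓝 _) :=
      (tendsto_const_nhds.sub ((tendsto_id.div_const _).mul_const _)).mono_left nhdsWithin_le_nhds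
    filter_upwards [hcont.eventually_lt_const (by simpa using hg.2 w hw hwT)] with ε hε _ using hε
  have hrays : {w : Λ | {w} ∈ K}.Finite := hK.finite.preimage Finset.singleton_injective.injOn
  filter_upwards [(eventually_all_finite hrays).2 hother, self_mem_nhdsWithin] with ε hε hε0
  refine ⟨g - (ε / κ r) • φ, fun w hw => ?_, fun w hw hwt => ?_⟩
  · rw [LinearMap.sub_apply, LinearMap.smul_apply, smul_eq_mul]
    rcases Finset.mem_insert.1 hw with rfl | hws
    · rw [Function.update_self, hgv, hφv, div_mul_cancel₀ _ hpos.ne']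
    · have hwK := hK.singleton_mem hT (Finset.mem_insert_of_mem hws)
      rw [Function.update_of_ne (fun h => hvK _ hwK (by simp [h])), hφs hws,
        hg.1 w (Finset.mem_insert_of_mem hws), mul_zero, sub_zero]
  · obtain ⟨hwv, hws⟩ := not_or.1 (Finset.mem_insert.not.1 hwt)
    rw [Function.update_of_ne hwv, LinearMap.sub_apply, LinearMap.smul_apply, smul_eq_mul]
    obtain rfl | hwr := eq_or_ne w r
    · rw [hφr, hg.1 w (Finset.mem_insert_self _ _), mul_one]
      exact sub_lt_self _ (div_pos hε0 hpos)
    · exact hε w ((singleton_mem_starComplex hw).resolve_right hwv) (by simp [hwr, hws])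

theorem starComplex_regular (hK : IsRegularFan vec n K) (hκ : 0 ≤ κ) (hκs : κ.support ∈ K)
    (hv : Finsupp.linearCombination ℝ vec κ = vec v) (hvK : ∀ s ∈ K, v ∉ s) :
    ∃ ψ : Λ → ℝ, ∀ t ∈ starComplex K v κ.support, t.card = n →
      ∃ g, IsStrictSupport vec (starComplex K v κ.support) ψ t g := by
  obtain ⟨ψ, hψ⟩ := hK.regular
  have hsmall : ∀ t ∈ starComplex K v κ.support, ∀ᶠ ε : ℝ in 𝓝[>] 0, t.card = n → ∃ g,
      IsStrictSupport vec (starComplex K v κ.support)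
        (Function.update ψ v (Finsupp.linearCombination ℝ ψ κ - ε)) t g := by
    intro t ht
    by_cases htn : t.card = n
    · rcases ht with ⟨ht, hκt⟩ | ⟨s, hs, hκs', hsκ, rfl⟩
      · obtain ⟨g, hg⟩ := hψ t ht htn
        filter_upwards [hK.isStrictSupport_of_not_subset hκ hκs hv hvK ht hκt hg] with ε hε _
          using ⟨g, hε⟩
      · rw [Finset.card_insert_of_notMem (hvK s hs)] at htn
        obtain ⟨r, hr, hrs, hT, hκT, hcard⟩ := hK.exists_insert_mem_of_card hκs' hsκ htn
        obtain ⟨g, hg⟩ := hψ _ hT hcard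
        filter_upwards [hK.exists_isStrictSupport_insert hκ hv hvK hr hrs hT hκT hg] with ε hε _
          using hε
    · exact Eventually.of_forall fun ε h => absurd h htn
  obtain ⟨ε, hε⟩ := ((eventually_all_finite (starComplex_finite hK.finite v _)).2 hsmall).exists
  exact ⟨_, hε⟩

theorem star (hK : IsRegularFan vec n K) (hκ : 0 ≤ κ) (hκ0 : κ ≠ 0) (hκs : κ.support ∈ K)
    (hv : Finsupp.linearCombination ℝ vec κ = vec v) :
    IsRegularFan vec n (starComplex K v κ.support) := by
  by_cases hvK : {v} ∈ K
  · rwa [hK.eq_single hvK hκ hκs hv, Finsupp.support_single _ one_ne_zero, hK.starComplex_singleton]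
  have hvK' : ∀ s ∈ K, v ∉ s := fun s hs h => hvK (hK.singleton_mem hs h)
  refine ⟨fun s hs t => hK.starComplex_down hs, starComplex_finite hK.finite v _, fun x => ?_,
    fun b b' hb hb' hbs hbs' heq => ?_, fun s => hK.starComplex_pure hvK',
    hK.starComplex_regular hκ hκs hv hvK'⟩
  · obtain ⟨a, ha, has, rfl⟩ := hK.exists_rep x
    exact ⟨starReduce v κ a, starReduce_nonneg hκ ha, hK.support_starReduce_mem hκ hκ0 ha has,
      linearCombination_starReduce hv a⟩
  · obtain ⟨a, ha, has, rfl⟩ := hK.exists_starReduce_eq hκ hb hbs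
    obtain ⟨a', ha', has', rfl⟩ := hK.exists_starReduce_eq hκ hb' hbs'
    rw [linearCombination_starReduce hv, linearCombination_starReduce hv] at heq
    rw [hK.unique a a' ha ha' has has' heq]

end IsRegularFan

end Fan

/-! ### Fans over the boundary of a polytope and their triangulations -/

section Cones

variable {Λ E : Type*} [AddCommGroup E] [Module ℝ E] {vec : Λ → E} {n : ℕ} {K : Set (Finset Λ)}
  {s t : Finset Λ}

/-- The fan whose cones are generated by the sets of rays in `K`. -/
def fanCones (vec : Λ → E) (K : Set (Finset Λ)) : Set (PointedCone ℝ E) :=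
  {σ | ∃ s ∈ K, σ = PointedCone.hull ℝ (vec '' s)}

theorem mem_hull_image {x : E} : x ∈ PointedCone.hull ℝ (vec '' s) ↔
    ∃ a : Λ →₀ ℝ, 0 ≤ a ∧ a.support ⊆ s ∧ Finsupp.linearCombination ℝ vec a = x := by
  classical
  constructor
  · intro h
    induction h using Submodule.span_induction with
    | mem x hx =>
      obtain ⟨v, hv, rfl⟩ := hx
      exact ⟨Finsupp.single v 1, Finsupp.single_nonneg.2 zero_le_one,
        Finsupp.support_single_subset.trans (Finset.singleton_subset_iff.2 hv), by simp⟩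
    | zero => exact ⟨0, le_rfl, by simp, by simp⟩
    | add x y _ _ hx hy =>
      obtain ⟨a, ha, has, rfl⟩ := hx
      obtain ⟨b, hb, hbs, rfl⟩ := hy
      exact ⟨a + b, add_nonneg ha hb, Finsupp.support_add.trans (Finset.union_subset has hbs),
        map_add _ a b⟩
    | smul c x _ hx =>
      obtain ⟨a, ha, has, rfl⟩ := hx
      exact ⟨(c : ℝ) • a, smul_nonneg c.2 ha, Finsupp.support_smul.trans has, map_smul _ (c : ℝ) a⟩
  · rintro ⟨a, ha, has, rfl⟩
    rw [Finsupp.linearCombination_apply]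
    exact Submodule.sum_mem _ fun v hv => Submodule.smul_mem _ (⟨a v, ha v⟩ : {c : ℝ // 0 ≤ c})
      (Submodule.subset_span ⟨v, has hv, rfl⟩)

theorem hull_image_insert [DecidableEq Λ] (vec : Λ → E) (v : Λ) (s : Finset Λ) :
    PointedCone.hull ℝ (vec '' (insert v s : Finset Λ)) =
      PointedCone.hull ℝ (vec '' s) ⊔ PointedCone.hull ℝ {vec v} := by
  rw [Finset.coe_insert, Set.image_insert_eq, sup_comm]
  exact Submodule.span_insert _ _

theorem IsRegularFan.mem_hull_iff (hK : IsRegularFan vec n K) (hs : s ∈ K) {a : Λ →₀ ℝ}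
    (ha : 0 ≤ a) (has : a.support ∈ K) :
    Finsupp.linearCombination ℝ vec a ∈ PointedCone.hull ℝ (vec '' s) ↔ a.support ⊆ s := by
  rw [mem_hull_image]
  refine ⟨?_, fun h => ⟨a, ha, h, rfl⟩⟩
  rintro ⟨b, hb, hbs, heq⟩
  rwa [← hK.unique b a hb ha (hK.down s hs _ hbs) has heq]

theorem IsRegularFan.hull_le_iff (hK : IsRegularFan vec n K) (hs : s ∈ K) (ht : t ∈ K) :
    PointedCone.hull ℝ (vec '' t) ≤ PointedCone.hull ℝ (vec '' s) ↔ t ⊆ s := by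
  refine ⟨fun h v hv => ?_, fun h => Submodule.span_mono (Set.image_mono (Finset.coe_subset.2 h))⟩
  have hvs : vec v ∈ PointedCone.hull ℝ (vec '' s) := h (Submodule.subset_span ⟨v, hv, rfl⟩)
  obtain ⟨a, ha, has, hav⟩ := mem_hull_image.1 hvs
  rw [hK.eq_single (hK.singleton_mem ht hv) ha (hK.down s hs _ has) hav] at has
  exact has (by simp)

end Cones

theorem IsRegularFan.starSubdivision_fanCones {Λ : Type*} [DecidableEq Λ] {n m : ℕ}
    {vec : Λ → Fin n → ℝ} {K : Set (Finset Λ)} (hK : IsRegularFan vec m K) {v : Λ} {κ : Λ →₀ ℝ}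
    (hκ : 0 ≤ κ) (hκs : κ.support ∈ K) (hv : Finsupp.linearCombination ℝ vec κ = vec v) :
    starSubdivision (fanCones vec K) (vec v) = fanCones vec (starComplex K v κ.support) := by
  have hmem : ∀ s ∈ K, (vec v ∈ PointedCone.hull ℝ (vec '' s) ↔ κ.support ⊆ s) :=
    fun s hs => by rw [← hv, hK.mem_hull_iff hs hκ hκs]
  ext σ
  constructor
  · rintro (⟨⟨s, hs, rfl⟩, h⟩ | ⟨τ, ⟨t, ht, rfl⟩, hvt, ⟨_, ⟨s, hs, rfl⟩, hvs, hts⟩, rfl⟩)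
    · exact ⟨s, Or.inl ⟨hs, fun h' => h ((hmem s hs).2 h')⟩, rfl⟩
    · have htκs := Finset.union_subset ((hK.hull_le_iff hs ht).1 hts) ((hmem s hs).1 hvs)
      exact ⟨insert v t, Or.inr ⟨t, ht, fun h => hvt ((hmem t ht).2 h), hK.down s hs _ htκs, rfl⟩,
        (hull_image_insert vec v t).symm⟩
  · rintro ⟨_, ⟨hs, hCs⟩ | ⟨s, hs, hCs, hsC, rfl⟩, rfl⟩
    · exact Or.inl ⟨⟨_, hs, rfl⟩, fun h => hCs ((hmem _ hs).1 h)⟩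
    · exact Or.inr ⟨_, ⟨s, hs, rfl⟩, fun h => hCs ((hmem s hs).1 h),
        ⟨_, ⟨_, hsC, rfl⟩, (hmem _ hsC).2 Finset.subset_union_right,
          (hK.hull_le_iff hsC hs).2 Finset.subset_union_left⟩, hull_image_insert vec v s⟩

section SimplexVertices

variable {Λ E : Type*} [Zero E] {vec : Λ → E} {K : Set (Finset Λ)} {s : Finset Λ}

/-- The vertices `vec v` for `v ∈ s`, together with the origin if `z` holds. -/
def simplexVertices (vec : Λ → E) (s : Finset Λ) (z : Prop) : Set E :=
  {y | z ∧ y = 0 ∨ y ∈ vec '' s}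

theorem simplexVertices_mono {t : Finset Λ} (hst : s ⊆ t) (z : Prop) :
    simplexVertices vec s z ⊆ simplexVertices vec t z :=
  fun _ => Or.imp_right (Set.image_mono (Finset.coe_subset.2 hst) ·)

theorem finite_simplexVertices (vec : Λ → E) (s : Finset Λ) (z : Prop) :
    (simplexVertices vec s z).Finite :=
  ((Set.finite_singleton (0 : E)).union (s.finite_toSet.image vec)).subset
    fun _ => Or.imp_left And.right

theorem exists_eq_simplexVertices (hdown : ∀ s ∈ K, ∀ t ⊆ s, t ∈ K) {σ : Finset E}
    (h : ∃ s ∈ K, (σ : Set E) ⊆ simplexVertices vec s True) :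
    ∃ s ∈ K, (σ : Set E) = simplexVertices vec s ((0 : E) ∈ σ) := by
  classical
  obtain ⟨s, hs, hsub⟩ := h
  refine ⟨{v ∈ s | vec v ∈ σ}, hdown s hs _ (Finset.filter_subset _ _), Set.ext fun y => ⟨?_, ?_⟩⟩
  · intro hy
    rcases hsub hy with ⟨-, rfl⟩ | ⟨v, hv, rfl⟩
    · exact Or.inl ⟨hy, rfl⟩
    · exact Or.inr ⟨v, Finset.mem_filter.2 ⟨hv, hy⟩, rfl⟩
  · rintro (⟨h, rfl⟩ | ⟨v, hv, rfl⟩)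
    · exact h
    · exact (Finset.mem_filter.1 hv).2

end SimplexVertices

section Boundary

variable {Λ E ι : Type*} [AddCommGroup E] [Module ℝ E] {vec : Λ → E} {n : ℕ} {K : Set (Finset Λ)}
  {ℓ : ι → E →ₗ[ℝ] ℝ} {a : Λ →₀ ℝ} {s : Finset Λ}

/-- A regular fan subdividing the fan of the cones over the faces of the polytope
`{x | ∀ i, ℓ i x ≤ 1}`, with ray generators on the boundary of the polytope: the generators of
each cone lie on a common facet. -/
structure IsBoundaryFan (ℓ : ι → E →ₗ[ℝ] ℝ) (vec : Λ → E) (n : ℕ) (K : Set (Finset Λ)) : Prop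
    extends IsRegularFan vec n K where
  facewise : ∀ s ∈ K, ∃ i, ∀ v ∈ s, ℓ i (vec v) = 1
  ray_le : ∀ v, {v} ∈ K → ∀ i, ℓ i (vec v) ≤ 1

/-- The sum of the coefficients. -/
noncomputable def coeffSum : (Λ →₀ ℝ) →ₗ[ℝ] ℝ := Finsupp.linearCombination ℝ fun _ => 1

theorem coeffSum_apply (a : Λ →₀ ℝ) : coeffSum a = ∑ v ∈ a.support, a v := by
  simp [coeffSum, Finsupp.linearCombination_apply, Finsupp.sum]

theorem linearCombination_mem_of_coeffSum_eq_one {C : Set E} (hC : Convex ℝ C) (ha : 0 ≤ a)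
    (h1 : coeffSum a = 1) (hmem : ∀ v ∈ a.support, vec v ∈ C) :
    Finsupp.linearCombination ℝ vec a ∈ C :=
  hC.sum_mem (fun v _ => ha v) (coeffSum_apply a ▸ h1) hmem

theorem linearCombination_mem_of_coeffSum_le_one {C : Set E} (hC : Convex ℝ C) (h0 : (0 : E) ∈ C)
    (ha : 0 ≤ a) (h1 : coeffSum a ≤ 1) (hmem : ∀ v ∈ a.support, vec v ∈ C) :
    Finsupp.linearCombination ℝ vec a ∈ C := by
  have hsum := hC.sum_mem (t := Finset.insertNone a.support)
    (w := fun o => o.elim (1 - coeffSum a) a) (z := fun o => o.elim 0 vec)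
    (Finset.forall_mem_insertNone.2 ⟨sub_nonneg.2 h1, fun v _ => ha v⟩) (by simp [coeffSum_apply])
    (Finset.forall_mem_insertNone.2 ⟨h0, hmem⟩)
  simpa [Finsupp.linearCombination_apply, Finsupp.sum] using hsum

namespace IsBoundaryFan

theorem le_one_iff (hK : IsBoundaryFan ℓ vec n K) (ha : 0 ≤ a) (has : a.support ∈ K) :
    (∀ i, ℓ i (Finsupp.linearCombination ℝ vec a) ≤ 1) ↔ coeffSum a ≤ 1 := by
  constructor
  · intro h
    obtain ⟨i, hi⟩ := hK.facewise _ has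
    refine le_trans (le_of_eq ?_) (h i)
    rw [map_linearCombination]
    exact linearCombination_congr fun v hv => (hi v hv).symm
  · intro h i
    rw [map_linearCombination]
    exact (linearCombination_le ha fun v hv => hK.ray_le v (hK.singleton_mem has hv) i).trans h

theorem vec_ne_zero (hK : IsBoundaryFan ℓ vec n K) (hs : s ∈ K) {v : Λ} (hv : v ∈ s) :
    vec v ≠ 0 := by
  obtain ⟨i, hi⟩ := hK.facewise s hs
  intro h
  simpa [h] using hi v hv

theorem star [DecidableEq Λ] (hK : IsBoundaryFan ℓ vec n K) {v : Λ} {κ : Λ →₀ ℝ} (hκ : 0 ≤ κ)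
    (hκs : κ.support ∈ K) (hv : Finsupp.linearCombination ℝ vec κ = vec v)
    (hle : ∀ i, ℓ i (vec v) ≤ 1) (heq : ∃ i, ℓ i (vec v) = 1) :
    IsBoundaryFan ℓ vec n (starComplex K v κ.support) where
  toIsRegularFan := by
    refine hK.toIsRegularFan.star hκ ?_ hκs hv
    rintro rfl
    obtain ⟨i, hi⟩ := heq
    simp [← hv] at hi
  facewise := by
    rintro s (⟨hs, -⟩ | ⟨s, -, -, hsC, rfl⟩)
    · exact hK.facewise s hs
    · obtain ⟨i, hi⟩ := hK.facewise _ hsC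
      refine ⟨i, fun w hw => ?_⟩
      rcases Finset.mem_insert.1 hw with rfl | hws
      · refine le_antisymm (hle i) ?_
        obtain ⟨j, hj⟩ := heq
        rw [← hj, ← hv, map_linearCombination, map_linearCombination]
        refine linearCombination_le hκ fun u hu => ?_
        rw [hi u (Finset.mem_union_right _ hu)]
        exact hK.ray_le u (hK.singleton_mem hκs hu) j
      · exact hi w (Finset.mem_union_left _ hws)
  ray_le w hw := by
    rcases singleton_mem_starComplex hw with h | rfl
    · exact hK.ray_le w h
    · exact hle

end IsBoundaryFan

theorem hull_simplexVertices {z : Prop} :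
    PointedCone.hull ℝ (simplexVertices vec s z) = PointedCone.hull ℝ (vec '' s) := by
  refine le_antisymm (Submodule.span_le.2 ?_) (Submodule.span_mono fun y hy => Or.inr hy)
  rintro y (⟨-, rfl⟩ | hy)
  · exact Submodule.zero_mem _
  · exact Submodule.subset_span hy

theorem convex_linearCombination (vec : Λ → E) (s : Finset Λ) (z : Prop) :
    Convex ℝ {x | ∃ a : Λ →₀ ℝ, 0 ≤ a ∧ a.support ⊆ s ∧ Finsupp.linearCombination ℝ vec a = x ∧
      coeffSum a ≤ 1 ∧ (z ∨ coeffSum a = 1)} := by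
  classical
  rintro x ⟨a, ha, has, rfl, ha1, haz⟩ y ⟨b, hb, hbs, rfl, hb1, hbz⟩ α β hα hβ hαβ
  have hsum : coeffSum (α • a + β • b) = α * coeffSum a + β * coeffSum b := by simp
  refine ⟨α • a + β • b, add_nonneg (smul_nonneg hα ha) (smul_nonneg hβ hb), ?_, by simp, ?_, ?_⟩
  · exact Finsupp.support_add.trans (Finset.union_subset (Finsupp.support_smul.trans has)
      (Finsupp.support_smul.trans hbs))
  · rw [hsum]
    nlinarith
  · refine or_iff_not_imp_left.2 fun hz => ?_
    rw [hsum, haz.resolve_left hz, hbz.resolve_left hz, mul_one, mul_one, hαβ]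

theorem mem_convexHull_simplexVertices {z : Prop} {x : E} :
    x ∈ convexHull ℝ (simplexVertices vec s z) ↔ ∃ a : Λ →₀ ℝ, 0 ≤ a ∧ a.support ⊆ s ∧
      Finsupp.linearCombination ℝ vec a = x ∧ coeffSum a ≤ 1 ∧ (z ∨ coeffSum a = 1) := by
  constructor
  · refine fun h => convexHull_min ?_ (convex_linearCombination vec s z) h
    rintro y (⟨hz, rfl⟩ | ⟨v, hv, rfl⟩)
    · exact ⟨0, le_rfl, by simp, by simp, by simp, Or.inl hz⟩
    · exact ⟨Finsupp.single v 1, Finsupp.single_nonneg.2 zero_le_one,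
        Finsupp.support_single_subset.trans (Finset.singleton_subset_iff.2 hv), by simp,
        by simp [coeffSum], Or.inr (by simp [coeffSum])⟩
  · rintro ⟨a, ha, has, rfl, ha1, haz⟩
    have hmem : ∀ v ∈ a.support, vec v ∈ convexHull ℝ (simplexVertices vec s z) := fun v hv =>
      subset_convexHull ℝ _ (Or.inr ⟨v, has hv, rfl⟩)
    rcases haz with hz | h1
    · exact linearCombination_mem_of_coeffSum_le_one (convex_convexHull ℝ _)
        (subset_convexHull ℝ _ (Or.inl ⟨hz, rfl⟩)) ha ha1 hmem
    · exact linearCombination_mem_of_coeffSum_eq_one (convex_convexHull ℝ _) ha h1 hmem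

end Boundary

section Triangulation

variable {Λ E ι : Type*} [AddCommGroup E] [Module ℝ E] {vec : Λ → E} {n : ℕ} {K : Set (Finset Λ)}
  {ℓ : ι → E →ₗ[ℝ] ℝ} {s t : Finset Λ}

namespace IsBoundaryFan

theorem affineIndependent (hK : IsBoundaryFan ℓ vec n K) (hs : s ∈ K) :
    AffineIndependent ℝ ((↑) : simplexVertices vec s True → E) := by
  have hindep : LinearIndepOn ℝ id (vec '' (s : Set Λ)) := (hK.linearIndepOn hs).id_image
  have hne : ∀ v ∈ vec '' (s : Set Λ), v ≠ 0 := by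
    rintro _ ⟨v, hv, rfl⟩
    exact hK.vec_ne_zero hs hv
  refine ((linearIndependent_set_iff_affineIndependent_vadd_union_singleton ℝ hne 0).1
    hindep).mono ?_
  rintro y (⟨-, rfl⟩ | h)
  · exact Or.inl rfl
  · exact Or.inr (by simpa using h)

theorem convexHull_inter_subset [DecidableEq Λ] (hK : IsBoundaryFan ℓ vec n K) (hs : s ∈ K)
    (ht : t ∈ K) (y z : Prop) :
    convexHull ℝ (simplexVertices vec s y) ∩ convexHull ℝ (simplexVertices vec t z) ⊆
      convexHull ℝ (simplexVertices vec (s ∩ t) (y ∧ z)) := by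
  rintro x ⟨hxs, hxt⟩
  rw [mem_convexHull_simplexVertices] at hxs hxt ⊢
  obtain ⟨a, ha, has, rfl, ha1, hay⟩ := hxs
  obtain ⟨b, hb, hbt, heq, -, hbz⟩ := hxt
  obtain rfl := hK.unique b a hb ha (hK.down t ht _ hbt) (hK.down s hs _ has) heq
  exact ⟨b, hb, Finset.subset_inter has hbt, rfl, ha1, by tauto⟩

theorem mem_convexHull_iff_support_subset (hK : IsBoundaryFan ℓ vec n K) (ht : t ∈ K)
    {a : Λ →₀ ℝ} (ha : 0 ≤ a) (haK : a.support ∈ K)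
    (ha1 : ∀ i, ℓ i (Finsupp.linearCombination ℝ vec a) ≤ 1) :
    Finsupp.linearCombination ℝ vec a ∈ convexHull ℝ (simplexVertices vec t True) ↔
      a.support ⊆ t := by
  rw [mem_convexHull_simplexVertices]
  refine ⟨?_, fun h => ⟨a, ha, h, rfl, (hK.le_one_iff ha haK).1 ha1, Or.inl trivial⟩⟩
  rintro ⟨b, hb, hbt, hba, -⟩
  rwa [← hK.unique b a hb ha (hK.down t ht _ hbt) haK hba]

/-- The triangulation of the polytope `{x | ∀ i, ℓ i x ≤ 1}` whose maximal simplices are spanned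
by the origin and the generators of a maximal cone. -/
def triangulation (hK : IsBoundaryFan ℓ vec n K) : Geometry.SimplicialComplex ℝ E where
  faces := {σ | σ.Nonempty ∧ ∃ s ∈ K, (σ : Set E) ⊆ simplexVertices vec s True}
  isRelLowerSet_faces := fun _ ⟨hσ, s, hs, hsub⟩ =>
    ⟨hσ, fun _ hτ hne => ⟨hne, s, hs, (Finset.coe_subset.2 hτ).trans hsub⟩⟩
  indep := fun ⟨_, _, hs, hsub⟩ => (hK.affineIndependent hs).mono hsub
  inter_subset_convexHull := by
    classical
    rintro σ τ ⟨-, hσ⟩ ⟨-, hτ⟩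
    obtain ⟨s, hs, hσs⟩ := exists_eq_simplexVertices hK.down hσ
    obtain ⟨t, ht, hτt⟩ := exists_eq_simplexVertices hK.down hτ
    have hinter := hK.convexHull_inter_subset hs ht ((0 : E) ∈ σ) ((0 : E) ∈ τ)
    rw [← hσs, ← hτt] at hinter
    refine hinter.trans (convexHull_mono (Set.subset_inter ?_ ?_))
    · rw [hσs]
      exact (simplexVertices_mono Finset.inter_subset_left _).trans
        fun _ => Or.imp_left (And.imp_left And.left)
    · rw [hτt]
      exact (simplexVertices_mono Finset.inter_subset_right _).trans
        fun _ => Or.imp_left (And.imp_left And.right)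

variable (hK : IsBoundaryFan ℓ vec n K)

theorem triangulation_finite : hK.triangulation.faces.Finite := by
  have hfin : (⋃ s ∈ K, simplexVertices vec s True).Finite :=
    hK.finite.biUnion fun s _ => finite_simplexVertices vec s True
  refine (hfin.finite_subsets.preimage Finset.coe_injective.injOn).subset ?_
  rintro σ ⟨-, s, hs, hsub⟩
  exact hsub.trans (Set.subset_biUnion_of_mem (u := fun s => simplexVertices vec s True) hs)

theorem exists_face (hs : s ∈ K) :
    ∃ σ ∈ hK.triangulation.faces, (σ : Set E) = simplexVertices vec s True := by
  have hfin := finite_simplexVertices vec s True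
  exact ⟨hfin.toFinset, ⟨⟨0, by simp [simplexVertices]⟩, s, hs, by simp⟩, by simp⟩

theorem triangulation_space : hK.triangulation.space = {x | ∀ i, ℓ i x ≤ 1} := by
  ext x
  rw [Geometry.SimplicialComplex.mem_space_iff, Set.mem_ofPred_eq]
  constructor
  · rintro ⟨σ, ⟨-, s, hs, hsub⟩, hx⟩
    obtain ⟨a, ha, has, rfl, ha1, -⟩ := mem_convexHull_simplexVertices.1 (convexHull_mono hsub hx)
    exact (hK.le_one_iff ha (hK.down s hs _ has)).2 ha1
  · intro hx
    obtain ⟨a, ha, has, rfl⟩ := hK.exists_rep x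
    obtain ⟨σ, hσ, hσs⟩ := hK.exists_face has
    refine ⟨σ, hσ, ?_⟩
    rw [hσs, mem_convexHull_simplexVertices]
    exact ⟨a, ha, le_rfl, rfl, (hK.le_one_iff ha has).1 hx, Or.inl trivial⟩

theorem eq_zero_or_exists_of_mem_vertices {y : E} (hy : y ∈ hK.triangulation.vertices) :
    y = 0 ∨ ∃ v, {v} ∈ K ∧ vec v = y := by
  obtain ⟨-, s, hs, hsub⟩ := hy
  rcases hsub (Finset.mem_coe.2 (Finset.mem_singleton_self y)) with ⟨-, rfl⟩ | ⟨v, hv, rfl⟩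
  · exact Or.inl rfl
  · exact Or.inr ⟨v, hK.singleton_mem hs hv, rfl⟩

theorem exists_of_mem_facets {σ : Finset E} (hσ : σ ∈ hK.triangulation.facets) :
    ∃ s ∈ K, s.card = n ∧ (σ : Set E) = simplexVertices vec s True := by
  obtain ⟨⟨-, s, hs, hsub⟩, hmax⟩ := hσ
  obtain ⟨t, ht, hst, htn⟩ := hK.pure s hs
  obtain ⟨τ, hτ, hτt⟩ := hK.exists_face ht
  refine ⟨t, ht, htn, ?_⟩
  rw [hmax hτ, hτt]
  rw [← Finset.coe_subset, hτt]
  exact hsub.trans (simplexVertices_mono hst True)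

theorem zero_mem_of_mem_facets {σ : Finset E} (hσ : σ ∈ hK.triangulation.facets) :
    (0 : E) ∈ σ := by
  obtain ⟨s, -, -, h⟩ := hK.exists_of_mem_facets hσ
  rw [← Finset.mem_coe, h]
  exact Or.inl ⟨trivial, rfl⟩

end IsBoundaryFan

end Triangulation

section LatticeTriangulation

variable {Λ ι : Type*} {n : ℕ} {vec : Λ → Fin n → ℝ} {K : Set (Finset Λ)}
  {ℓ : ι → (Fin n → ℝ) →ₗ[ℝ] ℝ} {t : Finset Λ}

theorem mem_range_compLeft_iff {x : Fin n → ℝ} :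
    x ∈ ((Int.castAddHom ℝ).compLeft (Fin n)).range ↔ IsLatticePoint x := by
  simp only [AddMonoidHom.mem_range, funext_iff, IsLatticePoint, eq_comm]
  rfl

theorem IsLatticePoint.sub {x y : Fin n → ℝ} (hx : IsLatticePoint x) (hy : IsLatticePoint y) :
    IsLatticePoint (x - y) := by
  rw [← mem_range_compLeft_iff] at *
  exact sub_mem hx hy

theorem isLatticePoint_linearCombination {a : Λ →₀ ℝ} (ha : ∀ v, ∃ z : ℤ, a v = z)
    (hlat : ∀ v ∈ a.support, IsLatticePoint (vec v)) :
    IsLatticePoint (Finsupp.linearCombination ℝ vec a) := by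
  rw [Finsupp.linearCombination_apply, ← mem_range_compLeft_iff]
  refine sum_mem fun v hv => ?_
  obtain ⟨z, hz⟩ := ha v
  simp only [hz, Int.cast_smul_eq_zsmul]
  exact zsmul_mem (mem_range_compLeft_iff.2 (hlat v hv)) z

/-- The point of the fundamental parallelepiped that is congruent to `linearCombination ℝ vec a`
is a lattice point, so its coefficients, the fractional parts of those of `a`, vanish. -/
theorem IsRegularFan.exists_int_eq (hK : IsRegularFan vec n K)
    (hlat : ∀ v, {v} ∈ K → IsLatticePoint (vec v))
    (hnat : ∀ y, IsLatticePoint y → ∃ a : Λ →₀ ℝ, 0 ≤ a ∧ a.support ∈ K ∧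
      Finsupp.linearCombination ℝ vec a = y ∧ IsNatural a)
    (ht : t ∈ K) {a : Λ →₀ ℝ} (hat : a.support ⊆ t)
    (hy : IsLatticePoint (Finsupp.linearCombination ℝ vec a)) (v : Λ) : ∃ z : ℤ, a v = z := by
  set b : Λ →₀ ℝ := a.mapRange (fun x => (⌊x⌋ : ℝ)) (by simp)
  set c : Λ →₀ ℝ := a.mapRange Int.fract (by simp)
  have hcb : c = a - b := Finsupp.ext fun v => by simp [b, c, Int.self_sub_floor]
  have hb : IsLatticePoint (Finsupp.linearCombination ℝ vec b) :=
    isLatticePoint_linearCombination (fun v => ⟨⌊a v⌋, by simp [b]⟩) fun v hv =>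
      hlat v (hK.singleton_mem ht (hat (Finsupp.support_mapRange hv)))
  obtain ⟨k, hk0, hkK, hky, hk⟩ := hnat _ (hy.sub hb)
  have hck : c = k := by
    refine hK.unique c k (fun v => by simp [c]) hk0
      (hK.down t ht _ (Finsupp.support_mapRange.trans hat)) hkK ?_
    rw [hky, hcb, map_sub]
  obtain ⟨m, hm⟩ := hk v
  rw [← hck, Finsupp.mapRange_apply] at hm
  have hm0 : m = 0 := by
    have hlt := Int.fract_lt_one (a v)
    rw [hm] at hlt
    exact Nat.lt_one_iff.1 (by exact_mod_cast hlt)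
  rw [hm0, Nat.cast_zero, Int.fract_eq_zero_iff] at hm
  obtain ⟨z, hz⟩ := hm
  exact ⟨z, hz.symm⟩

theorem IsRegularFan.exists_linearCombination_eq (hK : IsRegularFan vec n K) (ht : t ∈ K)
    (htn : t.card = n) (x : Fin n → ℝ) :
    ∃ a : Λ →₀ ℝ, a.support ⊆ t ∧ Finsupp.linearCombination ℝ vec a = x := by
  have hli : LinearIndependent ℝ fun v : (t : Set Λ) => vec v := hK.linearIndepOn ht
  have hx : x ∈ Submodule.span ℝ (vec '' t) := by
    rw [Set.image_eq_range, hli.span_eq_top_of_card_eq_finrank' (by simp [htn])]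
    exact Submodule.mem_top
  exact (Finsupp.mem_span_image_iff_linearCombination ℝ).1 hx

theorem abs_det_eq_one_of_mul_eq_one {m : Type*} [Fintype m] [DecidableEq m] {A B : Matrix m m ℤ}
    (h : B * A = 1) : |A.det| = 1 :=
  Int.isUnit_iff_abs_eq.1 ((Matrix.isUnit_iff_isUnit_det A).1 (.of_mul_eq_one_right B h))

theorem IsRegularFan.abs_det_eq_one (hK : IsRegularFan vec n K)
    (hlat : ∀ v, {v} ∈ K → IsLatticePoint (vec v))
    (hnat : ∀ y, IsLatticePoint y → ∃ a : Λ →₀ ℝ, 0 ≤ a ∧ a.support ∈ K ∧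
      Finsupp.linearCombination ℝ vec a = y ∧ IsNatural a)
    (ht : t ∈ K) (e : Fin n ≃ t) : |(Matrix.of fun i j => vec (e i) j).det| = 1 := by
  choose A hA using fun i => hlat (e i) (hK.singleton_mem ht (e i).2)
  choose a hat ha using fun j : Fin n => hK.exists_linearCombination_eq ht
    (by simpa using (Fintype.card_congr e).symm) (Pi.single j 1)
  have hbasis (j : Fin n) : IsLatticePoint (Pi.single j 1 : Fin n → ℝ) :=
    ⟨Pi.single j 1, fun i => by simp [Pi.single_apply]⟩
  choose B hB using fun j => hK.exists_int_eq hlat hnat ht (hat j) ((ha j).symm ▸ hbasis j)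
  have hBA : Matrix.of (fun j i => B j (e i)) * Matrix.of A = 1 := by
    ext j k
    have hsum := congrFun (ha j) k
    rw [Finsupp.linearCombination_apply, Finsupp.sum_of_support_subset _ (hat j) _ (by simp),
      ← Finset.sum_coe_sort, ← e.sum_comp, Finset.sum_apply] at hsum
    simp only [Pi.smul_apply, smul_eq_mul, hB, hA, Pi.single_apply] at hsum
    rw [Matrix.mul_apply, Matrix.one_apply]
    simp only [eq_comm (a := j)]
    exact_mod_cast hsum
  have hAvec : (Matrix.of fun i j => vec (e i) j) = (Int.castRingHom ℝ).mapMatrix (Matrix.of A) :=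
    Matrix.ext hA
  rw [hAvec, ← RingHom.map_det, Int.coe_castRingHom, ← Int.cast_abs,
    abs_det_eq_one_of_mul_eq_one hBA, Int.cast_one]

namespace IsBoundaryFan

variable (hK : IsBoundaryFan ℓ vec n K)

theorem isLatticeTriangulation (hlat : ∀ v, {v} ∈ K → IsLatticePoint (vec v)) :
    IsLatticeTriangulation hK.triangulation {x | ∀ i, ℓ i x ≤ 1} := by
  refine ⟨hK.triangulation_finite, hK.triangulation_space, fun y hy => ?_⟩
  obtain rfl | ⟨v, hv, rfl⟩ := hK.eq_zero_or_exists_of_mem_vertices hy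
  · exact ⟨0, by simp⟩
  · exact hlat v hv

theorem triangulationFan_eq : triangulationFan hK.triangulation = fanCones vec K := by
  ext C
  constructor
  · rintro ⟨σ, ⟨-, hσ⟩, rfl⟩
    obtain ⟨s, hs, h⟩ := exists_eq_simplexVertices hK.down hσ
    exact ⟨s, hs, by rw [h, hull_simplexVertices]⟩
  · rintro ⟨s, hs, rfl⟩
    obtain ⟨σ, hσ, h⟩ := hK.exists_face hs
    exact ⟨σ, hσ, by rw [h, hull_simplexVertices]⟩

theorem isCoherent : IsCoherent hK.triangulation {x | ∀ i, ℓ i x ≤ 1} := by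
  obtain ⟨ψ, hψ⟩ := hK.regular
  choose rep hrep0 hrepK hrep using hK.exists_rep
  have hray (x : Fin n → ℝ) : ∀ v ∈ (rep x).support, {v} ∈ K := fun _ => hK.singleton_mem (hrepK x)
  refine ⟨fun x => Finsupp.linearCombination ℝ ψ (rep x), ⟨?_, fun x _ y _ α β hα hβ _ => ?_⟩,
    fun σ hσ => ?_⟩
  · rw [Set.ofPred_forall]
    exact convex_iInter fun i => convex_halfSpace_le (ℓ i).isLinear 1
  · obtain ⟨t, ht, hsub, htn⟩ := hK.pure _ (hrepK (α • x + β • y))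
    obtain ⟨g, hg⟩ := hψ t ht htn
    have hle (x : Fin n → ℝ) : g x ≤ Finsupp.linearCombination ℝ ψ (rep x) := by
      simpa only [hrep] using hg.map_linearCombination_le (hrep0 x) (hray x)
    beta_reduce
    rw [← hg.map_linearCombination_eq hsub, hrep, map_add, map_smul, map_smul]
    exact add_le_add (smul_le_smul_of_nonneg_left (hle x) hα)
      (smul_le_smul_of_nonneg_left (hle y) hβ)
  · obtain ⟨t, ht, htn, hσt⟩ := hK.exists_of_mem_facets hσ
    obtain ⟨g, hg⟩ := hψ t ht htn
    have hmem {x : Fin n → ℝ} (hx : ∀ i, ℓ i x ≤ 1) :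
        x ∈ convexHull ℝ (σ : Set (Fin n → ℝ)) ↔ (rep x).support ⊆ t := by
      have hiff := hK.mem_convexHull_iff_support_subset ht (hrep0 x) (hrepK x)
      rw [hrep, ← hσt] at hiff
      exact hiff hx
    refine ⟨g.toAffineMap, fun x hx => ?_, fun x hxP hx => ?_⟩
    · have hxP : x ∈ hK.triangulation.space :=
        hK.triangulation.convexHull_subset_space hσ.1 hx
      rw [triangulation_space] at hxP
      beta_reduce
      rw [← hg.map_linearCombination_eq ((hmem hxP).1 hx), hrep, LinearMap.coe_toAffineMap]
    · simpa only [hrep, LinearMap.coe_toAffineMap] using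
        hg.map_linearCombination_lt (hrep0 x) (hray x) ((hmem hxP).not.1 hx)

theorem isUnimodular (hlat : ∀ v, {v} ∈ K → IsLatticePoint (vec v))
    (hnat : ∀ y, IsLatticePoint y → ∃ a : Λ →₀ ℝ, 0 ≤ a ∧ a.support ∈ K ∧
      Finsupp.linearCombination ℝ vec a = y ∧ IsNatural a) :
    IsUnimodular hK.triangulation := by
  intro σ hσ
  obtain ⟨t, ht, htn, hσt⟩ := hK.exists_of_mem_facets hσ
  let e : Fin n ≃ t := (t.equivFinOfCardEq htn).symm
  refine ⟨Fin.cons 0 fun i => vec (e i), ?_, ?_⟩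
  · rw [hσt, Fin.range_cons]
    ext y
    constructor
    · rintro (rfl | ⟨i, rfl⟩)
      · exact Or.inl ⟨trivial, rfl⟩
      · exact Or.inr ⟨e i, (e i).2, rfl⟩
    · rintro (⟨-, rfl⟩ | ⟨v, hv, rfl⟩)
      · exact Or.inl rfl
      · exact Or.inr ⟨e.symm ⟨v, hv⟩, by simp⟩
  · rw [← hK.abs_det_eq_one hlat hnat ht e, normalizedVolume]
    simp

end IsBoundaryFan

end LatticeTriangulation

section Fold

variable {Λ ι : Type*} {n : ℕ} {vec : Λ → Fin n → ℝ} {K : Set (Finset Λ)}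
  {ℓ : ι → (Fin n → ℝ) →ₗ[ℝ] ℝ} {κ : Λ → Λ →₀ ℝ} {U : Set Λ}

theorem IsBoundaryFan.exists_foldl (hK : IsBoundaryFan ℓ vec n K)
    (hlat : ∀ v, {v} ∈ K → IsLatticePoint (vec v)) (hκ : Represents vec κ)
    (hU : ∀ u ∈ U, (κ u).support ∈ K) {L : List Λ} (hLU : ∀ v ∈ L, v ∈ U)
    (hLlat : ∀ v ∈ L, IsLatticePoint (vec v)) (hle : ∀ v ∈ L, ∀ i, ℓ i (vec v) ≤ 1)
    (heq : ∀ v ∈ L, ∃ i, ℓ i (vec v) = 1) :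
    ∃ K', IsBoundaryFan ℓ vec n K' ∧ (∀ v, {v} ∈ K' → IsLatticePoint (vec v)) ∧
      (∀ u ∈ U, (L.foldl subdivide κ u).support ∈ K') ∧
      fanCones vec K' = (L.map vec).foldl starSubdivision (fanCones vec K) := by
  classical
  induction L generalizing K κ with
  | nil => exact ⟨K, hK, hlat, hU, rfl⟩
  | cons v L ih =>
    rw [List.forall_mem_cons] at hLU hLlat hle heq
    have hv := hU v hLU.1
    have hκ0 : κ v ≠ 0 := by
      intro h0
      obtain ⟨i, hi⟩ := heq.1
      simp [← (hκ v).2, h0] at hi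
    obtain ⟨K', hK', hlat', hU', hfan⟩ := ih (hK.star (hκ v).1 hv (hκ v).2 hle.1 heq.1)
      (fun w hw => (singleton_mem_starComplex hw).elim (hlat w) fun h => h ▸ hLlat.1)
      (hκ.subdivide v) (fun u hu => hK.support_starReduce_mem (hκ v).1 hκ0 (hκ u).1 (hU u hu))
      hLU.2 hLlat.2 hle.2 heq.2
    refine ⟨K', hK', hlat', hU', ?_⟩
    rw [hfan, List.map_cons, List.foldl_cons, hK.starSubdivision_fanCones (hκ v).1 hv (hκ v).2]

end Fold

/-! ### The polytope of projective space -/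

section Polytope

variable {n : ℕ}

/-- The linear functionals `-y₁, …, -yₙ, y₁ + ⋯ + yₙ`, which cut out the polytope by the
inequalities `facetFunctional n i y ≤ 1`. -/
noncomputable def facetFunctional (n : ℕ) (i : Fin (n + 1)) : (Fin n → ℝ) →ₗ[ℝ] ℝ :=
  Fin.lastCases (motive := fun _ => (Fin n → ℝ) →ₗ[ℝ] ℝ) (∑ j, LinearMap.proj j)
    (fun j => -LinearMap.proj j) i

@[simp] theorem facetFunctional_castSucc (j : Fin n) (y : Fin n → ℝ) :
    facetFunctional n j.castSucc y = -y j := by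
  simp [facetFunctional]

@[simp] theorem facetFunctional_last (y : Fin n → ℝ) :
    facetFunctional n (Fin.last n) y = ∑ j, y j := by
  simp [facetFunctional]

theorem sum_facetFunctional (y : Fin n → ℝ) : ∑ i, facetFunctional n i y = 0 := by
  simp [Fin.sum_univ_castSucc]

theorem ext_facetFunctional {y z : Fin n → ℝ}
    (h : ∀ i, facetFunctional n i y = facetFunctional n i z) : y = z := by
  ext j
  simpa using h j.castSucc

theorem continuous_facetFunctional (i : Fin (n + 1)) : Continuous (facetFunctional n i) :=
  (facetFunctional n i).continuous_of_finiteDimensional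

/-- The projection of `ℝⁿ⁺¹` along `(1, …, 1)` to `ℝⁿ`, realized as the hyperplane of the vectors
with coordinate sum `0`. It maps the simplex of coordinate sum `n + 1` onto the polytope. -/
noncomputable def ofHomogeneous (n : ℕ) : (Fin (n + 1) → ℝ) →ₗ[ℝ] (Fin n → ℝ) :=
  LinearMap.pi fun j => LinearMap.proj j.castSucc - ((n : ℝ) + 1)⁻¹ • ∑ i, LinearMap.proj i

theorem ofHomogeneous_apply (x : Fin (n + 1) → ℝ) (j : Fin n) :
    ofHomogeneous n x j = x j.castSucc - (∑ i, x i) / (n + 1) := by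
  simp [ofHomogeneous, div_eq_inv_mul]

theorem facetFunctional_ofHomogeneous (x : Fin (n + 1) → ℝ) (i : Fin (n + 1)) :
    facetFunctional n i (ofHomogeneous n x) = (∑ k, x k) / (n + 1) - x i := by
  have hn : (n + 1 : ℝ) ≠ 0 := by positivity
  induction i using Fin.lastCases with
  | last =>
    simp only [facetFunctional_last, ofHomogeneous_apply, Finset.sum_sub_distrib,
      Fin.sum_univ_castSucc x, Finset.sum_const, Finset.card_univ, Fintype.card_fin,
      nsmul_eq_mul]
    field_simp
    ring
  | cast j => simp [ofHomogeneous_apply]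

theorem ofHomogeneous_sub_facetFunctional (c : ℝ) (y : Fin n → ℝ) :
    ofHomogeneous n (fun i => c - facetFunctional n i y) = y := by
  refine ext_facetFunctional fun k => ?_
  have hn : (n + 1 : ℝ) ≠ 0 := by positivity
  simp [facetFunctional_ofHomogeneous, sum_facetFunctional, hn]

/-- The lattice point `u` of the cone `ℝⁿ⁺¹≥0` as a vector in `ℝⁿ`. If its coordinate sum is
`n + 1`, it is a lattice point of the polytope. -/
noncomputable def labelVec (n : ℕ) (u : Fin (n + 1) → ℕ) : Fin n → ℝ :=
  ofHomogeneous n (realLabel u)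

theorem labelVec_apply {u : Fin (n + 1) → ℕ} (hu : ∑ i, u i = n + 1) (j : Fin n) :
    labelVec n u j = u j.castSucc - 1 := by
  have hn : (n + 1 : ℝ) ≠ 0 := by positivity
  simp [labelVec, ofHomogeneous_apply, realLabel, ← Nat.cast_sum, hu, hn]

theorem isLatticePoint_labelVec {u : Fin (n + 1) → ℕ} (hu : ∑ i, u i = n + 1) :
    IsLatticePoint (labelVec n u) :=
  ⟨fun j => u j.castSucc - 1, fun j => by simp [labelVec_apply hu]⟩

theorem facetFunctional_labelVec {u : Fin (n + 1) → ℕ} (hu : ∑ i, u i = n + 1)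
    (i : Fin (n + 1)) : facetFunctional n i (labelVec n u) = 1 - u i := by
  have hn : (n + 1 : ℝ) ≠ 0 := by positivity
  simp [labelVec, facetFunctional_ofHomogeneous, realLabel, ← Nat.cast_sum, hu, hn]

theorem facetFunctional_labelVec_le {u : Fin (n + 1) → ℕ} (hu : ∑ i, u i = n + 1)
    (i : Fin (n + 1)) : facetFunctional n i (labelVec n u) ≤ 1 := by
  simp [facetFunctional_labelVec hu]

theorem facetFunctional_labelVec_eq_one_iff {u : Fin (n + 1) → ℕ} (hu : ∑ i, u i = n + 1)
    {i : Fin (n + 1)} : facetFunctional n i (labelVec n u) = 1 ↔ i ∉ labelSupport u := by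
  simp [facetFunctional_labelVec hu]

theorem injOn_labelVec : Set.InjOn (labelVec n) {u | ∑ i, u i = n + 1} := by
  intro u hu v hv h
  ext i
  have hi := facetFunctional_labelVec hu i
  rw [h, facetFunctional_labelVec hv i, sub_right_inj] at hi
  exact_mod_cast hi.symm

/-- The vertices of the polytope. -/
noncomputable def polytopeVertex (n : ℕ) (i : Fin (n + 1)) : Fin n → ℝ :=
  labelVec n (Pi.single i (n + 1))

theorem isLatticePoint_polytopeVertex (i : Fin (n + 1)) : IsLatticePoint (polytopeVertex n i) :=
  isLatticePoint_labelVec (by simp)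

theorem facetFunctional_polytopeVertex (i k : Fin (n + 1)) :
    facetFunctional n k (polytopeVertex n i) = 1 - if k = i then (n + 1 : ℝ) else 0 := by
  rw [polytopeVertex, facetFunctional_labelVec (by simp), Pi.single_apply]
  push_cast
  rfl

theorem facetFunctional_polytopeVertex_le (i k : Fin (n + 1)) :
    facetFunctional n k (polytopeVertex n i) ≤ 1 :=
  facetFunctional_labelVec_le (by simp) k

theorem ofHomogeneous_eq_sum (x : Fin (n + 1) → ℝ) :
    ofHomogeneous n x = ∑ i, (x i / (n + 1)) • polytopeVertex n i := by
  have hn : (n + 1 : ℝ) ≠ 0 := by positivity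
  have hx : x = ∑ i, (x i / (n + 1)) • realLabel (Pi.single i (n + 1)) := by
    ext j
    simp [realLabel, Finset.sum_apply, Pi.single_apply, hn]
  conv_lhs => rw [hx]
  simp only [map_sum, map_smul, polytopeVertex, labelVec]

/-- The barycentric coordinates with respect to the vertices of the polytope. -/
noncomputable def baryCoord (y : Fin n → ℝ) (i : Fin (n + 1)) : ℝ :=
  (1 - facetFunctional n i y) / (n + 1)

theorem sum_baryCoord (y : Fin n → ℝ) : ∑ i, baryCoord y i = 1 := by
  have hn : (n + 1 : ℝ) ≠ 0 := by positivity
  simp only [baryCoord]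
  rw [← Finset.sum_div, Finset.sum_sub_distrib, sum_facetFunctional]
  simp [hn]

theorem sum_baryCoord_smul_polytopeVertex (y : Fin n → ℝ) :
    ∑ i, baryCoord y i • polytopeVertex n i = y :=
  (ofHomogeneous_eq_sum _).symm.trans (ofHomogeneous_sub_facetFunctional 1 y)

theorem baryCoord_nonneg_iff {y : Fin n → ℝ} {i : Fin (n + 1)} :
    0 ≤ baryCoord y i ↔ facetFunctional n i y ≤ 1 := by
  rw [baryCoord, le_div_iff₀ (by positivity), zero_mul, sub_nonneg]

theorem baryCoord_eq_zero_iff {y : Fin n → ℝ} {i : Fin (n + 1)} :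
    baryCoord y i = 0 ↔ facetFunctional n i y = 1 := by
  have hn : (n + 1 : ℝ) ≠ 0 := by positivity
  rw [baryCoord, div_eq_zero_iff, or_iff_left hn, sub_eq_zero, eq_comm]

theorem projectiveSpacePolytope_eq_convexHull :
    projectiveSpacePolytope n = convexHull ℝ (Set.range (polytopeVertex n)) := by
  have hlast : polytopeVertex n (Fin.last n) = fun _ => -1 := by
    ext j
    simp [polytopeVertex, labelVec_apply, (Fin.castSucc_lt_last j).ne]
  have hcast (i : Fin n) :
      polytopeVertex n i.castSucc = fun j => if j = i then (n : ℝ) else -1 := by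
    ext j
    by_cases h : j = i <;> simp [polytopeVertex, labelVec_apply, h]
  rw [projectiveSpacePolytope]
  congr 1
  ext y
  simp only [Set.mem_insert_iff, Set.mem_range, Fin.exists_fin_succ', hlast, hcast]
  rw [or_comm, eq_comm (a := y)]

theorem convex_setOf_facetFunctional_le : Convex ℝ {y | ∀ i, facetFunctional n i y ≤ 1} := by
  rw [Set.ofPred_forall]
  exact convex_iInter fun i => convex_halfSpace_le (facetFunctional n i).isLinear 1

theorem projectiveSpacePolytope_eq :
    projectiveSpacePolytope n = {y | ∀ i, facetFunctional n i y ≤ 1} := by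
  rw [projectiveSpacePolytope_eq_convexHull]
  refine (convexHull_min ?_ convex_setOf_facetFunctional_le).antisymm fun y hy => ?_
  · rintro _ ⟨i, rfl⟩
    exact facetFunctional_polytopeVertex_le i
  · rw [← sum_baryCoord_smul_polytopeVertex y]
    exact (convex_convexHull ℝ _).sum_mem (fun i _ => baryCoord_nonneg_iff.2 (hy i))
      (sum_baryCoord y) fun i _ => subset_convexHull ℝ _ ⟨i, rfl⟩

theorem mem_projectiveSpacePolytope {y : Fin n → ℝ} :
    y ∈ projectiveSpacePolytope n ↔ ∀ i, facetFunctional n i y ≤ 1 := by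
  rw [projectiveSpacePolytope_eq, Set.mem_ofPred_eq]

theorem polytopeVertex_mem_projectiveSpacePolytope (i : Fin (n + 1)) :
    polytopeVertex n i ∈ projectiveSpacePolytope n :=
  mem_projectiveSpacePolytope.2 (facetFunctional_polytopeVertex_le i)

theorem interior_projectiveSpacePolytope :
    interior (projectiveSpacePolytope n) = {y | ∀ i, facetFunctional n i y < 1} := by
  refine Set.Subset.antisymm (fun y hy i => ?_) (interior_maximal ?_ ?_)
  · have hlim : Filter.Tendsto (fun t : ℝ => t • y) (nhdsWithin 1 (Set.Ioi 1)) (nhds y) := by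
      simpa using (Filter.tendsto_id.smul_const y).mono_left (nhdsWithin_le_nhds (a := (1 : ℝ)))
    have hmem := hlim.eventually (mem_interior_iff_mem_nhds.1 hy)
    obtain ⟨t, ht, ht1 : 1 < t⟩ := (hmem.and self_mem_nhdsWithin).exists
    have hti := mem_projectiveSpacePolytope.1 ht i
    rw [map_smul, smul_eq_mul] at hti
    nlinarith
  · exact fun y hy => mem_projectiveSpacePolytope.2 fun i => (hy i).le
  · rw [Set.ofPred_forall]
    exact isOpen_iInter_of_finite fun i => isOpen_lt (continuous_facetFunctional i) continuous_const

theorem mem_frontier_projectiveSpacePolytope {y : Fin n → ℝ} :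
    y ∈ frontier (projectiveSpacePolytope n) ↔
      (∀ i, facetFunctional n i y ≤ 1) ∧ ∃ i, facetFunctional n i y = 1 := by
  have hclosed : IsClosed (projectiveSpacePolytope n) := by
    rw [projectiveSpacePolytope_eq, Set.ofPred_forall]
    exact isClosed_iInter fun i => isClosed_le (continuous_facetFunctional i) continuous_const
  rw [hclosed.frontier_eq, interior_projectiveSpacePolytope, Set.mem_sdiff,
    mem_projectiveSpacePolytope, Set.mem_ofPred_eq, not_forall]
  exact and_congr_right fun h => exists_congr fun i => by rw [not_lt, (h i).ge_iff_eq]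

end Polytope

section Polar

variable {n : ℕ}

/-- The vertices of the polar dual of the polytope. -/
def polarVertex (n : ℕ) (i : Fin (n + 1)) : Fin n → ℝ :=
  Fin.lastCases (motive := fun _ => Fin n → ℝ) (fun _ => -1) (fun j => Pi.single j 1) i

theorem dotProduct_polarVertex (x : Fin n → ℝ) (i : Fin (n + 1)) :
    x ⬝ᵥ polarVertex n i = -facetFunctional n i x := by
  induction i using Fin.lastCases with
  | last => simp [polarVertex, dotProduct]
  | cast j => simp [polarVertex]

theorem isLatticePoint_polarVertex (i : Fin (n + 1)) : IsLatticePoint (polarVertex n i) := by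
  induction i using Fin.lastCases with
  | last => exact ⟨fun _ => -1, fun j => by simp [polarVertex]⟩
  | cast i => exact ⟨Pi.single i 1, fun j => by by_cases h : j = i <;> simp [polarVertex, h]⟩

theorem convex_polarDual (P : Set (Fin n → ℝ)) : Convex ℝ (polarDual P) := by
  have h : polarDual P = ⋂ x ∈ P, {y | -1 ≤ dotProductBilin ℝ ℝ x y} := by
    ext y
    simp [polarDual, dotProduct]
  rw [h]
  exact convex_iInter₂ fun x _ => convex_halfSpace_ge (dotProductBilin ℝ ℝ x).isLinear (-1)

theorem sum_polytopeVertex : ∑ i, polytopeVertex n i = 0 := by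
  have hn : (n + 1 : ℝ) ≠ 0 := by positivity
  have h := ofHomogeneous_sub_facetFunctional (n + 1) (0 : Fin n → ℝ)
  simpa [ofHomogeneous_eq_sum, hn] using h

theorem sum_smul_polarVertex (y : Fin n → ℝ) :
    ∑ i, ((1 + polytopeVertex n i ⬝ᵥ y) / (n + 1)) • polarVertex n i = y := by
  refine dotProduct_eq _ _ fun x => ?_
  have hx : ∑ i, (-facetFunctional n i x / (n + 1)) • polytopeVertex n i = x := by
    rw [← ofHomogeneous_eq_sum fun i => -facetFunctional n i x]
    simpa using ofHomogeneous_sub_facetFunctional 0 x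
  calc _ = ∑ i, (-facetFunctional n i x) / (n + 1)
        + ∑ i, (-facetFunctional n i x / (n + 1)) * (polytopeVertex n i ⬝ᵥ y) := by
        rw [sum_dotProduct, ← Finset.sum_add_distrib]
        refine Finset.sum_congr rfl fun i _ => ?_
        rw [smul_dotProduct, dotProduct_comm _ x, dotProduct_polarVertex, smul_eq_mul]
        ring
    _ = x ⬝ᵥ y := by
        conv_rhs => rw [← hx, sum_dotProduct]
        simp [← Finset.sum_div, sum_facetFunctional, smul_dotProduct]
    _ = y ⬝ᵥ x := dotProduct_comm x y

theorem polarDual_projectiveSpacePolytope :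
    polarDual (projectiveSpacePolytope n) = convexHull ℝ (Set.range (polarVertex n)) := by
  refine Set.Subset.antisymm (fun y hy => ?_) (convexHull_min ?_ (convex_polarDual _))
  · rw [← sum_smul_polarVertex y]
    refine (convex_convexHull ℝ _).sum_mem (fun i _ => div_nonneg ?_ (by positivity)) ?_
      fun i _ => subset_convexHull ℝ _ ⟨i, rfl⟩
    · exact neg_le_iff_add_nonneg'.1 (hy _ (polytopeVertex_mem_projectiveSpacePolytope i))
    · have hn : (n + 1 : ℝ) ≠ 0 := by positivity
      rw [← Finset.sum_div, Finset.sum_add_distrib, ← sum_dotProduct, sum_polytopeVertex]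
      simp [hn]
  · rintro _ ⟨i, rfl⟩ x hx
    have hxi := dotProduct_polarVertex x i
    rw [dotProduct] at hxi
    linarith [mem_projectiveSpacePolytope.1 hx i]

theorem isReflexive_projectiveSpacePolytope : IsReflexive (projectiveSpacePolytope n) := by
  refine ⟨⟨_, Set.finite_range _, ?_, projectiveSpacePolytope_eq_convexHull⟩, ?_,
    _, Set.finite_range _, ?_, polarDual_projectiveSpacePolytope⟩
  · rintro _ ⟨i, rfl⟩
    exact isLatticePoint_polytopeVertex i
  · simp [interior_projectiveSpacePolytope]
  · rintro _ ⟨i, rfl⟩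
    exact isLatticePoint_polarVertex i

end Polar

section Faces

variable {n : ℕ} {S R : Finset (Fin (n + 1))} {y : Fin n → ℝ}

/-- The face of the polytope with vertices `polytopeVertex n i` for `i ∈ S`. -/
def polytopeFace (S : Finset (Fin (n + 1))) : Set (Fin n → ℝ) :=
  {y ∈ projectiveSpacePolytope n | ∀ i ∉ S, facetFunctional n i y = 1}

theorem mem_polytopeFace_iff : y ∈ polytopeFace S ↔
    y ∈ projectiveSpacePolytope n ∧ ∀ i, baryCoord y i ≠ 0 → i ∈ S := by
  simp only [polytopeFace, Set.mem_ofPred_eq, ← baryCoord_eq_zero_iff]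
  exact and_congr_right fun _ => forall_congr' fun i => not_imp_comm

theorem polytopeFace_mono (h : S ⊆ R) : polytopeFace S ⊆ polytopeFace R :=
  fun _ hy => ⟨hy.1, fun i hi => hy.2 i fun hiS => hi (h hiS)⟩

theorem polytopeVertex_mem_polytopeFace_iff {i : Fin (n + 1)} :
    polytopeVertex n i ∈ polytopeFace S ↔ i ∈ S := by
  have hn : (n + 1 : ℝ) ≠ 0 := by positivity
  simp only [polytopeFace, Set.mem_ofPred_eq, polytopeVertex_mem_projectiveSpacePolytope, true_and,
    facetFunctional_polytopeVertex, sub_eq_self, ite_eq_right_iff, hn, imp_false]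
  exact ⟨fun h => by_contra fun hi => h i hi rfl, fun hi k hk hki => hk (hki ▸ hi)⟩

theorem polytopeFace_eq_projectiveSpacePolytope_iff :
    polytopeFace S = projectiveSpacePolytope n ↔ S = Finset.univ := by
  refine ⟨fun h => Finset.eq_univ_iff_forall.2 fun i => ?_, ?_⟩
  · rw [← polytopeVertex_mem_polytopeFace_iff, h]
    exact polytopeVertex_mem_projectiveSpacePolytope i
  · rintro rfl
    simp [polytopeFace]

theorem convex_polytopeFace (S : Finset (Fin (n + 1))) : Convex ℝ (polytopeFace S) := by
  have h : polytopeFace S =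
      projectiveSpacePolytope n ∩ ⋂ i ∉ S, {y | facetFunctional n i y = 1} := by
    ext y
    simp [polytopeFace]
  rw [h, projectiveSpacePolytope_eq]
  exact convex_setOf_facetFunctional_le.inter
    (convex_iInter₂ fun i _ => convex_hyperplane (facetFunctional n i).isLinear 1)

theorem polytopeFace_eq_convexHull (S : Finset (Fin (n + 1))) :
    polytopeFace S = convexHull ℝ (polytopeVertex n '' S) := by
  refine Set.Subset.antisymm (fun y hy => ?_) (convexHull_min ?_ (convex_polytopeFace S))
  · obtain ⟨hyP, hyS⟩ := mem_polytopeFace_iff.1 hy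
    have hzero : ∀ i ∉ S, baryCoord y i = 0 := fun i hi => by_contra fun h => hi (hyS i h)
    rw [← sum_baryCoord_smul_polytopeVertex y, ← Finset.sum_subset S.subset_univ fun i _ hi => by
      rw [hzero i hi, zero_smul]]
    refine (convex_convexHull ℝ _).sum_mem
      (fun i _ => baryCoord_nonneg_iff.2 (mem_projectiveSpacePolytope.1 hyP i)) ?_
      fun i hi => subset_convexHull ℝ _ ⟨i, hi, rfl⟩
    rw [Finset.sum_subset S.subset_univ fun i _ hi => hzero i hi, sum_baryCoord]
  · rintro _ ⟨i, hi, rfl⟩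
    exact polytopeVertex_mem_polytopeFace_iff.2 hi

theorem isExposed_polytopeFace (S : Finset (Fin (n + 1))) :
    IsExposed ℝ (projectiveSpacePolytope n) (polytopeFace S) := by
  rintro ⟨z, hz⟩
  have hle {y : Fin n → ℝ} (hy : y ∈ projectiveSpacePolytope n) (i : Fin (n + 1)) :
      facetFunctional n i y ≤ 1 := mem_projectiveSpacePolytope.1 hy i
  refine ⟨LinearMap.toContinuousLinearMap (∑ i ∈ Sᶜ, facetFunctional n i), ?_⟩
  ext y
  simp only [Set.mem_ofPred_eq, LinearMap.coe_toContinuousLinearMap', LinearMap.sum_apply]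
  refine and_congr_right fun hyP => ⟨fun hy w hw => ?_, fun hy i hi => ?_⟩
  · exact Finset.sum_le_sum fun i hi => (hle hw i).trans (hy i (Finset.mem_compl.1 hi)).ge
  · have hzy := hy z hz.1
    rw [Finset.sum_congr rfl fun i hi => hz.2 i (Finset.mem_compl.1 hi)] at hzy
    exact (Finset.sum_eq_sum_iff_of_le fun i _ => hle hyP i).1
      (le_antisymm (Finset.sum_le_sum fun i _ => hle hyP i) hzy) i (Finset.mem_compl.2 hi)

theorem polytopeVertex_mem_of_isExposed {F : Set (Fin n → ℝ)}
    (hF : IsExposed ℝ (projectiveSpacePolytope n) F) (hy : y ∈ F) {i : Fin (n + 1)}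
    (hi : baryCoord y i ≠ 0) : polytopeVertex n i ∈ F := by
  obtain ⟨l, rfl⟩ := hF ⟨y, hy⟩
  have hnonneg (k : Fin (n + 1)) : 0 ≤ baryCoord y k :=
    baryCoord_nonneg_iff.2 (mem_projectiveSpacePolytope.1 hy.1 k)
  have hle (k : Fin (n + 1)) : l (polytopeVertex n k) ≤ l y :=
    hy.2 _ (polytopeVertex_mem_projectiveSpacePolytope k)
  have hsum : ∑ k, baryCoord y k * (l y - l (polytopeVertex n k)) = 0 := by
    have hly := congrArg l (sum_baryCoord_smul_polytopeVertex y)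
    simp only [map_sum, map_smul, smul_eq_mul] at hly
    simp only [mul_sub, Finset.sum_sub_distrib, ← Finset.sum_mul, sum_baryCoord, hly]
    ring
  have hzero := (Finset.sum_eq_zero_iff_of_nonneg fun k _ =>
    mul_nonneg (hnonneg k) (sub_nonneg.2 (hle k))).1 hsum i (Finset.mem_univ i)
  have heq : l y = l (polytopeVertex n i) :=
    sub_eq_zero.1 ((mul_eq_zero.1 hzero).resolve_left hi)
  exact ⟨polytopeVertex_mem_projectiveSpacePolytope i, fun z hz => (hy.2 z hz).trans heq.le⟩

theorem exists_eq_polytopeFace {F : Set (Fin n → ℝ)}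
    (hF : IsExposed ℝ (projectiveSpacePolytope n) F) : ∃ S, F = polytopeFace S := by
  classical
  have hconvex : Convex ℝ (projectiveSpacePolytope n) := by
    rw [projectiveSpacePolytope_eq]
    exact convex_setOf_facetFunctional_le
  refine ⟨Finset.univ.filter fun i => polytopeVertex n i ∈ F,
    Set.Subset.antisymm (fun y hy => ?_) ?_⟩
  · refine mem_polytopeFace_iff.2 ⟨hF.subset hy, fun i hi => ?_⟩
    simpa using polytopeVertex_mem_of_isExposed hF hy hi
  · rw [polytopeFace_eq_convexHull]
    refine convexHull_min ?_ (hF.convex hconvex)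
    rintro _ ⟨i, hi, rfl⟩
    simpa using hi

theorem affineIndependent_polytopeVertex : AffineIndependent ℝ (polytopeVertex n) := by
  rw [affineIndependent_iff]
  intro s w hw h k hk
  have hsum := congrArg (facetFunctional n k) h
  simp only [map_sum, map_smul, smul_eq_mul, facetFunctional_polytopeVertex, mul_sub, mul_one,
    Finset.sum_sub_distrib, hw, mul_ite, mul_zero, Finset.sum_ite_eq, hk, if_true,
    map_zero, zero_sub] at hsum
  exact (mul_eq_zero.1 (neg_eq_zero.1 hsum)).resolve_right (by positivity)

variable {u : Fin (n + 1) → ℕ}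

theorem labelVec_mem_projectiveSpacePolytope (hu : ∑ i, u i = n + 1) :
    labelVec n u ∈ projectiveSpacePolytope n :=
  mem_projectiveSpacePolytope.2 (facetFunctional_labelVec_le hu)

theorem labelVec_mem_polytopeFace_iff (hu : ∑ i, u i = n + 1) :
    labelVec n u ∈ polytopeFace S ↔ labelSupport u ⊆ S := by
  simp only [polytopeFace, Set.mem_ofPred_eq, labelVec_mem_projectiveSpacePolytope hu, true_and,
    facetFunctional_labelVec_eq_one_iff hu, not_imp_not, Finset.subset_iff]

theorem sInter_exposed_labelVec (hu : ∑ i, u i = n + 1) :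
    ⋂₀ {F : Set (Fin n → ℝ) | IsExposed ℝ (projectiveSpacePolytope n) F ∧ labelVec n u ∈ F} =
      polytopeFace (labelSupport u) := by
  refine Set.Subset.antisymm (Set.sInter_subset_of_mem
    ⟨isExposed_polytopeFace _, (labelVec_mem_polytopeFace_iff hu).2 le_rfl⟩) (Set.subset_sInter ?_)
  rintro F ⟨hF, hx⟩
  obtain ⟨S, rfl⟩ := exists_eq_polytopeFace hF
  exact polytopeFace_mono ((labelVec_mem_polytopeFace_iff hu).1 hx)

theorem faceDim_labelVec (hu : ∑ i, u i = n + 1) :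
    faceDim (projectiveSpacePolytope n) (labelVec n u) = (labelSupport u).card - 1 := by
  classical
  have hcard : 0 < (labelSupport u).card := by
    obtain ⟨i, -, hi⟩ := Finset.exists_ne_zero_of_sum_ne_zero (hu.trans_ne n.succ_ne_zero)
    exact Finset.card_pos.2 ⟨i, mem_labelSupport.2 hi⟩
  rw [faceDim, sInter_exposed_labelVec hu, polytopeFace_eq_convexHull, ← direction_affineSpan,
    affineSpan_convexHull, direction_affineSpan, ← Finset.coe_image]
  exact affineIndependent_polytopeVertex.finrank_vectorSpan_image_finset
    (Nat.succ_pred_eq_of_pos hcard).symm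

end Faces

section BoundaryComplex

variable {n : ℕ}

/-- The vertices of the facet opposite to the vertex with index `k`. -/
def boundaryFacet (n : ℕ) (k : Fin (n + 1)) : Finset (Fin (n + 1) → ℕ) :=
  (Finset.univ.erase k).image fun i => Pi.single i (n + 1)

/-- The boundary of the polytope as a simplicial complex: the sets of vertices which lie on a
common facet. -/
def boundaryComplex (n : ℕ) : Set (Finset (Fin (n + 1) → ℕ)) :=
  {s | ∃ k, s ⊆ boundaryFacet n k}

theorem mem_boundaryFacet {k : Fin (n + 1)} {v : Fin (n + 1) → ℕ} :
    v ∈ boundaryFacet n k ↔ ∃ i ≠ k, Pi.single i (n + 1) = v := by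
  simp [boundaryFacet]

theorem card_boundaryFacet (k : Fin (n + 1)) : (boundaryFacet n k).card = n := by
  rw [boundaryFacet, Finset.card_image_of_injective _ (single_injective n.succ_ne_zero)]
  simp

theorem facetFunctional_of_mem_boundaryFacet {k : Fin (n + 1)} {v : Fin (n + 1) → ℕ}
    (hv : v ∈ boundaryFacet n k) : facetFunctional n k (labelVec n v) = 1 := by
  obtain ⟨i, hi, rfl⟩ := mem_boundaryFacet.1 hv
  simp [facetFunctional_labelVec, hi.symm]

theorem exists_of_singleton_mem_boundaryComplex {v : Fin (n + 1) → ℕ}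
    (hv : {v} ∈ boundaryComplex n) : ∃ i, Pi.single i (n + 1) = v := by
  obtain ⟨k, hk⟩ := hv
  obtain ⟨i, -, hi⟩ := mem_boundaryFacet.1 (Finset.singleton_subset_iff.1 hk)
  exact ⟨i, hi⟩

theorem mem_boundaryComplex_iff {s : Finset (Fin (n + 1) → ℕ)} : s ∈ boundaryComplex n ↔
    ∃ S ≠ Finset.univ, (S.image fun i => Pi.single i (n + 1)) = s := by
  simp only [boundaryComplex, boundaryFacet, Set.mem_ofPred_eq, Finset.subset_image_iff,
    Finset.subset_erase, Finset.subset_univ, true_and, ne_eq, Finset.eq_univ_iff_forall, not_forall]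
  constructor
  · rintro ⟨k, S, hk, hS⟩
    exact ⟨S, ⟨k, hk⟩, hS⟩
  · rintro ⟨S, ⟨k, hk⟩, hS⟩
    exact ⟨k, S, hk, hS⟩

theorem hull_polytopeFace (S : Finset (Fin (n + 1))) :
    PointedCone.hull ℝ (polytopeFace S) = PointedCone.hull ℝ
      (labelVec n '' (S.image fun i => (Pi.single i (n + 1) : Fin (n + 1) → ℕ) : Finset _)) := by
  rw [polytopeFace_eq_convexHull, Finset.coe_image, Set.image_image]
  exact le_antisymm (Submodule.span_le.2 (convexHull_min Submodule.subset_span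
    (PointedCone.convex _))) (Submodule.span_mono (subset_convexHull ℝ _))

theorem faceFan_eq_fanCones :
    faceFan (projectiveSpacePolytope n) = fanCones (labelVec n) (boundaryComplex n) := by
  ext σ
  constructor
  · rintro ⟨F, hF, hne, rfl⟩
    obtain ⟨S, rfl⟩ := exists_eq_polytopeFace hF
    exact ⟨_, mem_boundaryComplex_iff.2
      ⟨S, fun h => hne (polytopeFace_eq_projectiveSpacePolytope_iff.2 h), rfl⟩, hull_polytopeFace S⟩
  · rintro ⟨s, hs, rfl⟩
    obtain ⟨S, hS, rfl⟩ := mem_boundaryComplex_iff.1 hs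
    exact ⟨polytopeFace S, isExposed_polytopeFace S,
      fun h => hS (polytopeFace_eq_projectiveSpacePolytope_iff.1 h), (hull_polytopeFace S).symm⟩

theorem facetFunctional_linearCombination {a : (Fin (n + 1) → ℕ) →₀ ℝ} {k j : Fin (n + 1)}
    (ha : a.support ⊆ boundaryFacet n k) :
    facetFunctional n j (Finsupp.linearCombination ℝ (labelVec n) a) =
      coeffSum a - a (Pi.single j (n + 1)) * (n + 1) := by
  have hvalue : ∀ v ∈ a.support, facetFunctional n j (labelVec n v) = 1 - v j := by
    intro v hv
    obtain ⟨i, -, rfl⟩ := mem_boundaryFacet.1 (ha hv)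
    exact facetFunctional_labelVec (by simp) j
  have hcoord : ∑ v ∈ a.support, a v * v j = a (Pi.single j (n + 1)) * (n + 1) := by
    rw [Finset.sum_eq_single (Pi.single j (n + 1))]
    · simp
    · intro v hv hne
      obtain ⟨i, -, rfl⟩ := mem_boundaryFacet.1 (ha hv)
      have hij : j ≠ i := fun h => hne (h ▸ rfl)
      simp [hij]
    · intro h
      rw [Finsupp.notMem_support_iff.1 h, zero_mul]
  rw [map_linearCombination, linearCombination_congr hvalue, coeffSum_apply, ← hcoord,
    ← Finset.sum_sub_distrib, Finsupp.linearCombination_apply, Finsupp.sum]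
  simp only [smul_eq_mul, mul_sub, mul_one]

theorem coeffSum_eq_facetFunctional {a : (Fin (n + 1) → ℕ) →₀ ℝ} {k : Fin (n + 1)}
    (ha : a.support ⊆ boundaryFacet n k) :
    coeffSum a = facetFunctional n k (Finsupp.linearCombination ℝ (labelVec n) a) := by
  have hk : a (Pi.single k (n + 1)) = 0 := by
    refine Finsupp.notMem_support_iff.1 fun h => ?_
    obtain ⟨i, hi, hik⟩ := mem_boundaryFacet.1 (ha h)
    exact hi (single_injective n.succ_ne_zero hik)
  rw [facetFunctional_linearCombination ha, hk, zero_mul, sub_zero]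

theorem facetFunctional_linearCombination_le {a : (Fin (n + 1) → ℕ) →₀ ℝ} {k : Fin (n + 1)}
    (ha : 0 ≤ a) (has : a.support ⊆ boundaryFacet n k) (j : Fin (n + 1)) :
    facetFunctional n j (Finsupp.linearCombination ℝ (labelVec n) a) ≤ coeffSum a := by
  rw [facetFunctional_linearCombination has]
  exact sub_le_self _ (mul_nonneg (ha _) (by positivity))

theorem boundaryComplex_unique {a b : (Fin (n + 1) → ℕ) →₀ ℝ} (ha : 0 ≤ a) (hb : 0 ≤ b)
    (has : a.support ∈ boundaryComplex n) (hbs : b.support ∈ boundaryComplex n)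
    (h : Finsupp.linearCombination ℝ (labelVec n) a =
      Finsupp.linearCombination ℝ (labelVec n) b) : a = b := by
  obtain ⟨k, hk⟩ := has
  obtain ⟨l, hl⟩ := hbs
  -- Both coefficient sums are the largest value of the facet functionals at the common vector.
  have hsum : coeffSum a = coeffSum b := by
    refine le_antisymm ?_ ?_
    · rw [coeffSum_eq_facetFunctional hk, h]
      exact facetFunctional_linearCombination_le hb hl k
    · rw [coeffSum_eq_facetFunctional hl, ← h]
      exact facetFunctional_linearCombination_le ha hk l
  have hn : (n + 1 : ℝ) ≠ 0 := by positivity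
  ext v
  by_cases hv : ∃ j, Pi.single j (n + 1) = v
  · obtain ⟨j, rfl⟩ := hv
    have hj := congrArg (facetFunctional n j) h
    rw [facetFunctional_linearCombination hk, facetFunctional_linearCombination hl, hsum] at hj
    exact mul_right_cancel₀ hn (sub_right_injective hj)
  · have hout (c : (Fin (n + 1) → ℕ) →₀ ℝ) (m : Fin (n + 1))
        (hc : c.support ⊆ boundaryFacet n m) : c v = 0 := by
      refine Finsupp.notMem_support_iff.1 fun hmem => hv ?_
      obtain ⟨i, -, hi⟩ := mem_boundaryFacet.1 (hc hmem)
      exact ⟨i, hi⟩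
    rw [hout a k hk, hout b l hl]

theorem boundaryComplex_exists_rep (y : Fin n → ℝ) : ∃ a : (Fin (n + 1) → ℕ) →₀ ℝ, 0 ≤ a ∧
    a.support ∈ boundaryComplex n ∧ Finsupp.linearCombination ℝ (labelVec n) a = y := by
  classical
  obtain ⟨k, hk⟩ := Finite.exists_max fun i => facetFunctional n i y
  refine ⟨∑ i, Finsupp.single (Pi.single i (n + 1))
    ((facetFunctional n k y - facetFunctional n i y) / (n + 1)),
    Finset.sum_nonneg fun i _ => Finsupp.single_nonneg.2
      (div_nonneg (sub_nonneg.2 (hk i)) (by positivity)), ⟨k, fun v hv => ?_⟩, ?_⟩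
  · obtain ⟨i, -, hi⟩ := Finset.mem_biUnion.1 (Finsupp.support_finsetSum hv)
    rw [Finsupp.mem_support_single] at hi
    refine mem_boundaryFacet.2 ⟨i, ?_, hi.1.symm⟩
    rintro rfl
    simp at hi
  · simp only [map_sum, Finsupp.linearCombination_single]
    exact (ofHomogeneous_eq_sum _).symm.trans (ofHomogeneous_sub_facetFunctional _ y)

theorem boundaryFacet_isStrictSupport (k : Fin (n + 1)) :
    IsStrictSupport (labelVec n) (boundaryComplex n) (fun _ => 1) (boundaryFacet n k)
      (facetFunctional n k) := by
  refine ⟨fun v hv => facetFunctional_of_mem_boundaryFacet hv, fun v hv hvk => ?_⟩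
  obtain ⟨i, rfl⟩ := exists_of_singleton_mem_boundaryComplex hv
  have hik : i = k := by_contra fun h => hvk (mem_boundaryFacet.2 ⟨i, h, rfl⟩)
  subst hik
  rw [facetFunctional_labelVec (by simp), Pi.single_eq_same]
  exact sub_lt_self 1 (by positivity)

theorem isBoundaryFan_boundaryComplex :
    IsBoundaryFan (facetFunctional n) (labelVec n) n (boundaryComplex n) where
  down := fun _ ⟨k, hk⟩ _ ht => ⟨k, ht.trans hk⟩
  finite := by
    have h : boundaryComplex n = ⋃ k, {s | s ⊆ boundaryFacet n k} := by
      ext s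
      simp [boundaryComplex]
    rw [h]
    exact Set.finite_iUnion fun k => (boundaryFacet n k).powerset.finite_toSet.subset
      fun s hs => Finset.mem_coe.2 (Finset.mem_powerset.2 hs)
  exists_rep := boundaryComplex_exists_rep
  unique _ _ := boundaryComplex_unique
  pure := fun _ ⟨k, hk⟩ => ⟨boundaryFacet n k, ⟨k, subset_rfl⟩, hk, card_boundaryFacet k⟩
  regular := by
    refine ⟨fun _ => 1, ?_⟩
    rintro s ⟨k, hk⟩ hs
    rw [Finset.eq_of_subset_of_card_le hk ((card_boundaryFacet k).trans hs.symm).le]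
    exact ⟨_, boundaryFacet_isStrictSupport k⟩
  facewise := fun _ ⟨k, hk⟩ => ⟨k, fun v hv => facetFunctional_of_mem_boundaryFacet (hk hv)⟩
  ray_le v hv i := by
    obtain ⟨j, rfl⟩ := exists_of_singleton_mem_boundaryComplex hv
    exact facetFunctional_labelVec_le (by simp) i

end BoundaryComplex

section BoundaryLatticePoints

variable {n : ℕ} {y : Fin n → ℝ} {u : Fin (n + 1) → ℕ}

theorem labelSupport_ne_univ_iff : labelSupport u ≠ Finset.univ ↔ ∃ i, u i = 0 := by
  simp [Finset.eq_univ_iff_forall]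

theorem support_vertexCoeffs_mem_boundaryComplex (hu : labelSupport u ≠ Finset.univ) :
    (vertexCoeffs (n + 1) u).support ∈ boundaryComplex n := by
  obtain ⟨k, hk⟩ := labelSupport_ne_univ_iff.1 hu
  refine ⟨k, fun r hr => ?_⟩
  obtain ⟨i, hi, rfl⟩ := exists_of_mem_support_vertexCoeffs hr
  exact mem_boundaryFacet.2 ⟨i, fun hik => mem_labelSupport.1 hi (hik ▸ hk), rfl⟩

theorem exists_int_facetFunctional (hy : IsLatticePoint y) (i : Fin (n + 1)) :
    ∃ z : ℤ, facetFunctional n i y = z := by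
  obtain ⟨m, hm⟩ := hy
  induction i using Fin.lastCases with
  | last => exact ⟨∑ j, m j, by simp [hm]⟩
  | cast j => exact ⟨-m j, by simp [hm]⟩

theorem exists_labelVec_eq_of_facetFunctional_le (hy : IsLatticePoint y) {c : ℤ}
    (hle : ∀ i, facetFunctional n i y ≤ c) (heq : ∃ i, facetFunctional n i y = c) :
    ∃ u, labelVec n u = y ∧ labelSupport u ≠ Finset.univ ∧ (∑ i, u i : ℤ) = (n + 1) * c := by
  choose z hz using exists_int_facetFunctional hy
  simp only [hz, Int.cast_le, Int.cast_inj] at hle heq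
  have hcast (i : Fin (n + 1)) : ((c - z i).toNat : ℤ) = c - z i :=
    Int.toNat_of_nonneg (sub_nonneg.2 (hle i))
  have hreal : realLabel (fun i => (c - z i).toNat) = fun i => c - facetFunctional n i y := by
    ext i
    rw [realLabel, hz]
    exact_mod_cast congrArg (Int.cast : ℤ → ℝ) (hcast i)
  have hsum : ∑ i, z i = 0 := by
    have h := sum_facetFunctional y
    simp only [hz] at h
    exact_mod_cast h
  refine ⟨fun i => (c - z i).toNat, ?_, labelSupport_ne_univ_iff.2 ?_, ?_⟩
  · rw [labelVec, hreal, ofHomogeneous_sub_facetFunctional]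
  · exact heq.imp fun i hi => by simp [hi]
  · simp [hcast, Finset.sum_sub_distrib, hsum]

theorem exists_labelVec_eq (hy : IsLatticePoint y) :
    ∃ u, labelVec n u = y ∧ labelSupport u ≠ Finset.univ ∧ n + 1 ∣ ∑ i, u i := by
  obtain ⟨k, hk⟩ := Finite.exists_max fun i => facetFunctional n i y
  obtain ⟨c, hc⟩ := exists_int_facetFunctional hy k
  obtain ⟨u, huy, hus, hsum⟩ :=
    exists_labelVec_eq_of_facetFunctional_le hy (fun i => (hk i).trans_eq hc) ⟨k, hc⟩
  exact ⟨u, huy, hus, by exact_mod_cast Dvd.intro c hsum.symm⟩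

theorem isLatticePoint_and_mem_frontier_iff :
    IsLatticePoint y ∧ y ∈ frontier (projectiveSpacePolytope n) ↔
      ∃ u, (∑ i, u i = n + 1 ∧ labelSupport u ≠ Finset.univ) ∧ labelVec n u = y := by
  rw [mem_frontier_projectiveSpacePolytope]
  constructor
  · rintro ⟨hy, hle, heq⟩
    obtain ⟨u, huy, hus, hsum⟩ :=
      exists_labelVec_eq_of_facetFunctional_le hy (c := 1) (by simpa using hle) (by simpa using heq)
    exact ⟨u, ⟨by exact_mod_cast hsum.trans (mul_one _), hus⟩, huy⟩
  · rintro ⟨u, ⟨hsum, hus⟩, rfl⟩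
    obtain ⟨i, hi⟩ := labelSupport_ne_univ_iff.1 hus
    exact ⟨isLatticePoint_labelVec hsum, facetFunctional_labelVec_le hsum,
      i, (facetFunctional_labelVec_eq_one_iff hsum).2 (notMem_labelSupport.2 hi)⟩

/-- The labels of the lattice points on the boundary of the polytope, in the order in which their
rays are inserted into the fan. -/
noncomputable def boundaryLabels (n : ℕ) : List (Fin (n + 1) → ℕ) :=
  latticePoints (n + 1) (Finset.univ.erase Finset.univ)

theorem mem_boundaryLabels :
    u ∈ boundaryLabels n ↔ ∑ i, u i = n + 1 ∧ labelSupport u ≠ Finset.univ := by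
  rw [boundaryLabels, mem_latticePoints]
  simp only [Finset.mem_erase, Finset.mem_univ, and_true]
  refine ⟨fun h => ⟨h.2.2, h.1⟩, fun h => ⟨h.2, ?_, h.1⟩⟩
  obtain ⟨i, -, hi⟩ := Finset.exists_ne_zero_of_sum_ne_zero (h.1.trans_ne n.succ_ne_zero)
  exact ⟨i, mem_labelSupport.2 hi⟩

theorem nodup_map_labelVec_boundaryLabels : ((boundaryLabels n).map (labelVec n)).Nodup :=
  (nodup_latticePoints _ _).map_on fun _ hu _ hv h =>
    injOn_labelVec (mem_boundaryLabels.1 hu).1 (mem_boundaryLabels.1 hv).1 h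

theorem mem_map_labelVec_boundaryLabels : y ∈ (boundaryLabels n).map (labelVec n) ↔
    IsLatticePoint y ∧ y ∈ frontier (projectiveSpacePolytope n) := by
  simp only [List.mem_map, mem_boundaryLabels, isLatticePoint_and_mem_frontier_iff]

theorem pairwise_faceDim_map_labelVec_boundaryLabels :
    ((boundaryLabels n).map (labelVec n)).Pairwise fun v w =>
      faceDim (projectiveSpacePolytope n) w ≤ faceDim (projectiveSpacePolytope n) v := by
  refine List.pairwise_map.2 ((pairwise_latticePoints _ _).imp_of_mem fun hu hv h => ?_)
  rw [faceDim_labelVec (mem_boundaryLabels.1 hu).1, faceDim_labelVec (mem_boundaryLabels.1 hv).1]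
  exact Nat.sub_le_sub_right h 1

theorem isNatural_foldl_subdivide_boundaryLabels (hu : n + 1 ∣ ∑ i, u i)
    (hus : labelSupport u ≠ Finset.univ) :
    IsNatural ((boundaryLabels n).foldl subdivide (vertexCoeffs (n + 1)) u) := by
  refine isNatural_foldl_subdivide n.succ_ne_zero (pairwise_sortedByCard _) hu fun S hS _ _ => ?_
  simp only [mem_sortedByCard, Finset.mem_erase, Finset.mem_univ, and_true]
  rintro rfl
  exact hus (Finset.univ_subset_iff.1 hS)

theorem exists_isBoundaryFan_foldl_starSubdivision (n : ℕ) :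
    ∃ K, IsBoundaryFan (facetFunctional n) (labelVec n) n K ∧
      (∀ v, {v} ∈ K → IsLatticePoint (labelVec n v)) ∧
      (∀ y, IsLatticePoint y → ∃ a, 0 ≤ a ∧ a.support ∈ K ∧
        Finsupp.linearCombination ℝ (labelVec n) a = y ∧ IsNatural a) ∧
      fanCones (labelVec n) K = ((boundaryLabels n).map (labelVec n)).foldl starSubdivision
        (faceFan (projectiveSpacePolytope n)) := by
  have hrep : Represents (labelVec n) (vertexCoeffs (n + 1)) :=
    represents_vertexCoeffs n.succ_ne_zero (ofHomogeneous n)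
  have hfrontier (v) (hv : v ∈ boundaryLabels n) := isLatticePoint_and_mem_frontier_iff.2
    ⟨v, mem_boundaryLabels.1 hv, rfl⟩
  simp only [mem_frontier_projectiveSpacePolytope] at hfrontier
  obtain ⟨K, hK, hlat, hsupp, hfan⟩ := isBoundaryFan_boundaryComplex.exists_foldl
    (L := boundaryLabels n) (U := {u | labelSupport u ≠ Finset.univ})
    (fun v hv => by
      obtain ⟨i, rfl⟩ := exists_of_singleton_mem_boundaryComplex hv
      exact isLatticePoint_polytopeVertex i)
    hrep (fun _ => support_vertexCoeffs_mem_boundaryComplex)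
    (fun v hv => (mem_boundaryLabels.1 hv).2) (fun v hv => (hfrontier v hv).1)
    (fun v hv => (hfrontier v hv).2.1) (fun v hv => (hfrontier v hv).2.2)
  refine ⟨K, hK, hlat, fun y hy => ?_, hfan.trans (by rw [faceFan_eq_fanCones])⟩
  obtain ⟨u, rfl, hus, hsum⟩ := exists_labelVec_eq hy
  obtain ⟨hnonneg, hlc⟩ := hrep.foldl_subdivide (boundaryLabels n) u
  exact ⟨_, hnonneg, hsupp u hus, hlc, isNatural_foldl_subdivide_boundaryLabels hsum hus⟩

theorem exists_isRegularProjectiveTriangulation (n : ℕ) :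
    ∃ T, IsRegularProjectiveTriangulation T (projectiveSpacePolytope n) ∧
      triangulationFan T = ((boundaryLabels n).map (labelVec n)).foldl starSubdivision
        (faceFan (projectiveSpacePolytope n)) := by
  obtain ⟨K, hK, hlat, hnat, hfan⟩ := exists_isBoundaryFan_foldl_starSubdivision n
  refine ⟨hK.triangulation, ⟨?_, hK.isUnimodular hlat hnat, ?_, fun _ => hK.zero_mem_of_mem_facets⟩,
    hK.triangulationFan_eq.trans hfan⟩
  · simpa only [projectiveSpacePolytope_eq] using hK.isLatticeTriangulation hlat
  · simpa only [projectiveSpacePolytope_eq] using hK.isCoherent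

end BoundaryLatticePoints

end ToricTriangulation

open ToricTriangulation in
theorem mainTheorem8 (n : ℕ) :
    ToricTriangulation.IsReflexive (ToricTriangulation.projectiveSpacePolytope n) ∧
    ∃ T : Geometry.SimplicialComplex ℝ (Fin n → ℝ),
      ToricTriangulation.IsRegularProjectiveTriangulation T
        (ToricTriangulation.projectiveSpacePolytope n) ∧
      ∃ L : List (Fin n → ℝ),
        L.Nodup ∧
        (∀ v, v ∈ L ↔ ToricTriangulation.IsLatticePoint v ∧
          v ∈ frontier (ToricTriangulation.projectiveSpacePolytope n)) ∧
        L.Pairwise (fun v w =>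
          ToricTriangulation.faceDim (ToricTriangulation.projectiveSpacePolytope n) w ≤
            ToricTriangulation.faceDim (ToricTriangulation.projectiveSpacePolytope n) v) ∧
        ToricTriangulation.triangulationFan T =
          L.foldl ToricTriangulation.starSubdivision
            (ToricTriangulation.faceFan (ToricTriangulation.projectiveSpacePolytope n)) := by
  obtain ⟨T, hT, hfan⟩ := exists_isRegularProjectiveTriangulation n
  exact ⟨isReflexive_projectiveSpacePolytope, T, hT, (boundaryLabels n).map (labelVec n),
    nodup_map_labelVec_boundaryLabels, fun _ => mem_map_labelVec_boundaryLabels,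
    pairwise_faceDim_map_labelVec_boundaryLabels, hfan⟩
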